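/- Functions on $S^1=\mathbb R/\mathbb Z$ are $1$-periodic functions on the line. Let $s\in(1/2,\infty]$, where $H^\infty=C^\infty$. Let $\mathrm{Dens}^s(S^1)=\{\rho\in H^s(S^1):\rho>0,\ \int\rho\,dx=1\}$ and $T^*\mathrm{Dens}^s(S^1)=\mathrm{Dens}^s(S^1)\times H^s(S^1)/\mathbb R$. A tangent vector of $T^*\mathrm{Dens}^s(S^1)$ at $(\rho,[\theta])$ is a pair $(\dot\rho,\dot\theta)\in H^s\times H^s$ with $\int\dot\rho\,dx=0$, where $\dot\theta$ is the representative of its coset modulo constants with $\int\dot\theta\rho\,dx=0$. The Sasaki–Fisher–Rao metric is $$\mathsf G^*_{(\rho,[\theta])}\big((\dot\rho,\dot\theta),(\dot\rho,\dot\theta)\big)=\frac14\int_{S^1}\Big(\frac{\dot\rho^2}{\rho}+\dot\theta^2\rho\Big)dx .$$ A geodesic of it is a $C^2$ curve that is a critical point of the energy on every compact time interval under variations with fixed end points. Let $\mathcal D$ be the set of pairs $(\varphi,\alpha)$, where $\varphi$ is (the lift to $\mathbb R$ of) an orientation preserving diffeomorphism of $S^1$ of class $H^{s+1}$ and $\alpha:S^1\to\mathbb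 R/2\pi\mathbb Z$ is a null-homotopic map of class $H^s$. It carries the product $(\varphi,\alpha)(\eta,\beta)=(\varphi\circ\eta,\beta+\alpha\circ\eta)$. For a prescribed point $x_0$ let $\mathcal G=\{(\varphi,\alpha)\in\mathcal D:\varphi(x_0)=x_0\}$. Let $\langle\cdot,\cdot\rangle_{\dot H^1}$ be the right-invariant form with $\langle (v,\sigma),(v,\sigma)\rangle_{\dot H^1}=\frac14\int((v')^2+\sigma^2)\,dx$ at the identity. Let $\Psi(\varphi,\alpha)=(\varphi',[\theta])\in T^*\mathrm{Dens}^s(S^1)$ with $\theta(x)=\int_0^x\alpha'$, that is, $\theta$ is a real lift of $\alpha$ up to a constant. Let $I$ be an open time interval and $t_0\in I$. A pair $(v,\sigma)$ of periodic functions on $I\times S^1$ is called the Eulerian velocity of a $C^2$ curve $(\varphi,\alpha)$ in $\mathcal D$ over $I$ if $\dot\varphi=v\circ\varphi$ and $\dot\alpha=\sigma\circ\varphi$. The two-component Hunter–Saxton equation is $$\dot v''=-2v'v''-vv'''+\sigma\sigma',\qquad \dot\sigma=-(\sigma v)' ,$$ understood in the sense of distributions on $I\times S^1$, with $2v'v''+vv'''=(vv')''-\frac12((v')^2)'$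 and $\sigma\sigma'=\frac12(\sigma^2)'$. **Proposition.** 1. If $t\mapsto g(t)=(\varphi,\alpha)$ is a $C^1$ curve in $\mathcal D$ over $I$, then $\Psi\circ g$ is a $C^1$ curve in $T^*\mathrm{Dens}^s(S^1)$, and at every time at which $\sigma=\dot\alpha\circ\varphi^{-1}$ satisfies $\int\sigma\,dx=0$ the squared length of its velocity in the metric $\mathsf G^*$ equals $\langle\dot g,\dot g\rangle_{\dot H^1}=\frac14\int((v')^2+\sigma^2)\,dx$, where $v=\dot\varphi\circ\varphi^{-1}$. Thus on vectors with $\int\sigma\,dx=0$ the $\dot H^1$-metric is the pullback of $\mathsf G^*$ by $\Psi$. 2. Let $(v,\sigma)$ be the Eulerian velocity of a $C^2$ curve $g$ in $\mathcal D$ over $I$. Then $(v,\sigma)$ solves the two-component Hunter–Saxton equation with $\int\sigma(t_0,x)\,dx=0$ if and only if $\Psi\circ g$ is a geodesic of $\mathsf G^*$ and $\int\sigma(t,x)\,dx=0$ for all $t\in I$. If $s>5/2$, then $(v,\sigma)$ solves the equation in the sense of distributions if and only if $v(t,\cdot)$ is $C^3$ and $\sigma(t,\cdot)$ is $C^1$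 for every $t\in I$ and the equation holds pointwise. 3. For every geodesic $\gamma$ of $\mathsf G^*$ over $I$ there is a $C^2$ curve $g$ in $\mathcal G$ with $\Psi\circ g=\gamma$ on $I$ whose Eulerian velocity $(v,\sigma)$ solves the two-component Hunter–Saxton equation and satisfies $\int\sigma(t,x)\,dx=0$ for all $t\in I$. The pair $(v,\sigma)$ is unique: it is the Eulerian velocity of every $C^2$ curve in $\mathcal G$ over $I$ that $\Psi$ maps to $\gamma$ and whose Eulerian velocity has $\int\sigma(t,x)\,dx=0$ for all $t\in I$. -/

import Mathlib

open MeasureTheory Set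

noncomputable section

namespace HunterSaxton

/-! ### Sobolev spaces on the circle `S¹ = ℝ/ℤ`

Functions on `S¹` are `1`-periodic functions on the line; for exponents above `1/2` a function of
class `H^r` is identified with its continuous representative. -/

/-- The `n`-th Fourier coefficient of a real function on `[0,1]`. -/
def coeff (f : ℝ → ℝ) (n : ℤ) : ℂ :=
  fourierCoeffOn (zero_lt_one' ℝ) (fun x => (f x : ℂ)) n

theorem coeff_add {f g : ℝ → ℝ} (hf : Continuous f) (hg : Continuous g) (n : ℤ) :
    coeff (f + g) n = coeff f n + coeff g n := by
  unfold coeff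
  simp only [fourierCoeffOn_eq_integral]
  rw [← smul_add, ← intervalIntegral.integral_add]
  · congr 2
    ext x
    simp [mul_add]
  · apply Continuous.intervalIntegrable
    simp only [fourier_coe_apply]
    fun_prop
  · apply Continuous.intervalIntegrable
    simp only [fourier_coe_apply]
    fun_prop

theorem coeff_smul (c : ℝ) (f : ℝ → ℝ) (n : ℤ) : coeff (c • f) n = c * coeff f n := by
  unfold coeff
  rw [← fourierCoeffOn.const_mul]
  congr 1
  ext x
  simp

/-- The weight `(1 + n²)^(r/2)` of the Fourier mode `n` in the norm of `H^r`. -/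
def weight (r : ℝ) (n : ℤ) : ℝ := (1 + (n : ℝ) ^ 2) ^ (r / 2)

theorem weight_pos (r : ℝ) (n : ℤ) : 0 < weight r n := by
  unfold weight; positivity

/-- The weighted sequence of Fourier coefficients. -/
def wcoeff (r : ℝ) (f : ℝ → ℝ) (n : ℤ) : ℂ := (weight r n : ℂ) * coeff f n

/-- The Sobolev space `H^r(S¹)`, for a finite real exponent: periodic (continuous) functions with
`∑ (1 + n²)^r |f̂(n)|² < ∞`. -/
def HsReal (r : ℝ) : Submodule ℝ (ℝ → ℝ) where
  carrier := {f | Continuous f ∧ Function.Periodic f 1 ∧ Memℓp (wcoeff r f) 2}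
  zero_mem' := by
    refine ⟨continuous_const, fun x => rfl, ?_⟩
    have : wcoeff r 0 = 0 := by
      ext n
      have := coeff_smul 0 0 n
      simp at this
      simp [wcoeff, this]
    rw [this]
    exact zero_memℓp
  add_mem' := by
    rintro f g ⟨hf, hfp, hfs⟩ ⟨hg, hgp, hgs⟩
    refine ⟨hf.add hg, hfp.add hgp, ?_⟩
    have : wcoeff r (f + g) = wcoeff r f + wcoeff r g := by
      ext n
      simp [wcoeff, coeff_add hf hg, mul_add]
    rw [this]
    exact hfs.add hgs
  smul_mem' := by
    rintro c f ⟨hf, hfp, hfs⟩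
    refine ⟨hf.const_smul c, hfp.smul c, ?_⟩
    have : wcoeff r (c • f) = c • wcoeff r f := by
      ext n
      simp [wcoeff, coeff_smul, mul_left_comm]
    rw [this]
    exact hfs.const_smul c

/-- The weighted Fourier coefficients as a linear map into `ℓ²`. -/
def toL2 (r : ℝ) : HsReal r →ₗ[ℝ] lp (fun _ : ℤ => ℂ) 2 where
  toFun f := ⟨wcoeff r f, f.2.2.2⟩
  map_add' f g := by
    ext n
    change wcoeff r ((f : ℝ → ℝ) + (g : ℝ → ℝ)) n = wcoeff r f n + wcoeff r g n
    simp [wcoeff, coeff_add f.2.1 g.2.1, mul_add]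
  map_smul' c f := by
    ext n
    change wcoeff r (c • (f : ℝ → ℝ)) n = c • wcoeff r f n
    simp [wcoeff, coeff_smul, mul_left_comm]

theorem toL2_injective (r : ℝ) : Function.Injective (toL2 r) := by
  rw [← LinearMap.ker_eq_bot, LinearMap.ker_eq_bot']
  rintro ⟨f, hc, hp, hs⟩ h0
  have hz : ∀ n, coeff f n = 0 := by
    intro n
    have h1 : wcoeff r f n = 0 := congrArg (fun u : lp (fun _ : ℤ => ℂ) 2 => u n) h0
    have h2 : (weight r n : ℂ) ≠ 0 := by exact_mod_cast (weight_pos r n).ne'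
    exact (mul_eq_zero.mp h1).resolve_left h2
  have hcc : Continuous (fun x => (f x : ℂ)) := by fun_prop
  have hm : MemLp (fun x => (f x : ℂ)) 2 (volume.restrict (Ioc (0 : ℝ) 1)) := by
    have hb := (isCompact_Icc (a := (0 : ℝ)) (b := 1)).exists_bound_of_continuousOn
      hcc.continuousOn
    obtain ⟨C, hC⟩ := hb
    refine MemLp.of_bound hcc.aestronglyMeasurable C ?_
    filter_upwards [ae_restrict_mem measurableSet_Ioc] with x hx
    exact hC x (Ioc_subset_Icc_self hx)
  have hP := tsum_sq_fourierCoeffOn (zero_lt_one' ℝ) hm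
  have hz' : ∀ n, fourierCoeffOn (zero_lt_one' ℝ) (fun x => (f x : ℂ)) n = 0 := hz
  simp only [hz'] at hP
  simp at hP
  have hzero : ∀ x ∈ Icc (0 : ℝ) 1, f x = 0 := by
    intro x hx
    by_contra hne
    have : 0 < ∫ y in (0 : ℝ)..1, f y ^ 2 :=
      intervalIntegral.integral_pos zero_lt_one (by fun_prop) (fun y _ => sq_nonneg _)
        ⟨x, hx, by positivity⟩
    linarith
  ext x
  obtain ⟨y, hy, hxy⟩ := hp.exists_mem_Ico₀ zero_lt_one x
  simp only [ZeroMemClass.coe_zero, Pi.zero_apply]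
  rw [hxy]
  exact hzero y (Ico_subset_Icc_self hy)

/-- `H^r(S¹)` as a normed space, with `‖f‖² = ∑ (1 + n²)^r |f̂(n)|²`. -/
def HsSpace (r : ℝ) : Type := HsReal r

instance (r : ℝ) : AddCommGroup (HsSpace r) := inferInstanceAs (AddCommGroup (HsReal r))

instance (r : ℝ) : Module ℝ (HsSpace r) := inferInstanceAs (Module ℝ (HsReal r))

/-- `toL2`, as a map on the type `HsSpace r`. -/
def HsSpace.toL2 (r : ℝ) : HsSpace r →ₗ[ℝ] lp (fun _ : ℤ => ℂ) 2 := HunterSaxton.toL2 r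

instance (r : ℝ) : NormedAddCommGroup (HsSpace r) :=
  NormedAddCommGroup.induced _ _ (HsSpace.toL2 r) (toL2_injective r)

instance (r : ℝ) : NormedSpace ℝ (HsSpace r) := NormedSpace.induced ℝ _ _ (HsSpace.toL2 r)

/-- The periodic function underlying an element of `H^r(S¹)`. -/
def HsSpace.toFun {r : ℝ} (f : HsSpace r) : ℝ → ℝ := f.1

/-- The space `H^s(S¹)` for `s` real or `s = ∞`; for real `s` it is `HsReal s`, and for `s = ⊤`
it is the intersection of all `H^r`, that is `C^∞(S¹)`. -/
def Hs (s : WithTop ℝ) : Submodule ℝ (ℝ → ℝ) := ⨅ (r : ℝ) (_ : (r : WithTop ℝ) ≤ s), HsReal r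

theorem mem_Hs {s : WithTop ℝ} {f : ℝ → ℝ} :
    f ∈ Hs s ↔ ∀ r : ℝ, (r : WithTop ℝ) ≤ s → f ∈ HsReal r := by
  simp [Hs, Submodule.mem_iInf]

theorem weight_mul_coeff_deriv_le {f : ℝ → ℝ} (hf : ContDiff ℝ 1 f) (hp : Function.Periodic f 1)
    (r : ℝ) (n : ℤ) :
    ‖wcoeff r (deriv f) n‖ ≤ ‖((2 * Real.pi : ℝ) : ℂ) * wcoeff (r + 1) f n‖ := by
  have hw : weight (r + 1) n = weight r n * (1 + (n : ℝ) ^ 2) ^ (1 / 2 : ℝ) := by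
    unfold weight
    rw [← Real.rpow_add (by positivity)]
    congr 1
    ring
  have hn : |(n : ℝ)| ≤ (1 + (n : ℝ) ^ 2) ^ (1 / 2 : ℝ) := by
    rw [← Real.sqrt_eq_rpow]
    apply Real.abs_le_sqrt
    linarith
  have hd : ∀ x, HasDerivAt f (deriv f x) x := fun x =>
    (hf.differentiable one_ne_zero x).hasDerivAt
  have hdc : Continuous (deriv f) := hf.continuous_deriv le_rfl
  have key : ‖coeff (deriv f) n‖ = 2 * Real.pi * |(n : ℝ)| * ‖coeff f n‖ := by
    have hper : f 1 = f 0 := by simpa using hp 0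
    by_cases h0 : n = 0
    · subst h0
      have hint : ∫ x in (0 : ℝ)..1, deriv f x = 0 := by
        rw [intervalIntegral.integral_eq_sub_of_hasDerivAt (fun x _ => hd x)
          (hdc.intervalIntegrable _ _), hper, sub_self]
      have : coeff (deriv f) 0 = 0 := by
        unfold coeff
        rw [fourierCoeffOn_eq_integral]
        simp [intervalIntegral.integral_ofReal, hint]
      simp [this]
    · have h := fourierCoeffOn_of_hasDerivAt (zero_lt_one' ℝ) (f := fun x => (f x : ℂ))
        (f' := fun x => ((deriv f x : ℝ) : ℂ)) (n := n) h0 (fun x _ => HasDerivAt.ofReal_comp (hd x))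
        ((Complex.continuous_ofReal.comp hdc).intervalIntegrable _ _)
      have h' : coeff f n = 1 / (-2 * Real.pi * Complex.I * n) * (-coeff (deriv f) n) := by
        unfold coeff
        rw [h, hper]
        simp
      have hn0 : (n : ℂ) ≠ 0 := by exact_mod_cast h0
      have hpi : (Real.pi : ℂ) ≠ 0 := by exact_mod_cast Real.pi_ne_zero
      have h'' : coeff (deriv f) n = 2 * Real.pi * Complex.I * n * coeff f n := by
        rw [h']
        have := Complex.I_ne_zero
        field_simp
      rw [h'']
      simp [abs_of_pos Real.pi_pos]
  have h1 : ‖wcoeff r (deriv f) n‖ = weight r n * ‖coeff (deriv f) n‖ := by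
    rw [wcoeff, norm_mul, Complex.norm_real, Real.norm_of_nonneg (weight_pos r n).le]
  have h2 : ‖((2 * Real.pi : ℝ) : ℂ) * wcoeff (r + 1) f n‖
      = 2 * Real.pi * (weight (r + 1) n * ‖coeff f n‖) := by
    rw [wcoeff, norm_mul, norm_mul, Complex.norm_real, Complex.norm_real,
      Real.norm_of_nonneg (weight_pos (r + 1) n).le, Real.norm_of_nonneg (by positivity)]
  rw [h1, h2, key, hw]
  have h0 : 0 ≤ weight r n * (2 * Real.pi) * ‖coeff f n‖ := by
    have := (weight_pos r n).le
    positivity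
  have h3 := mul_le_mul_of_nonneg_left hn h0
  calc weight r n * (2 * Real.pi * |(n : ℝ)| * ‖coeff f n‖)
      = weight r n * (2 * Real.pi) * ‖coeff f n‖ * |(n : ℝ)| := by ring
    _ ≤ weight r n * (2 * Real.pi) * ‖coeff f n‖ * (1 + (n : ℝ) ^ 2) ^ (1 / 2 : ℝ) := h3
    _ = _ := by ring

/-- The derivative maps `C¹` functions of class `H^(s+1)` to `H^s`. -/
theorem deriv_mem_Hs {s : WithTop ℝ} {f : ℝ → ℝ} (hf : ContDiff ℝ 1 f) (hp : Function.Periodic f 1)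
    (h : f ∈ Hs (s + 1)) : deriv f ∈ Hs s := by
  rw [mem_Hs] at h ⊢
  intro r hr
  have h1 := h (r + 1) (by
    rw [WithTop.coe_add, WithTop.coe_one]
    gcongr)
  refine ⟨hf.continuous_deriv le_rfl, fun x => ?_, ?_⟩
  · rw [← deriv_comp_add_const]
    congr 1
    ext y
    exact hp y
  · have h2 := h1.2.2
    have h3 : Memℓp (fun n => ((2 * Real.pi : ℝ) : ℂ) * wcoeff (r + 1) f n) 2 :=
      h2.const_mul _
    apply memℓp_gen
    have h4 := (memℓp_gen_iff (by norm_num)).mp h3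
    refine h4.of_nonneg_of_le (fun n => by positivity) (fun n => ?_)
    exact Real.rpow_le_rpow (norm_nonneg _) (weight_mul_coeff_deriv_le hf hp r n) (by norm_num)

/-! ### Time-dependent functions -/

/-- Partial derivative in time. -/
def dt (u : ℝ → ℝ → ℝ) (t x : ℝ) : ℝ := deriv (fun τ => u τ x) t

/-- Partial derivative in space. -/
def dx (u : ℝ → ℝ → ℝ) (t x : ℝ) : ℝ := deriv (u t) x

/-- `t ↦ u t` is a curve of class `C^k` in `H^s(S¹)` over the open interval `I`
(in the Fréchet sense, for `s = ∞`). -/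
def IsCurve (k : ℕ) (s : WithTop ℝ) (I : Set ℝ) (u : ℝ → ℝ → ℝ) : Prop :=
  ∀ r : ℝ, 1 / 2 < r → (r : WithTop ℝ) ≤ s →
    ∃ U : ℝ → HsSpace r, ContDiffOn ℝ k U I ∧ ∀ t ∈ I, (U t).toFun = u t

/-! ### The cotangent bundle of the space of densities -/

/-- The space `Dens^s(S¹)` of positive probability densities of class `H^s`. -/
def Dens (s : WithTop ℝ) : Set (Hs s) :=
  {ρ | (∀ x, 0 < (ρ : ℝ → ℝ) x) ∧ ∫ x in (0 : ℝ)..1, (ρ : ℝ → ℝ) x = 1}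

/-- The constant functions in `H^s(S¹)`. -/
def constants (s : WithTop ℝ) : Submodule ℝ (Hs s) :=
  (Submodule.span ℝ {fun _ : ℝ => (1 : ℝ)}).comap (Hs s).subtype

/-- `T*Dens^s(S¹) = Dens^s(S¹) × H^s(S¹)/ℝ`. -/
abbrev CotDens (s : WithTop ℝ) : Type := Dens s × (Hs s ⧸ constants s)

/-- The density component of a point of `T*Dens^s(S¹)`. -/
def CotDens.density {s : WithTop ℝ} (p : CotDens s) : ℝ → ℝ := ((p.1 : Hs s) : ℝ → ℝ)

/-- `Θ` is a lift of class `C^k` of the curve `γ = (ρ, [θ])`: `ρ` is a `C^k` curve in `H^s` and `Θ`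
is a `C^k` curve in `H^s` with `[Θ] = [θ]`. -/
def IsLift {s : WithTop ℝ} (k : ℕ) (I : Set ℝ) (γ : ℝ → CotDens s) (Θ : ℝ → Hs s) : Prop :=
  IsCurve k s I (fun t => (γ t).density) ∧ IsCurve k s I (fun t => (Θ t : ℝ → ℝ)) ∧
    ∀ t ∈ I, (constants s).mkQ (Θ t) = (γ t).2

/-- `γ` is a curve of class `C^k` in `T*Dens^s(S¹)`. -/
def IsCotCurve {s : WithTop ℝ} (k : ℕ) (I : Set ℝ) (γ : ℝ → CotDens s) : Prop :=
  ∃ Θ : ℝ → Hs s, IsLift k I γ Θ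

/-- The representative of the coset of `θd` whose integral against `ρ` vanishes (when `ρ` is a
probability density). -/
def normalize (ρ θd : ℝ → ℝ) : ℝ → ℝ := fun x => θd x - ∫ y in (0 : ℝ)..1, θd y * ρ y

/-- The Sasaki–Fisher–Rao metric (as a quadratic form) at a point over `ρ`, on a tangent vector
`(ρd, θd)` with `∫ ρd = 0` and `∫ θd ρ = 0`. -/
def sasaki (ρ ρd θd : ℝ → ℝ) : ℝ :=
  1 / 4 * ∫ x in (0 : ℝ)..1, (ρd x ^ 2 / ρ x + θd x ^ 2 * ρ x)

/-- `(ρd, θd)` is the velocity at time `t` of the `C¹` curve `γ` in `T*Dens^s(S¹)`, where `θd`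
is normalized by `∫ θd ρ = 0`. -/
def IsVelocity {s : WithTop ℝ} (I : Set ℝ) (γ : ℝ → CotDens s) (t : ℝ) (ρd θd : ℝ → ℝ) : Prop :=
  ∃ Θ : ℝ → Hs s, IsLift 1 I γ Θ ∧ ρd = dt (fun τ => (γ τ).density) t ∧
    θd = normalize (γ t).density (dt (fun τ => (Θ τ : ℝ → ℝ)) t)

/-- The energy over `[a, b]` of the curve `t ↦ (ρ t, [Θ t])` for the Sasaki–Fisher–Rao metric. -/
def energy (a b : ℝ) (ρ Θ : ℝ → ℝ → ℝ) : ℝ :=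
  ∫ t in a..b, sasaki (ρ t) (dt ρ t) (normalize (ρ t) (dt Θ t))

/-- `γ` is a geodesic of the Sasaki–Fisher–Rao metric on the open interval `I`: a `C²` curve which
is a critical point of the energy on every compact subinterval `[a, b]` under variations with fixed
end points.  As `T*Dens^s` is an open subset of an affine space (modulo constants in `θ`), a
variation is given by `(ρ + ε r, [Θ + ε h])` with `∫ r = 0`. -/
def IsGeodesic {s : WithTop ℝ} (I : Set ℝ) (γ : ℝ → CotDens s) : Prop :=
  ∃ Θ : ℝ → Hs s, IsLift 2 I γ Θ ∧
    ∀ a b : ℝ, a < b → Icc a b ⊆ I → ∀ r h : ℝ → ℝ → ℝ,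
      IsCurve 2 s I r → IsCurve 2 s I h → (∀ t ∈ I, ∫ x in (0 : ℝ)..1, r t x = 0) →
      r a = 0 → r b = 0 → h a = 0 → h b = 0 →
      HasDerivAt (fun ε : ℝ => energy a b (fun t x => (γ t).density x + ε * r t x)
        (fun t x => (Θ t : ℝ → ℝ) x + ε * h t x)) 0 0

/-! ### The semidirect product -/

/-- Pairs `(φ, α)` of an orientation preserving diffeomorphism `φ` of the circle of class `H^(s+1)`,
given by a lift to the line, and a null-homotopic map `α : S¹ → ℝ/2πℤ` of class `H^s`, which is
one that lifts to a function in `H^s(S¹)`.  A diffeomorphism of the circle fixing the point `x₀`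
has exactly one lift with `φ x₀ = x₀`.
The product is `(φ, α)(η, β) = (φ ∘ η, β + α ∘ η)`. -/
structure SemiDirect (s : WithTop ℝ) where
  φ : ℝ → ℝ
  contDiff_φ : ContDiff ℝ 1 φ
  periodic_φ : Function.Periodic (fun x => φ x - x) 1
  mem_φ : (fun x => φ x - x) ∈ Hs (s + 1)
  deriv_pos : ∀ x, 0 < deriv φ x
  α : ℝ → AddCircle (2 * Real.pi)
  exists_lift : ∃ a : Hs s, ∀ x, α x = (((a : ℝ → ℝ) x : ℝ) : AddCircle (2 * Real.pi))

/-- Constant functions are of class `H^s`. -/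
theorem const_mem_Hs (s : WithTop ℝ) (c : ℝ) : (fun _ : ℝ => c) ∈ Hs s := by
  rw [mem_Hs]
  intro r _
  refine ⟨continuous_const, fun _ => rfl, ?_⟩
  have hz : ∀ n : ℤ, n ≠ 0 → wcoeff r (fun _ => c) n = 0 := by
    intro n hn
    have h := fourierCoeffOn_of_hasDerivAt (zero_lt_one' ℝ) (f := fun _ => (c : ℂ))
      (f' := fun _ => 0) (n := n) hn (fun x _ => hasDerivAt_const x _)
      (continuous_const.intervalIntegrable _ _)
    have h0 : fourierCoeffOn (zero_lt_one' ℝ) (fun _ => (0 : ℂ)) n = 0 := by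
      rw [fourierCoeffOn_eq_integral]
      simp
    simp [wcoeff, coeff, h, h0]
  apply memℓp_gen
  refine summable_of_ne_finset_zero (s := {0}) (fun n hn => ?_)
  rw [hz n (by simpa using hn)]
  norm_num

/-- The density `π(φ) = φ^*(dx)`, that is `φ'`. -/
def SemiDirect.jac {s : WithTop ℝ} (g : SemiDirect s) : Dens s := by
  have hd : ∀ x, HasDerivAt g.φ (deriv g.φ x) x := fun x =>
    (g.contDiff_φ.differentiable one_ne_zero x).hasDerivAt
  refine ⟨⟨deriv g.φ, ?_⟩, g.deriv_pos, ?_⟩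
  · have h1 : deriv (fun x => g.φ x - x) ∈ Hs s :=
      deriv_mem_Hs (g.contDiff_φ.sub contDiff_id) g.periodic_φ g.mem_φ
    have h2 : deriv g.φ = deriv (fun x => g.φ x - x) + fun _ => 1 := by
      ext x
      have h3 : HasDerivAt (fun x => g.φ x - x) (deriv g.φ x - 1) x := (hd x).sub (hasDerivAt_id x)
      rw [Pi.add_apply, h3.deriv]
      ring
    rw [h2]
    exact (Hs s).add_mem h1 (const_mem_Hs s 1)
  · change ∫ x in (0 : ℝ)..1, deriv g.φ x = 1
    rw [intervalIntegral.integral_eq_sub_of_hasDerivAt (fun x _ => hd x)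
      ((g.contDiff_φ.continuous_deriv le_rfl).intervalIntegrable _ _)]
    have h := g.periodic_φ 0
    simp only [zero_add, sub_zero] at h
    linarith

/-- The map `(φ, α) ↦ (π(φ), [θ])`, where `θ` is a real lift of `α`; two such lifts differ by a
constant, and one of them is `x ↦ ∫₀ˣ α'`. -/
def SemiDirect.toCotDens {s : WithTop ℝ} (g : SemiDirect s) : CotDens s :=
  (g.jac, (constants s).mkQ g.exists_lift.choose)

/-- `g` is a curve of class `C^k` in the semidirect product over the open interval `I`, and `a` is
a `C^k` real lift of its second component. -/
def IsGroupCurve {s : WithTop ℝ} (k : ℕ) (I : Set ℝ) (g : ℝ → SemiDirect s) (a : ℝ → ℝ → ℝ) :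
    Prop :=
  IsCurve k (s + 1) I (fun t x => (g t).φ x - x) ∧ IsCurve k s I a ∧
    ∀ t ∈ I, ∀ x, (g t).α x = ((a t x : ℝ) : AddCircle (2 * Real.pi))

/-- The `Ḣ¹`-type inner product (as a quadratic form) at the identity. -/
def lenellsOne (v σ : ℝ → ℝ) : ℝ := 1 / 4 * ∫ x in (0 : ℝ)..1, (deriv v x ^ 2 + σ x ^ 2)

/-- The right-invariant `Ḣ¹`-type metric at a point over `φ`, on the tangent vector `(φd, αd)`:
right translation by the inverse element moves it to `(φd ∘ φ⁻¹, αd ∘ φ⁻¹)` at the identity. -/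
def lenells (φ φd αd : ℝ → ℝ) : ℝ :=
  lenellsOne (φd ∘ Function.invFun φ) (αd ∘ Function.invFun φ)

/-! ### The two-component Hunter–Saxton equation -/

/-- `(v, σ)` are the Eulerian velocities of the `C²` curve `g = (φ, α)` in the semidirect product
(with real lift `a` of `α`): `∂ₜφ = v ∘ φ` and `∂ₜα = σ ∘ φ`. -/
def IsEulerianVelocity {s : WithTop ℝ} (I : Set ℝ) (v σ : ℝ → ℝ → ℝ) (g : ℝ → SemiDirect s)
    (a : ℝ → ℝ → ℝ) : Prop :=
  IsGroupCurve 2 I g a ∧ ∀ t ∈ I, ∀ x,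
    dt (fun τ => (g τ).φ) t x = v t ((g t).φ x) ∧ dt a t x = σ t ((g t).φ x)

/-- Test functions: smooth, periodic in `x`, with support in `K × S¹`, `K ⊆ I` compact. -/
def IsTest (I : Set ℝ) (η : ℝ → ℝ → ℝ) : Prop :=
  ContDiff ℝ (⊤ : ℕ∞) (fun p : ℝ × ℝ => η p.1 p.2) ∧ (∀ t, Function.Periodic (η t) 1) ∧
    ∃ K : Set ℝ, IsCompact K ∧ K ⊆ I ∧ ∀ t, t ∉ K → ∀ x, η t x = 0

/-- `(v, σ)` solves `v̇'' = -2 v' v'' - v v''' + σ σ'`, `σ̇ = -(σ v)'` on `I × S¹` in the sense of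
distributions, where `2 v' v'' + v v''' = (v v')'' - (v'² / 2)'` and `σ σ' = (σ² / 2)'`. -/
def IsWeakSolution (I : Set ℝ) (v σ : ℝ → ℝ → ℝ) : Prop :=
  ∀ η : ℝ → ℝ → ℝ, IsTest I η →
    (∫ t in I, ∫ x in (0 : ℝ)..1, (dx v t x * dt (dx η) t x + v t x * dx v t x * dx (dx η) t x
      + (dx v t x ^ 2 / 2 + σ t x ^ 2 / 2) * dx η t x)) = 0 ∧
    (∫ t in I, ∫ x in (0 : ℝ)..1, (σ t x * dt η t x + σ t x * v t x * dx η t x)) = 0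

/-- `(v, σ)` solves the same equations pointwise on `I × S¹`. -/
def IsClassicalSolution (I : Set ℝ) (v σ : ℝ → ℝ → ℝ) : Prop :=
  ∀ t ∈ I, ContDiff ℝ 3 (v t) ∧ ContDiff ℝ 1 (σ t) ∧ ∀ x,
    HasDerivAt (fun τ => dx (dx v) τ x)
      (-2 * dx v t x * dx (dx v) t x - v t x * dx (dx (dx v)) t x + σ t x * dx σ t x) t ∧
    HasDerivAt (fun τ => σ τ x) (-deriv (fun y => σ t y * v t y) x) t

end HunterSaxton

end

/-! For a curve `(φ, a)` in the semidirect product write `ρ = φ'` for its Jacobian.  Testing the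
first variation of the energy with `χ(t) cos (2πkx)` and `χ(t) sin (2πkx)` shows that `(ρ, [θ])` is
a geodesic if and only if, for the lift `θ` with `∫ (dt θ) ρ = 0`, the momentum `(dt θ) ρ` is
constant in time and `2 (ρ̇ / ρ)˙ + (ρ̇ / ρ)² - θ̇²` is constant in space.  If `(v, σ)` is the
Eulerian velocity of `(φ, a)`, then `v' ∘ φ = ρ̇ / ρ` and `σ ∘ φ = ȧ`, so that the change of
variables `y = φ(t, x)` turns these equations into the two-component Hunter–Saxton equation,
integrated once in space and in weak form; it also turns `∫ (dt θ) ρ = 0` into `∫ σ = 0`.  A curve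
of densities determines `φ` once `φ(x₀) = x₀` is prescribed. -/

open MeasureTheory Set

noncomputable section

namespace HunterSaxton

open Filter Topology

/-! ### Fourier series of functions of class `H^r` -/

theorem coeff_eq_integral (f : ℝ → ℝ) (n : ℤ) :
    coeff f n = ∫ x in (0 : ℝ)..1, fourier (-n) (x : AddCircle (1 : ℝ)) * (f x : ℂ) := by
  unfold coeff
  rw [fourierCoeffOn_eq_integral]
  norm_num

theorem coeff_zero_eq_integral (f : ℝ → ℝ) : coeff f 0 = ((∫ x in (0 : ℝ)..1, f x : ℝ) : ℂ) := by
  rw [coeff_eq_integral]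
  simp [intervalIntegral.integral_ofReal]

theorem weight_le_weight {r r' : ℝ} (h : r ≤ r') (n : ℤ) : weight r n ≤ weight r' n :=
  Real.rpow_le_rpow_of_exponent_le (by nlinarith [sq_nonneg (n : ℝ)]) (by linarith)

theorem weight_add (r r' : ℝ) (n : ℤ) : weight (r + r') n = weight r n * weight r' n := by
  unfold weight
  rw [← Real.rpow_add (by positivity), add_div]

theorem weight_sq (r : ℝ) (n : ℤ) : weight r n ^ 2 = weight (2 * r) n := by
  rw [sq, ← weight_add, two_mul]

theorem norm_wcoeff (r : ℝ) (f : ℝ → ℝ) (n : ℤ) : ‖wcoeff r f n‖ = weight r n * ‖coeff f n‖ := by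
  rw [wcoeff, norm_mul, Complex.norm_real, Real.norm_of_nonneg (weight_pos r n).le]

theorem norm_wcoeff_mono {r r' : ℝ} (h : r ≤ r') (f : ℝ → ℝ) (n : ℤ) :
    ‖wcoeff r f n‖ ≤ ‖wcoeff r' f n‖ := by
  rw [norm_wcoeff, norm_wcoeff]
  gcongr
  exact weight_le_weight h n

theorem abs_le_weight_one (n : ℤ) : |(n : ℝ)| ≤ weight 1 n := by
  unfold weight
  rw [← Real.sqrt_eq_rpow]
  exact Real.abs_le_sqrt (by linarith)

theorem weight_one_le {n : ℤ} (hn : n ≠ 0) : weight 1 n ≤ 2 * |(n : ℝ)| := by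
  unfold weight
  rw [← Real.sqrt_eq_rpow, Real.sqrt_le_iff]
  have : (1 : ℝ) ≤ |(n : ℝ)| := by exact_mod_cast Int.one_le_abs hn
  exact ⟨by positivity, by nlinarith [sq_abs (n : ℝ)]⟩

theorem weight_le_abs_rpow {r : ℝ} (hr : r ≤ 0) {n : ℤ} (hn : n ≠ 0) :
    weight r n ≤ |(n : ℝ)| ^ r := by
  have h : |(n : ℝ)| ^ r = ((n : ℝ) ^ 2) ^ (r / 2) := by
    rw [← sq_abs, ← Real.rpow_natCast, ← Real.rpow_mul (abs_nonneg _), Nat.cast_ofNat,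
      mul_div_cancel₀ r two_ne_zero]
  rw [h]
  exact Real.rpow_le_rpow_of_nonpos (by positivity) (by linarith) (by linarith)

theorem summable_weight {r : ℝ} (hr : r < -1) : Summable (weight r) := by
  have habs : Summable fun n : ℤ => |(n : ℝ)| ^ r := by
    simpa only [neg_neg] using Real.summable_abs_int_rpow (b := -r) (by linarith)
  have hzero : Summable (Pi.single (0 : ℤ) (1 : ℝ)) := (hasSum_pi_single 0 1).summable
  refine (habs.add hzero).of_nonneg_of_le (fun n => (weight_pos r n).le) fun n => ?_
  rcases eq_or_ne n 0 with rfl | hn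
  · simp [weight, Real.zero_rpow (show r ≠ 0 by linarith)]
  · rw [Pi.single_eq_of_ne hn, add_zero]
    exact weight_le_abs_rpow (by linarith) hn

theorem mem_HsReal_of_norm_wcoeff_le {r r' C : ℝ} {f g : ℝ → ℝ} (hf : f ∈ HsReal r)
    (hg : Continuous g) (hp : Function.Periodic g 1)
    (h : ∀ n, ‖wcoeff r' g n‖ ≤ C * ‖wcoeff r f n‖) : g ∈ HsReal r' :=
  ⟨hg, hp, (hf.2.2.norm.const_mul C).mono h⟩

theorem HsReal_antitone : Antitone HsReal := fun _ _ h f hf =>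
  mem_HsReal_of_norm_wcoeff_le hf hf.1 hf.2.1 (C := 1) fun n => by
    rw [one_mul]
    exact norm_wcoeff_mono h f n

theorem mem_Hs_coe {r : ℝ} {f : ℝ → ℝ} : f ∈ Hs (r : WithTop ℝ) ↔ f ∈ HsReal r := by
  rw [mem_Hs]
  exact ⟨fun h => h r le_rfl, fun h r' hr' => HsReal_antitone (WithTop.coe_le_coe.mp hr') h⟩

theorem summable_sq_wcoeff {r : ℝ} {f : ℝ → ℝ} (hf : f ∈ HsReal r) :
    Summable fun n => ‖wcoeff r f n‖ ^ (2 : ℝ) := by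
  simpa using (memℓp_gen_iff (by norm_num)).mp hf.2.2

theorem HsSpace.norm_eq {r : ℝ} (f : HsSpace r) :
    ‖f‖ = (∑' n, ‖wcoeff r f.toFun n‖ ^ (2 : ℝ)) ^ (1 / 2 : ℝ) := by
  change ‖HsSpace.toL2 r f‖ = _
  rw [lp.norm_eq_tsum_rpow (by norm_num)]
  norm_num
  rfl

/-- The constant in the Sobolev inequality `‖f‖_∞ ≤ C ‖f‖_{H^r}` given by Cauchy–Schwarz. -/
def sobolevConst (r : ℝ) : ℝ := (∑' n, weight (-r) n ^ (2 : ℝ)) ^ (1 / 2 : ℝ)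

theorem sobolevConst_nonneg (r : ℝ) : 0 ≤ sobolevConst r :=
  Real.rpow_nonneg (tsum_nonneg fun n => Real.rpow_nonneg (weight_pos _ n).le _) _

theorem summable_weight_mul_coeff {r r' : ℝ} (h : r' + 1 / 2 < r) {f : ℝ → ℝ}
    (hf : f ∈ HsReal r) : Summable fun n => weight r' n * ‖coeff f n‖ := by
  have hw : Summable fun n => weight (r' - r) n ^ (2 : ℝ) := by
    simp only [Real.rpow_ofNat, weight_sq]
    exact summable_weight (by linarith)
  refine (Real.summable_mul_of_Lp_Lq_of_nonneg Real.HolderConjugate.two_two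
    (fun n => (weight_pos _ n).le) (fun n => norm_nonneg _) hw
    (summable_sq_wcoeff hf)).congr fun n => ?_
  rw [norm_wcoeff, ← mul_assoc, ← weight_add, sub_add_cancel]

theorem summable_coeff {r : ℝ} (h : 1 / 2 < r) {f : ℝ → ℝ} (hf : f ∈ HsReal r) :
    Summable fun n => ‖coeff f n‖ := by
  simpa [weight] using summable_weight_mul_coeff (r' := 0) (by linarith) hf

theorem tsum_norm_coeff_le {r : ℝ} (h : 1 / 2 < r) (f : HsSpace r) :
    ∑' n, ‖coeff f.toFun n‖ ≤ sobolevConst r * ‖f‖ := by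
  have hw : Summable fun n => weight (-r) n ^ (2 : ℝ) := by
    simp only [Real.rpow_ofNat, weight_sq]
    exact summable_weight (by linarith)
  calc ∑' n, ‖coeff f.toFun n‖ = ∑' n, weight (-r) n * ‖wcoeff r f.toFun n‖ :=
        tsum_congr fun n => by
          rw [norm_wcoeff, ← mul_assoc, ← weight_add, neg_add_cancel]
          simp [weight]
    _ ≤ sobolevConst r * ‖f‖ := by
        rw [HsSpace.norm_eq]
        exact Real.inner_le_Lp_mul_Lq_tsum_of_nonneg Real.HolderConjugate.two_two
          (fun n => (weight_pos _ n).le) (fun n => norm_nonneg _) hw (summable_sq_wcoeff f.2)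

theorem norm_fourier_coe (n : ℤ) (x : ℝ) : ‖fourier n (x : AddCircle (1 : ℝ))‖ = 1 := by
  rw [fourier_apply]
  exact Circle.norm_coe _

section AbsolutelyConvergent

variable {f : ℝ → ℝ} (hf : Continuous f) (hp : Function.Periodic f 1)

include hf hp

theorem hasSum_coeff (hs : Summable fun n => ‖coeff f n‖) (x : ℝ) :
    HasSum (fun n => coeff f n * fourier n (x : AddCircle (1 : ℝ))) (f x : ℂ) := by
  have hp' : Function.Periodic (fun y => (f y : ℂ)) 1 := fun y => by simp [hp y]
  let F : C(AddCircle (1 : ℝ), ℂ) :=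
    ⟨hp'.lift, continuous_coinduced_dom.mpr (Complex.continuous_ofReal.comp hf)⟩
  have hF : fourierCoeff F = coeff f := by
    ext n
    rw [fourierCoeff_eq_intervalIntegral _ _ 0, coeff_eq_integral]
    simp [F]
  have h := has_pointwise_sum_fourier_series_of_summable
    (hF ▸ hs.of_norm) (x : AddCircle (1 : ℝ))
  rwa [hF] at h

theorem abs_le_tsum_coeff (hs : Summable fun n => ‖coeff f n‖) (x : ℝ) :
    |f x| ≤ ∑' n, ‖coeff f n‖ := by
  have h := (hasSum_coeff hf hp hs x).norm_le_of_bounded hs.hasSum fun n => by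
    rw [norm_mul, norm_fourier_coe, mul_one]
  rwa [Complex.norm_real] at h

theorem eq_zero_of_coeff_eq_zero (h : ∀ n, coeff f n = 0) : f = 0 := by
  ext x
  simpa [h] using abs_le_tsum_coeff hf hp (by simp [h]) x

theorem contDiff_one_of_summable (hs : Summable fun n => weight 1 n * ‖coeff f n‖) :
    ContDiff ℝ 1 f := by
  have hs₀ : Summable fun n => ‖coeff f n‖ := by
    refine hs.of_nonneg_of_le (fun n => norm_nonneg _) fun n => ?_
    have : 1 ≤ weight 1 n := by simpa [weight] using weight_le_weight zero_le_one n
    exact le_mul_of_one_le_left (norm_nonneg _) this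
  let F' : ℤ → ℝ → ℂ := fun n x =>
    coeff f n * (2 * Real.pi * Complex.I * n / (1 : ℝ) * fourier n (x : AddCircle (1 : ℝ)))
  have hF' : ∀ n x, ‖F' n x‖ ≤ 2 * Real.pi * (weight 1 n * ‖coeff f n‖) := by
    intro n x
    calc ‖F' n x‖ = 2 * Real.pi * (|(n : ℝ)| * ‖coeff f n‖) := by
          simp only [F', norm_mul, norm_fourier_coe, Complex.ofReal_one, div_one,
            Complex.norm_ofNat, Complex.norm_real, Real.norm_eq_abs, abs_of_pos Real.pi_pos,
            Complex.norm_I, mul_one, Complex.norm_intCast]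
          ring
      _ ≤ 2 * Real.pi * (weight 1 n * ‖coeff f n‖) := by
          gcongr
          exact abs_le_weight_one n
  have hsum : ∀ x : ℝ, HasSum (fun n => coeff f n * fourier n (x : AddCircle (1 : ℝ))) (f x : ℂ) :=
    hasSum_coeff hf hp hs₀
  have hderiv : ∀ x, HasDerivAt f (∑' n, F' n x).re x := by
    intro x
    have h : HasDerivAt (fun z => (f z : ℂ)) (∑' n, F' n x) x := by
      simpa only [(hsum _).tsum_eq] using hasDerivAt_tsum (hs.mul_left (2 * Real.pi))
        (fun n y => (hasDerivAt_fourier 1 n y).const_mul (coeff f n)) hF' (hsum 0).summable x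
    exact Complex.reCLM.hasFDerivAt.comp_hasDerivAt x h
  rw [contDiff_one_iff_deriv, funext fun x => (hderiv x).deriv]
  refine ⟨fun x => (hderiv x).differentiableAt, Complex.continuous_re.comp
    (continuous_tsum (fun n => ?_) (hs.mul_left (2 * Real.pi)) hF')⟩
  simp only [F', fourier_coe_apply]
  fun_prop

end AbsolutelyConvergent

theorem HsSpace.abs_apply_le {r : ℝ} (h : 1 / 2 < r) (f : HsSpace r) (x : ℝ) :
    |f.toFun x| ≤ sobolevConst r * ‖f‖ :=
  (abs_le_tsum_coeff f.2.1 f.2.2.1 (summable_coeff h f.2) x).trans (tsum_norm_coeff_le h f)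

theorem contDiff_one_of_mem {r : ℝ} (h : 3 / 2 < r) {f : ℝ → ℝ} (hf : f ∈ HsReal r) :
    ContDiff ℝ 1 f :=
  contDiff_one_of_summable hf.1 hf.2.1 (summable_weight_mul_coeff (by linarith) hf)

/-! ### Bounded operators between the Sobolev spaces -/

namespace HsSpace

variable {r r' : ℝ}

/-- The element of `H^r` given by a function. -/
def ofMem (f : ℝ → ℝ) (hf : f ∈ HsReal r) : HsSpace r := (⟨f, hf⟩ : HsReal r)

@[simp] theorem toFun_ofMem (f : ℝ → ℝ) (hf : f ∈ HsReal r) : (ofMem f hf).toFun = f := rfl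

theorem toFun_injective : Function.Injective (toFun (r := r)) := Subtype.val_injective

@[simp] theorem toFun_add (f g : HsSpace r) : (f + g).toFun = f.toFun + g.toFun := rfl

@[simp] theorem toFun_smul (c : ℝ) (f : HsSpace r) : (c • f).toFun = c • f.toFun := rfl

theorem mem (f : HsSpace r) : f.toFun ∈ HsReal r := f.2

theorem continuous (f : HsSpace r) : Continuous f.toFun := f.mem.1

theorem periodic (f : HsSpace r) : Function.Periodic f.toFun 1 := f.mem.2.1

theorem norm_le_of_norm_wcoeff_le {C : ℝ} (hC : 0 ≤ C) {f : HsSpace r} {g : HsSpace r'}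
    (h : ∀ n, ‖wcoeff r' g.toFun n‖ ≤ C * ‖wcoeff r f.toFun n‖) : ‖g‖ ≤ C * ‖f‖ := by
  have hmono : ‖HsSpace.toL2 r' g‖ ≤ ‖(C • HsSpace.toL2 r f : lp (fun _ : ℤ => ℂ) 2)‖ := by
    refine lp.norm_mono (by norm_num) fun n => ?_
    rw [lp.coeFn_smul, Pi.smul_apply, norm_smul, Real.norm_of_nonneg hC]
    exact h n
  rwa [norm_smul, Real.norm_of_nonneg hC] at hmono

/-- The bounded operator `H^r → H^r'` given by a linear map into continuous periodic functions
whose weighted Fourier coefficients are dominated mode by mode. -/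
def mkCLM (T : HsSpace r →ₗ[ℝ] ℝ → ℝ) (hc : ∀ f, Continuous (T f))
    (hp : ∀ f, Function.Periodic (T f) 1) (C : ℝ) (hC : 0 ≤ C)
    (h : ∀ f n, ‖wcoeff r' (T f) n‖ ≤ C * ‖wcoeff r f.toFun n‖) : HsSpace r →L[ℝ] HsSpace r' :=
  LinearMap.mkContinuous
    { toFun := fun f => ofMem (T f) (mem_HsReal_of_norm_wcoeff_le f.mem (hc f) (hp f) (h f))
      map_add' := fun f g => toFun_injective (by simp)
      map_smul' := fun c f => toFun_injective (by simp) } C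
    fun f => norm_le_of_norm_wcoeff_le hC (h f)

theorem mkCLM_toFun (T : HsSpace r →ₗ[ℝ] ℝ → ℝ) (hc : ∀ f, Continuous (T f))
    (hp : ∀ f, Function.Periodic (T f) 1) (C : ℝ) (hC : 0 ≤ C)
    (h : ∀ f n, ‖wcoeff r' (T f) n‖ ≤ C * ‖wcoeff r f.toFun n‖) (f : HsSpace r) :
    (mkCLM T hc hp C hC h f).toFun = T f := rfl

/-- `HsSpace.toFun` as a linear map. -/
def toFunₗ (r : ℝ) : HsSpace r →ₗ[ℝ] ℝ → ℝ where
  toFun := toFun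
  map_add' := toFun_add
  map_smul' := toFun_smul

end HsSpace

open HsSpace

/-- Evaluation at a point. -/
def evalCLM {r : ℝ} (h : 1 / 2 < r) (x : ℝ) : HsSpace r →L[ℝ] ℝ :=
  (LinearMap.proj x ∘ₗ toFunₗ r).mkContinuous (sobolevConst r) fun f => abs_apply_le h f x

@[simp] theorem evalCLM_apply {r : ℝ} (h : 1 / 2 < r) (x : ℝ) (f : HsSpace r) :
    evalCLM h x f = f.toFun x := rfl

/-- The inclusion `H^r ⊆ H^r'` for `r' ≤ r`. -/
def inclCLM {r r' : ℝ} (h : r' ≤ r) : HsSpace r →L[ℝ] HsSpace r' :=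
  mkCLM (toFunₗ r) (fun f => f.continuous) (fun f => f.periodic) 1 zero_le_one fun f n => by
    rw [one_mul]
    exact norm_wcoeff_mono h f.toFun n

@[simp] theorem inclCLM_toFun {r r' : ℝ} (h : r' ≤ r) (f : HsSpace r) :
    (inclCLM h f).toFun = f.toFun := mkCLM_toFun _ _ _ _ _ _ _

theorem HsSpace.contDiff {r : ℝ} (h : 1 / 2 < r) (f : HsSpace (r + 1)) : ContDiff ℝ 1 f.toFun :=
  contDiff_one_of_mem (by linarith) f.mem

theorem HsSpace.differentiable {r : ℝ} (h : 1 / 2 < r) (f : HsSpace (r + 1)) :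
    Differentiable ℝ f.toFun :=
  (f.contDiff h).differentiable one_ne_zero

theorem deriv_mem_HsReal {r : ℝ} (h : 1 / 2 < r) {f : ℝ → ℝ} (hf : f ∈ HsReal (r + 1)) :
    deriv f ∈ HsReal r :=
  mem_Hs_coe.mp (deriv_mem_Hs (contDiff_one_of_mem (by linarith) hf) hf.2.1
    (by exact_mod_cast mem_Hs_coe.mpr hf))

/-- The derivative as an operator `H^(r+1) → H^r`. -/
def derivCLM {r : ℝ} (h : 1 / 2 < r) : HsSpace (r + 1) →L[ℝ] HsSpace r :=
  mkCLM
    { toFun := fun f => deriv f.toFun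
      map_add' := fun f g =>
        funext fun x => deriv_add (f.differentiable h x) (g.differentiable h x)
      map_smul' := fun c f => funext fun x => deriv_const_smul c (f.differentiable h x) }
    (fun f => (f.contDiff h).continuous_deriv le_rfl)
    (fun f => (deriv_mem_HsReal h f.mem).2.1) (2 * Real.pi) (by positivity) fun f n => by
      have hle := weight_mul_coeff_deriv_le (f.contDiff h) f.periodic r n
      rwa [norm_mul, Complex.norm_real, Real.norm_of_nonneg (by positivity)] at hle

@[simp] theorem derivCLM_toFun {r : ℝ} (h : 1 / 2 < r) (f : HsSpace (r + 1)) :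
    (derivCLM h f).toFun = deriv f.toFun := mkCLM_toFun _ _ _ _ _ _ _

theorem coeff_of_hasDerivAt {f f' : ℝ → ℝ} (hd : ∀ x, HasDerivAt f (f' x) x) (hc : Continuous f')
    (hp : Function.Periodic f 1) (n : ℤ) :
    coeff f' n = 2 * Real.pi * Complex.I * n * coeff f n := by
  have hper : f 1 = f 0 := by simpa using hp 0
  rcases eq_or_ne n 0 with rfl | hn
  · have hint : ∫ x in (0 : ℝ)..1, f' x = 0 := by
      rw [intervalIntegral.integral_eq_sub_of_hasDerivAt (fun x _ => hd x)
        (hc.intervalIntegrable _ _), hper, sub_self]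
    simp [coeff_zero_eq_integral, hint]
  · have h := fourierCoeffOn_of_hasDerivAt (zero_lt_one' ℝ) (f := fun x => (f x : ℂ))
      (f' := fun x => (f' x : ℂ)) hn (fun x _ => HasDerivAt.ofReal_comp (hd x))
      ((Complex.continuous_ofReal.comp hc).intervalIntegrable _ _)
    rw [hper] at h
    have hf : coeff f n = 1 / (-2 * Real.pi * Complex.I * n) * (-coeff f' n) := by
      simpa [coeff] using h
    have hn' : (n : ℂ) ≠ 0 := by exact_mod_cast hn
    have hpi : (Real.pi : ℂ) ≠ 0 := by exact_mod_cast Real.pi_ne_zero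
    rw [hf]
    field_simp [Complex.I_ne_zero]

theorem coeff_const (c : ℝ) {n : ℤ} (hn : n ≠ 0) : coeff (fun _ => c) n = 0 := by
  have h := coeff_of_hasDerivAt (fun x => hasDerivAt_const x c) continuous_const (fun _ => rfl) n
  have h0 : coeff (fun _ => 0) n = 0 := by simp [coeff_eq_integral]
  simpa [h0, hn, Real.pi_ne_zero, eq_comm] using h

/-- The periodic primitive of mean zero of `f` minus its mean. -/
def primitive (f : ℝ → ℝ) (x : ℝ) : ℝ :=
  (∫ y in (0 : ℝ)..x, (f y - ∫ z in (0 : ℝ)..1, f z)) -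
    ∫ w in (0 : ℝ)..1, ∫ y in (0 : ℝ)..w, (f y - ∫ z in (0 : ℝ)..1, f z)

theorem hasDerivAt_primitive {f : ℝ → ℝ} (hf : Continuous f) (x : ℝ) :
    HasDerivAt (primitive f) (f x - ∫ z in (0 : ℝ)..1, f z) x := by
  have hc : Continuous fun y => f y - ∫ z in (0 : ℝ)..1, f z := by fun_prop
  exact (hc.integral_hasStrictDerivAt 0 x).hasDerivAt.sub_const _

theorem continuous_primitive {f : ℝ → ℝ} (hf : Continuous f) : Continuous (primitive f) :=
  continuous_iff_continuousAt.mpr fun x => (hasDerivAt_primitive hf x).continuousAt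

theorem integral_primitive {f : ℝ → ℝ} (hf : Continuous f) :
    ∫ x in (0 : ℝ)..1, primitive f x = 0 := by
  have h : Continuous fun x => ∫ y in (0 : ℝ)..x, (f y - ∫ z in (0 : ℝ)..1, f z) :=
    intervalIntegral.continuous_primitive
      (fun a b => (hf.sub continuous_const).intervalIntegrable a b) 0
  unfold primitive
  rw [intervalIntegral.integral_sub (h.intervalIntegrable _ _) (by simp)]
  simp

theorem periodic_primitive {f : ℝ → ℝ} (hf : Continuous f) (hp : Function.Periodic f 1) :
    Function.Periodic (primitive f) 1 := by
  intro x
  have hp' : Function.Periodic (fun y => f y - ∫ z in (0 : ℝ)..1, f z) 1 := fun y => by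
    simp [hp y]
  have hmean : ∫ y in x..(x + 1), (f y - ∫ z in (0 : ℝ)..1, f z) = 0 := by
    rw [hp'.intervalIntegral_add_eq x 0, zero_add,
      intervalIntegral.integral_sub (hf.intervalIntegrable _ _) (by simp)]
    simp
  have hftc := intervalIntegral.integral_eq_sub_of_hasDerivAt
    (fun y (_ : y ∈ uIcc x (x + 1)) => hasDerivAt_primitive hf y)
    ((hf.sub continuous_const).intervalIntegrable _ _)
  linarith

theorem eq_primitive_of_hasDerivAt {f F : ℝ → ℝ} (hf : Continuous f)
    (hF : ∀ x, HasDerivAt F (f x - ∫ z in (0 : ℝ)..1, f z) x)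
    (hF₀ : ∫ x in (0 : ℝ)..1, F x = 0) : F = primitive f := by
  have hd : ∀ x, HasDerivAt (F - primitive f) 0 x := fun x => by
    simpa only [sub_self] using (hF x).sub (hasDerivAt_primitive hf x)
  have hc : Continuous F := continuous_iff_continuousAt.mpr fun x => (hF x).continuousAt
  have hconst : ∀ x, F x - primitive f x = F 0 - primitive f 0 := fun x =>
    is_const_of_deriv_eq_zero (fun y => (hd y).differentiableAt) (fun y => (hd y).deriv) x 0
  have hint := intervalIntegral.integral_sub (hc.intervalIntegrable (μ := volume) 0 1)
    ((continuous_primitive hf).intervalIntegrable 0 1)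
  simp only [hconst, intervalIntegral.integral_const, hF₀, integral_primitive hf, sub_zero,
    one_smul] at hint
  exact funext fun x => sub_eq_zero.mp ((hconst x).trans hint)

theorem primitive_add {f g : ℝ → ℝ} (hf : Continuous f) (hg : Continuous g) :
    primitive (f + g) = primitive f + primitive g := by
  refine (eq_primitive_of_hasDerivAt (hf.add hg) (fun x => ?_) ?_).symm
  · refine ((hasDerivAt_primitive hf x).add (hasDerivAt_primitive hg x)).congr_deriv ?_
    simp only [Pi.add_apply]
    rw [intervalIntegral.integral_add (hf.intervalIntegrable _ _) (hg.intervalIntegrable _ _)]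
    ring
  · refine (intervalIntegral.integral_add ((continuous_primitive hf).intervalIntegrable _ _)
      ((continuous_primitive hg).intervalIntegrable _ _)).trans ?_
    rw [integral_primitive hf, integral_primitive hg, add_zero]

theorem primitive_smul (c : ℝ) (f : ℝ → ℝ) : primitive (c • f) = c • primitive f := by
  ext x
  simp only [primitive, Pi.smul_apply, smul_eq_mul, intervalIntegral.integral_const_mul, ← mul_sub]

theorem coeff_eq_coeff_primitive {f : ℝ → ℝ} (hf : Continuous f) (hp : Function.Periodic f 1)
    {n : ℤ} (hn : n ≠ 0) : coeff f n = 2 * Real.pi * Complex.I * n * coeff (primitive f) n := by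
  rw [← coeff_of_hasDerivAt (hasDerivAt_primitive hf) (by fun_prop) (periodic_primitive hf hp) n]
  have h : (fun x => f x - ∫ z in (0 : ℝ)..1, f z) = f + fun _ => -∫ z in (0 : ℝ)..1, f z :=
    funext fun x => sub_eq_add_neg _ _
  rw [h, coeff_add hf continuous_const, coeff_const _ hn, add_zero]

theorem norm_wcoeff_primitive_le {f : ℝ → ℝ} (hf : Continuous f) (hp : Function.Periodic f 1)
    (r : ℝ) (n : ℤ) : ‖wcoeff (r + 1) (primitive f) n‖ ≤ ‖wcoeff r f n‖ := by
  rw [norm_wcoeff, norm_wcoeff]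
  rcases eq_or_ne n 0 with rfl | hn
  · rw [coeff_zero_eq_integral (primitive f), integral_primitive hf, Complex.ofReal_zero, norm_zero,
      mul_zero]
    exact mul_nonneg (weight_pos r 0).le (norm_nonneg _)
  · have hcoeff : ‖coeff f n‖ = 2 * Real.pi * |(n : ℝ)| * ‖coeff (primitive f) n‖ := by
      rw [coeff_eq_coeff_primitive hf hp hn]
      simp [abs_of_pos Real.pi_pos]
    have hone : weight 1 n ≤ 2 * Real.pi * |(n : ℝ)| := by
      nlinarith [weight_one_le hn, Real.pi_gt_three, abs_nonneg (n : ℝ)]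
    have := (weight_pos r n).le
    calc weight (r + 1) n * ‖coeff (primitive f) n‖
        = weight r n * (weight 1 n * ‖coeff (primitive f) n‖) := by rw [weight_add, mul_assoc]
      _ ≤ weight r n * (2 * Real.pi * |(n : ℝ)| * ‖coeff (primitive f) n‖) := by gcongr
      _ = weight r n * ‖coeff f n‖ := by rw [hcoeff]

theorem primitive_mem {r : ℝ} {f : ℝ → ℝ} (hf : f ∈ HsReal r) : primitive f ∈ HsReal (r + 1) :=
  mem_HsReal_of_norm_wcoeff_le hf (continuous_primitive hf.1) (periodic_primitive hf.1 hf.2.1)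
    (C := 1) fun n => by
      rw [one_mul]
      exact norm_wcoeff_primitive_le hf.1 hf.2.1 r n

/-- The primitive of mean zero as an operator `H^r → H^(r+1)`. -/
def primitiveCLM (r : ℝ) : HsSpace r →L[ℝ] HsSpace (r + 1) :=
  mkCLM
    { toFun := fun f => primitive f.toFun
      map_add' := fun f g => primitive_add f.continuous g.continuous
      map_smul' := fun c f => primitive_smul c f.toFun }
    (fun f => continuous_primitive f.continuous)
    (fun f => periodic_primitive f.continuous f.periodic) 1 zero_le_one fun f n => by
      rw [one_mul]
      exact norm_wcoeff_primitive_le f.continuous f.periodic r n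

@[simp] theorem primitiveCLM_toFun {r : ℝ} (f : HsSpace r) :
    (primitiveCLM r f).toFun = primitive f.toFun := mkCLM_toFun _ _ _ _ _ _ _

/-! ### Trigonometric functions -/

theorem coeff_eq_zero_of_eigenfunction {f g : ℝ → ℝ} {k : ℤ} (hf : ∀ x, HasDerivAt f (g x) x)
    (hg : ∀ x, HasDerivAt g (-(2 * Real.pi * k) ^ 2 * f x) x) (hfp : Function.Periodic f 1)
    (hgp : Function.Periodic g 1) {n : ℤ} (hn : n ≠ k) (hn' : n ≠ -k) : coeff f n = 0 := by
  have hfc : Continuous f := continuous_iff_continuousAt.mpr fun x => (hf x).continuousAt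
  have hgc : Continuous g := continuous_iff_continuousAt.mpr fun x => (hg x).continuousAt
  have hcoeff : ((-(2 * Real.pi * k) ^ 2 : ℝ) : ℂ) * coeff f n =
      2 * Real.pi * Complex.I * n * (2 * Real.pi * Complex.I * n * coeff f n) := by
    rw [← coeff_of_hasDerivAt hf hgc hfp n, ← coeff_of_hasDerivAt hg (by fun_prop) hgp n,
      ← coeff_smul]
    rfl
  have hprod : (2 * (Real.pi : ℂ)) ^ 2 * (((n : ℂ) - k) * ((n : ℂ) + k) * coeff f n) = 0 := by
    push_cast at hcoeff
    linear_combination hcoeff + (2 * (Real.pi : ℂ)) ^ 2 * n ^ 2 * coeff f n * Complex.I_sq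
  have hpi : (Real.pi : ℂ) ≠ 0 := by exact_mod_cast Real.pi_ne_zero
  have hsub : (n : ℂ) - k ≠ 0 := sub_ne_zero.mpr (by exact_mod_cast hn)
  have hadd : (n : ℂ) + k ≠ 0 := by
    rw [← sub_neg_eq_add, sub_ne_zero]
    exact_mod_cast hn'
  simpa [hpi, hsub, hadd] using hprod

theorem mem_HsReal_of_eigenfunction {f g : ℝ → ℝ} {k : ℤ} (hf : ∀ x, HasDerivAt f (g x) x)
    (hg : ∀ x, HasDerivAt g (-(2 * Real.pi * k) ^ 2 * f x) x) (hfp : Function.Periodic f 1)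
    (hgp : Function.Periodic g 1) (r : ℝ) : f ∈ HsReal r := by
  refine ⟨continuous_iff_continuousAt.mpr fun x => (hf x).continuousAt, hfp,
    (memℓp_zero (((finite_singleton (-k)).insert k).subset fun n hn => ?_)).of_exponent_ge
      zero_le⟩
  by_contra hmem
  simp only [mem_insert_iff, mem_singleton_iff, not_or] at hmem
  exact hn (by simp [wcoeff, coeff_eq_zero_of_eigenfunction hf hg hfp hgp hmem.1 hmem.2])

/-- The function `cos (2πkx)`. -/
def cosFun (k : ℤ) (x : ℝ) : ℝ := Real.cos (2 * Real.pi * k * x)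

/-- The function `sin (2πkx)`. -/
def sinFun (k : ℤ) (x : ℝ) : ℝ := Real.sin (2 * Real.pi * k * x)

section

variable (k : ℤ)

theorem periodic_cosFun : Function.Periodic (cosFun k) 1 := fun x => by
  unfold cosFun
  rw [show 2 * Real.pi * k * (x + 1) = 2 * Real.pi * k * x + k * (2 * Real.pi) by ring,
    Real.cos_add_int_mul_two_pi]

theorem periodic_sinFun : Function.Periodic (sinFun k) 1 := fun x => by
  unfold sinFun
  rw [show 2 * Real.pi * k * (x + 1) = 2 * Real.pi * k * x + k * (2 * Real.pi) by ring,
    Real.sin_add_int_mul_two_pi]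

theorem hasDerivAt_cosFun (x : ℝ) :
    HasDerivAt (cosFun k) (-(2 * Real.pi * k) * sinFun k x) x := by
  refine (((hasDerivAt_id x).const_mul (2 * Real.pi * k)).cos).congr_deriv ?_
  rw [id, sinFun]
  ring

theorem hasDerivAt_sinFun (x : ℝ) :
    HasDerivAt (sinFun k) (2 * Real.pi * k * cosFun k x) x := by
  refine (((hasDerivAt_id x).const_mul (2 * Real.pi * k)).sin).congr_deriv ?_
  rw [id, cosFun]
  ring

theorem contDiff_cosFun {n : WithTop ℕ∞} : ContDiff ℝ n (cosFun k) := by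
  unfold cosFun
  fun_prop

theorem contDiff_sinFun {n : WithTop ℕ∞} : ContDiff ℝ n (sinFun k) := by
  unfold sinFun
  fun_prop

theorem cosFun_mem (r : ℝ) : cosFun k ∈ HsReal r := by
  refine mem_HsReal_of_eigenfunction (k := k) (hasDerivAt_cosFun k)
    (fun x => ((hasDerivAt_sinFun k x).const_mul _).congr_deriv (by ring)) (periodic_cosFun k)
    (fun x => ?_) r
  simp only [periodic_sinFun k x]

theorem sinFun_mem (r : ℝ) : sinFun k ∈ HsReal r := by
  refine mem_HsReal_of_eigenfunction (k := k) (hasDerivAt_sinFun k)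
    (fun x => ((hasDerivAt_cosFun k x).const_mul _).congr_deriv (by ring)) (periodic_sinFun k)
    (fun x => ?_) r
  simp only [periodic_cosFun k x]

end

theorem coeff_eq_cos_sin {f : ℝ → ℝ} (hf : Continuous f) (n : ℤ) :
    coeff f n = ((∫ x in (0 : ℝ)..1, f x * cosFun n x : ℝ) : ℂ) -
      Complex.I * ((∫ x in (0 : ℝ)..1, f x * sinFun n x : ℝ) : ℂ) := by
  have hc := (contDiff_cosFun n (n := 0)).continuous
  have hs := (contDiff_sinFun n (n := 0)).continuous
  rw [coeff_eq_integral, ← intervalIntegral.integral_ofReal, ← intervalIntegral.integral_ofReal,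
    ← intervalIntegral.integral_const_mul, ← intervalIntegral.integral_sub
      (Continuous.intervalIntegrable (by fun_prop) _ _)
      (Continuous.intervalIntegrable (by fun_prop) _ _)]
  refine intervalIntegral.integral_congr fun x _ => ?_
  have hexp : 2 * Real.pi * Complex.I * ((-n : ℤ) : ℂ) * x / (1 : ℝ) =
      ((-(2 * Real.pi * n * x) : ℝ) : ℂ) * Complex.I := by
    push_cast
    ring
  simp only [fourier_coe_apply, hexp, Complex.exp_mul_I, ← Complex.ofReal_cos,
    ← Complex.ofReal_sin, Real.cos_neg, Real.sin_neg, cosFun, sinFun]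
  push_cast
  ring

theorem eq_mean_of_orthogonal {f : ℝ → ℝ} (hf : Continuous f) (hp : Function.Periodic f 1)
    (hcos : ∀ n : ℤ, n ≠ 0 → ∫ x in (0 : ℝ)..1, f x * cosFun n x = 0)
    (hsin : ∀ n : ℤ, n ≠ 0 → ∫ x in (0 : ℝ)..1, f x * sinFun n x = 0) (x : ℝ) :
    f x = ∫ y in (0 : ℝ)..1, f y := by
  have h : f + (fun _ => -∫ y in (0 : ℝ)..1, f y) = 0 := by
    refine eq_zero_of_coeff_eq_zero (hf.add continuous_const) (hp.add fun _ => rfl) fun n => ?_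
    rw [coeff_add hf continuous_const]
    rcases eq_or_ne n 0 with rfl | hn
    · simp [coeff_zero_eq_integral]
    · rw [coeff_const _ hn, coeff_eq_cos_sin hf, hcos n hn, hsin n hn]
      simp
  exact add_neg_eq_zero.mp (congrFun h x)

/-! ### Curves in Sobolev spaces -/

theorem exists_exponent {s : WithTop ℝ} {c : ℝ} (hs : (c : WithTop ℝ) < s) :
    ∃ r : ℝ, c < r ∧ (r : WithTop ℝ) ≤ s := by
  induction s using WithTop.recTopCoe with
  | top => exact ⟨c + 1, by linarith, le_top⟩
  | coe a => exact ⟨a, WithTop.coe_lt_coe.mp hs, le_rfl⟩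

theorem coe_sub_one_le {s : WithTop ℝ} {r : ℝ} (h : (r : WithTop ℝ) ≤ s + 1) :
    ((r - 1 : ℝ) : WithTop ℝ) ≤ s := by
  induction s using WithTop.recTopCoe with
  | top => exact le_top
  | coe a =>
    have h' : r ≤ a + 1 := by exact_mod_cast h
    exact WithTop.coe_le_coe.mpr (by linarith)

theorem coe_add_one_le {s : WithTop ℝ} {r : ℝ} (h : (r : WithTop ℝ) ≤ s) :
    ((r + 1 : ℝ) : WithTop ℝ) ≤ s + 1 := by
  rw [WithTop.coe_add, WithTop.coe_one]
  gcongr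

theorem half_lt_add_one {s : WithTop ℝ} (hs : ((1 / 2 : ℝ) : WithTop ℝ) < s) :
    ((1 / 2 : ℝ) : WithTop ℝ) < s + 1 := by
  obtain ⟨r, hr, hrs⟩ := exists_exponent hs
  exact (WithTop.coe_lt_coe.mpr (by linarith)).trans_le (coe_add_one_le hrs)

theorem mem_Hs_of_forall {s : WithTop ℝ} (hs : ((1 / 2 : ℝ) : WithTop ℝ) < s) {f : ℝ → ℝ}
    (h : ∀ r : ℝ, 1 / 2 < r → (r : WithTop ℝ) ≤ s → f ∈ HsReal r) : f ∈ Hs s := by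
  obtain ⟨r₀, hr₀, hr₀s⟩ := exists_exponent hs
  refine mem_Hs.mpr fun r hr => ?_
  rcases lt_or_ge (1 / 2) r with hlt | hle
  · exact h r hlt hr
  · exact HsReal_antitone (hle.trans hr₀.le) (h r₀ hr₀ hr₀s)

theorem primitive_mem_Hs {s : WithTop ℝ} {f : ℝ → ℝ} (hf : f ∈ Hs s) :
    primitive f ∈ Hs (s + 1) := by
  rw [mem_Hs] at hf ⊢
  intro r hr
  simpa only [sub_add_cancel] using primitive_mem (hf (r - 1) (coe_sub_one_le hr))

theorem HsSpace.continuous_eval {r : ℝ} (hr : 1 / 2 < r) :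
    Continuous fun p : HsSpace r × ℝ => p.1.toFun p.2 :=
  continuous_prod_of_continuous_lipschitzWith _ (sobolevConst r).toNNReal
    (fun f => f.continuous) fun x => LipschitzWith.of_dist_le_mul fun f g => by
      rw [Real.dist_eq, dist_eq_norm, Real.coe_toNNReal _ (sobolevConst_nonneg r)]
      exact (f - g).abs_apply_le hr x

/-- The pairing `∫ f g` on `H^r`. -/
def pairing {r : ℝ} (hr : 1 / 2 < r) : HsSpace r →L[ℝ] HsSpace r →L[ℝ] ℝ :=
  LinearMap.mkContinuous₂
    (LinearMap.mk₂ ℝ (fun f g : HsSpace r => ∫ x in (0 : ℝ)..1, f.toFun x * g.toFun x)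
      (fun f f' g => by
        simp only [toFun_add, Pi.add_apply, add_mul]
        exact intervalIntegral.integral_add
          ((f.continuous.mul g.continuous).intervalIntegrable _ _)
          ((f'.continuous.mul g.continuous).intervalIntegrable _ _))
      (fun c f g => by
        simp only [toFun_smul, Pi.smul_apply, smul_eq_mul, mul_assoc]
        exact intervalIntegral.integral_const_mul _ _)
      (fun f g g' => by
        simp only [toFun_add, Pi.add_apply, mul_add]
        exact intervalIntegral.integral_add
          ((f.continuous.mul g.continuous).intervalIntegrable _ _)
          ((f.continuous.mul g'.continuous).intervalIntegrable _ _))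
      (fun c f g => by
        simp only [toFun_smul, Pi.smul_apply, smul_eq_mul, mul_left_comm]
        exact intervalIntegral.integral_const_mul _ _)) (sobolevConst r * sobolevConst r)
    fun f g => by
      have hmul : ∀ x ∈ uIoc (0 : ℝ) 1, ‖f.toFun x * g.toFun x‖ ≤
          sobolevConst r * ‖f‖ * (sobolevConst r * ‖g‖) := fun x _ => by
        rw [norm_mul]
        have := sobolevConst_nonneg r
        exact mul_le_mul (f.abs_apply_le hr x) (g.abs_apply_le hr x) (norm_nonneg _)
          (by positivity)
      calc _ ≤ _ := intervalIntegral.norm_integral_le_of_norm_le_const hmul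
        _ = _ := by
          rw [sub_zero, abs_one]
          ring

theorem pairing_apply {r : ℝ} (hr : 1 / 2 < r) (f g : HsSpace r) :
    pairing hr f g = ∫ x in (0 : ℝ)..1, f.toFun x * g.toFun x := rfl

theorem hasDerivAt_toFun {r : ℝ} (hr : 1 / 2 < r) {U : ℝ → HsSpace r} {U' : HsSpace r} {t : ℝ}
    (hU : HasDerivAt U U' t) (x : ℝ) : HasDerivAt (fun τ => (U τ).toFun x) (U'.toFun x) t :=
  (evalCLM hr x).hasFDerivAt.comp_hasDerivAt t hU

section

variable {k : ℕ} {s : WithTop ℝ} {I : Set ℝ} {u w : ℝ → ℝ → ℝ}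

theorem IsCurve.of_le {k' : ℕ} (h : IsCurve k s I u) (hk : k' ≤ k) : IsCurve k' s I u := by
  intro r hr hrs
  obtain ⟨U, hU, hu⟩ := h r hr hrs
  exact ⟨U, hU.of_le (by exact_mod_cast hk), hu⟩

theorem IsCurve.anti {s' : WithTop ℝ} (h : IsCurve k s I u) (hs : s' ≤ s) : IsCurve k s' I u :=
  fun r hr hrs => h r hr (hrs.trans hs)

theorem IsCurve.congr (h : IsCurve k s I u) (hw : ∀ t ∈ I, w t = u t) : IsCurve k s I w := by
  intro r hr hrs
  obtain ⟨U, hU, hu⟩ := h r hr hrs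
  exact ⟨U, hU, fun t ht => (hu t ht).trans (hw t ht).symm⟩

theorem IsCurve.add (h : IsCurve k s I u) (h' : IsCurve k s I w) :
    IsCurve k s I (fun t x => u t x + w t x) := by
  intro r hr hrs
  obtain ⟨U, hU, hu⟩ := h r hr hrs
  obtain ⟨W, hW, hw⟩ := h' r hr hrs
  refine ⟨fun t => U t + W t, hU.add hW, fun t ht => ?_⟩
  rw [toFun_add, hu t ht, hw t ht]
  rfl

theorem isCurve_smul {c : ℝ → ℝ} (hc : ContDiffOn ℝ k c I) {f : ℝ → ℝ}
    (hf : ∀ r : ℝ, 1 / 2 < r → (r : WithTop ℝ) ≤ s → f ∈ HsReal r) :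
    IsCurve k s I (fun t x => c t * f x) := fun r hr hrs =>
  ⟨fun t => c t • ofMem f (hf r hr hrs), hc.smul contDiffOn_const, fun _ _ => rfl⟩

theorem isCurve_scalar {c : ℝ → ℝ} (hc : ContDiffOn ℝ k c I) :
    IsCurve k s I (fun t _ => c t) := by
  simpa only [mul_one] using
    isCurve_smul (s := s) hc (f := fun _ => 1) fun r _ _ => mem_Hs_coe.mp (const_mem_Hs r 1)

theorem IsCurve.comp_clm (h : IsCurve k s I u) {r r' : ℝ} (hr : 1 / 2 < r)
    (hrs : (r : WithTop ℝ) ≤ s) (T : HsSpace r →L[ℝ] HsSpace r') {F : (ℝ → ℝ) → ℝ → ℝ}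
    (hF : ∀ f, (T f).toFun = F f.toFun) :
    ∃ W : ℝ → HsSpace r', ContDiffOn ℝ k W I ∧ ∀ t ∈ I, (W t).toFun = F (u t) := by
  obtain ⟨U, hU, hu⟩ := h r hr hrs
  exact ⟨fun t => T (U t), T.contDiff.comp_contDiffOn hU, fun t ht => by rw [hF, hu t ht]⟩

theorem IsCurve.dx (h : IsCurve k (s + 1) I u) : IsCurve k s I (dx u) := fun r hr hrs =>
  h.comp_clm (by linarith) (coe_add_one_le hrs) (derivCLM hr) (derivCLM_toFun hr)

theorem IsCurve.primitive (hs : ((1 / 2 : ℝ) : WithTop ℝ) < s) (h : IsCurve k s I u) :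
    IsCurve k (s + 1) I (fun t => primitive (u t)) := by
  intro r _ hrs
  obtain ⟨r₀, hr₀, hr₀s⟩ := exists_exponent hs
  have hmax : ((max (r - 1) r₀ : ℝ) : WithTop ℝ) ≤ s := by
    rw [WithTop.coe_max]
    exact max_le (coe_sub_one_le hrs) hr₀s
  have hle : r ≤ max (r - 1) r₀ + 1 := by linarith [le_max_left (r - 1) r₀]
  exact h.comp_clm (hr₀.trans_le (le_max_right _ _)) hmax
    ((inclCLM hle).comp (primitiveCLM _)) fun f => by simp

theorem deriv_toFun_eq_dt (hI : IsOpen I) {r : ℝ} (hr : 1 / 2 < r) {U : ℝ → HsSpace r}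
    (hU : ContDiffOn ℝ (k + 1 : ℕ) U I) (hu : ∀ t ∈ I, (U t).toFun = u t) {t : ℝ} (ht : t ∈ I) :
    (∀ x, HasDerivAt (fun τ => u τ x) ((deriv U t).toFun x) t) ∧ (deriv U t).toFun = dt u t := by
  have hd : HasDerivAt U (deriv U t) t :=
    ((hU.differentiableOn (by simp)).differentiableAt (hI.mem_nhds ht)).hasDerivAt
  have hux : ∀ x, HasDerivAt (fun τ => u τ x) ((deriv U t).toFun x) t := by
    intro x
    refine (hasDerivAt_toFun hr hd x).congr_of_eventuallyEq ?_
    filter_upwards [hI.mem_nhds ht] with τ hτ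
    rw [hu τ hτ]
  exact ⟨hux, funext fun x => (hux x).deriv.symm⟩

theorem IsCurve.dt (hI : IsOpen I) (h : IsCurve (k + 1) s I u) : IsCurve k s I (dt u) := by
  intro r hr hrs
  obtain ⟨U, hU, hu⟩ := h r hr hrs
  exact ⟨deriv U, hU.deriv_of_isOpen hI (by simp),
    fun t ht => (deriv_toFun_eq_dt hI hr hU hu ht).2⟩

section

variable (hs : ((1 / 2 : ℝ) : WithTop ℝ) < s)

include hs

theorem IsCurve.mem_Hs (h : IsCurve k s I u) {t : ℝ} (ht : t ∈ I) : u t ∈ Hs s := by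
  refine mem_Hs_of_forall hs fun r hr hrs => ?_
  obtain ⟨U, -, hu⟩ := h r hr hrs
  exact hu t ht ▸ (U t).mem

theorem continuous_of_mem_Hs {f : ℝ → ℝ} (hf : f ∈ Hs s) : Continuous f :=
  let ⟨r, _, hrs⟩ := exists_exponent hs
  (HunterSaxton.mem_Hs.mp hf r hrs).1

theorem periodic_of_mem_Hs {f : ℝ → ℝ} (hf : f ∈ Hs s) : Function.Periodic f 1 :=
  let ⟨r, _, hrs⟩ := exists_exponent hs
  (HunterSaxton.mem_Hs.mp hf r hrs).2.1

theorem IsCurve.continuous (h : IsCurve k s I u) {t : ℝ} (ht : t ∈ I) : Continuous (u t) :=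
  continuous_of_mem_Hs hs (h.mem_Hs hs ht)

theorem IsCurve.periodic (h : IsCurve k s I u) {t : ℝ} (ht : t ∈ I) :
    Function.Periodic (u t) 1 :=
  periodic_of_mem_Hs hs (h.mem_Hs hs ht)

theorem IsCurve.continuousOn (h : IsCurve k s I u) :
    ContinuousOn (fun p : ℝ × ℝ => u p.1 p.2) (I ×ˢ univ) := by
  obtain ⟨r, hr, hrs⟩ := exists_exponent hs
  obtain ⟨U, hU, hu⟩ := h r hr hrs
  have hpair : ContinuousOn (fun p : ℝ × ℝ => (U p.1, p.2)) (I ×ˢ univ) :=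
    (hU.continuousOn.comp continuousOn_fst fun p hp => hp.1).prodMk continuousOn_snd
  refine ((continuous_eval hr).comp_continuousOn hpair).congr fun p hp => ?_
  rw [Function.comp_apply, hu p.1 hp.1]

theorem IsCurve.eval (h : IsCurve k s I u) (x : ℝ) : ContDiffOn ℝ k (fun t => u t x) I := by
  obtain ⟨r, hr, hrs⟩ := exists_exponent hs
  obtain ⟨U, hU, hu⟩ := h r hr hrs
  refine ((evalCLM hr x).contDiff.comp_contDiffOn hU).congr fun t ht => ?_
  simp [hu t ht]

theorem IsCurve.integral_mul (h : IsCurve k s I u) (h' : IsCurve k s I w) :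
    ContDiffOn ℝ k (fun t => ∫ x in (0 : ℝ)..1, u t x * w t x) I := by
  obtain ⟨r, hr, hrs⟩ := exists_exponent hs
  obtain ⟨U, hU, hu⟩ := h r hr hrs
  obtain ⟨W, hW, hw⟩ := h' r hr hrs
  refine (((pairing hr).contDiff.comp_contDiffOn hU).clm_apply hW).congr fun t ht => ?_
  rw [Function.comp_apply, pairing_apply, hu t ht, hw t ht]

theorem IsCurve.hasDerivAt (hI : IsOpen I) (h : IsCurve (k + 1) s I u) {t : ℝ} (ht : t ∈ I)
    (x : ℝ) : HasDerivAt (fun τ => u τ x) (HunterSaxton.dt u t x) t :=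
  (((h.eval hs x).differentiableOn (by simp)).differentiableAt (hI.mem_nhds ht)).hasDerivAt

theorem IsCurve.contDiff (h : IsCurve k (s + 1) I u) {t : ℝ} (ht : t ∈ I) :
    ContDiff ℝ 1 (u t) := by
  obtain ⟨r, hr, hrs⟩ := exists_exponent hs
  exact contDiff_one_of_mem (r := r + 1) (by linarith)
    (HunterSaxton.mem_Hs.mp (h.mem_Hs (half_lt_add_one hs) ht) _ (coe_add_one_le hrs))

theorem IsCurve.hasDerivAt_space (h : IsCurve k (s + 1) I u) {t : ℝ} (ht : t ∈ I) (x : ℝ) :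
    HasDerivAt (u t) (HunterSaxton.dx u t x) x :=
  ((h.contDiff hs ht).differentiable one_ne_zero x).hasDerivAt

theorem IsCurve.dt_dx (hI : IsOpen I) (h : IsCurve (k + 1) (s + 1) I u) {t : ℝ} (ht : t ∈ I) :
    HunterSaxton.dt (HunterSaxton.dx u) t = HunterSaxton.dx (HunterSaxton.dt u) t := by
  obtain ⟨r, hr, hrs⟩ := exists_exponent hs
  obtain ⟨U, hU, hu⟩ := h (r + 1) (by linarith) (coe_add_one_le hrs)
  have hd : HasDerivAt U (deriv U t) t :=
    ((hU.differentiableOn (by simp)).differentiableAt (hI.mem_nhds ht)).hasDerivAt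
  ext x
  have hdx := hasDerivAt_toFun hr ((derivCLM hr).hasFDerivAt.comp_hasDerivAt t hd) x
  rw [derivCLM_toFun, (deriv_toFun_eq_dt hI (by linarith) hU hu ht).2] at hdx
  refine (hdx.congr_of_eventuallyEq ?_).deriv
  filter_upwards [hI.mem_nhds ht] with τ hτ
  rw [Function.comp_apply, derivCLM_toFun, hu τ hτ]
  rfl

theorem IsCurve.hasStrictFDerivAt (hI : IsOpen I) (h : IsCurve (k + 1) (s + 1) I u) {t : ℝ}
    (ht : t ∈ I) (x : ℝ) :
    HasStrictFDerivAt (fun p : ℝ × ℝ => u p.1 p.2)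
      ((ContinuousLinearMap.toSpanSingleton ℝ (HunterSaxton.dt u t x)).coprod
        (ContinuousLinearMap.toSpanSingleton ℝ (HunterSaxton.dx u t x))) (t, x) := by
  have hs' := half_lt_add_one hs
  have hmem : I ×ˢ (univ : Set ℝ) ∈ 𝓝 (t, x) :=
    (hI.prod isOpen_univ).mem_nhds ⟨ht, mem_univ _⟩
  have hc : Continuous fun c : ℝ => ContinuousLinearMap.toSpanSingleton ℝ c :=
    (ContinuousLinearMap.toSpanSingletonCLE (𝕜 := ℝ) (E := ℝ)).continuous
  refine hasStrictFDerivAt_uncurry_coprod (u := (t, x)) (f := u)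
    (f₁ := fun t x => ContinuousLinearMap.toSpanSingleton ℝ (HunterSaxton.dt u t x))
    (f₂ := fun t x => ContinuousLinearMap.toSpanSingleton ℝ (HunterSaxton.dx u t x)) ?_ ?_ ?_ ?_
  · filter_upwards [hmem] with p hp
    exact (h.hasDerivAt hs' hI hp.1 p.2).hasFDerivAt
  · filter_upwards [hmem] with p hp
    exact (h.hasDerivAt_space hs hp.1 p.2).hasFDerivAt
  · exact hc.continuousAt.comp (((h.dt hI).continuousOn hs').continuousAt hmem)
  · exact hc.continuousAt.comp ((h.dx.continuousOn hs).continuousAt hmem)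

end

end

/-! ### Integrals over space and time -/

/-- Joint continuity on `I × ℝ` of a function of time and space. -/
abbrev JointCont (I : Set ℝ) (f : ℝ → ℝ → ℝ) : Prop :=
  ContinuousOn (fun p : ℝ × ℝ => f p.1 p.2) (I ×ˢ univ)

theorem continuousOn_integral {X : Type*} [TopologicalSpace X] {S : Set X} {f : X → ℝ → ℝ}
    (hf : ContinuousOn (fun p : X × ℝ => f p.1 p.2) (S ×ˢ univ)) (a b : ℝ) :
    ContinuousOn (fun z => ∫ x in a..b, f z x) S := by
  rw [continuousOn_iff_continuous_domRestrict]
  have hcont : Continuous (Function.uncurry fun (z : S) (x : ℝ) => f z x) :=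
    hf.comp_continuous (f := fun p : S × ℝ => ((p.1 : X), p.2)) (by fun_prop)
      fun p => ⟨p.1.2, mem_univ _⟩
  exact intervalIntegral.continuous_parametric_intervalIntegral_of_continuous' hcont a b

section JointCont

variable {I : Set ℝ} {f : ℝ → ℝ → ℝ}

theorem JointCont.space (h : JointCont I f) {t : ℝ} (ht : t ∈ I) : Continuous (f t) := by
  rw [← continuousOn_univ]
  exact h.comp (f := fun x => (t, x)) (by fun_prop) fun x _ => ⟨ht, mem_univ _⟩

theorem JointCont.time (h : JointCont I f) (x : ℝ) : ContinuousOn (fun t => f t x) I :=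
  h.comp (f := fun t => (t, x)) (by fun_prop) fun t ht => ⟨ht, mem_univ _⟩

theorem JointCont.integral (h : JointCont I f) (a b : ℝ) :
    ContinuousOn (fun t => ∫ x in a..b, f t x) I := continuousOn_integral h a b

theorem JointCont.mono {J : Set ℝ} (h : JointCont I f) (hJ : J ⊆ I) : JointCont J f :=
  ContinuousOn.mono h (prod_mono hJ subset_rfl)

theorem JointCont.swap {a b : ℝ} (h : JointCont (uIcc a b) f) (c d : ℝ) :
    ∫ t in a..b, ∫ x in c..d, f t x = ∫ x in c..d, ∫ t in a..b, f t x := by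
  apply intervalIntegral_intervalIntegral_swap
  have hint : IntegrableOn (fun p : ℝ × ℝ => f p.1 p.2) (uIcc a b ×ˢ uIcc c d) :=
    (ContinuousOn.mono h (prod_mono subset_rfl (subset_univ _))).integrableOn_compact
      (isCompact_uIcc.prod isCompact_uIcc)
  exact hint.mono_set (prod_mono uIoc_subset_uIcc uIoc_subset_uIcc)

end JointCont

theorem integral_integral_add_deriv {a b c d : ℝ} {F w w' : ℝ → ℝ → ℝ}
    (hF : JointCont (uIcc a b) F) (hw' : JointCont (uIcc a b) w')
    (hdw : ∀ t ∈ uIcc a b, ∀ x, HasDerivAt (fun τ => w τ x) (w' t x) t)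
    (ha : ∀ x, w a x = 0) (hb : ∀ x, w b x = 0) :
    ∫ t in a..b, ∫ x in c..d, (F t x + w' t x) = ∫ t in a..b, ∫ x in c..d, F t x := by
  have hzero : ∫ t in a..b, ∫ x in c..d, w' t x = 0 := by
    rw [hw'.swap]
    refine intervalIntegral.integral_zero_ae (Eventually.of_forall fun x _ => ?_)
    rw [intervalIntegral.integral_eq_sub_of_hasDerivAt (fun t ht => hdw t ht x)
      (hw'.time x).intervalIntegrable, ha, hb, sub_zero]
  calc ∫ t in a..b, ∫ x in c..d, (F t x + w' t x)
      = ∫ t in a..b, ((∫ x in c..d, F t x) + ∫ x in c..d, w' t x) :=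
        intervalIntegral.integral_congr fun t ht => intervalIntegral.integral_add
          ((hF.space ht).intervalIntegrable _ _) ((hw'.space ht).intervalIntegrable _ _)
    _ = ∫ t in a..b, ∫ x in c..d, F t x := by
        rw [intervalIntegral.integral_add (hF.integral c d).intervalIntegrable
          (hw'.integral c d).intervalIntegrable, hzero, add_zero]

theorem hasDerivAt_integral_of_continuousOn {F F' : ℝ → ℝ → ℝ} {a b p q e₀ : ℝ}
    (he₀ : e₀ ∈ Ioo p q) (hF : ContinuousOn (fun z : ℝ × ℝ => F z.1 z.2) (Icc p q ×ˢ uIcc a b))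
    (hF' : ContinuousOn (fun z : ℝ × ℝ => F' z.1 z.2) (Icc p q ×ˢ uIcc a b))
    (hd : ∀ e ∈ Ioo p q, ∀ t ∈ uIcc a b, HasDerivAt (fun e => F e t) (F' e t) e) :
    HasDerivAt (fun e => ∫ t in a..b, F e t) (∫ t in a..b, F' e₀ t) e₀ := by
  obtain ⟨C, hC⟩ := (isCompact_Icc.prod isCompact_uIcc).exists_bound_of_continuousOn hF'
  have hslice {G : ℝ → ℝ → ℝ}
      (hG : ContinuousOn (fun z : ℝ × ℝ => G z.1 z.2) (Icc p q ×ˢ uIcc a b)) {e : ℝ}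
      (he : e ∈ Ioo p q) : IntervalIntegrable (G e) volume a b :=
    (hG.comp (f := fun t => (e, t)) (by fun_prop)
      fun t ht => ⟨Ioo_subset_Icc_self he, ht⟩).intervalIntegrable
  have hnhds : Ioo p q ∈ 𝓝 e₀ := Ioo_mem_nhds he₀.1 he₀.2
  exact (intervalIntegral.hasDerivAt_integral_of_dominated_loc_of_deriv_le (bound := fun _ => C)
    hnhds (eventually_of_mem hnhds fun e he => (hslice hF he).aestronglyMeasurable_restrict_uIoc)
    (hslice hF he₀) (hslice hF' he₀).aestronglyMeasurable_restrict_uIoc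
    (Eventually.of_forall fun t ht e he =>
      hC (e, t) ⟨Ioo_subset_Icc_self he, uIoc_subset_uIcc ht⟩)
    (by simp) (Eventually.of_forall fun t ht e he => hd e he t (uIoc_subset_uIcc ht))).2

theorem hasDerivAt_integral_integral {F F' : ℝ → ℝ → ℝ → ℝ} {a b c d p q e₀ : ℝ}
    (he₀ : e₀ ∈ Ioo p q)
    (hF : ContinuousOn (fun z : ℝ × ℝ × ℝ => F z.1 z.2.1 z.2.2) (Icc p q ×ˢ uIcc a b ×ˢ univ))
    (hF' : ContinuousOn (fun z : ℝ × ℝ × ℝ => F' z.1 z.2.1 z.2.2) (Icc p q ×ˢ uIcc a b ×ˢ univ))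
    (hd : ∀ e ∈ Ioo p q, ∀ t ∈ uIcc a b, ∀ x, HasDerivAt (fun e => F e t x) (F' e t x) e) :
    HasDerivAt (fun e => ∫ t in a..b, ∫ x in c..d, F e t x)
      (∫ t in a..b, ∫ x in c..d, F' e₀ t x) e₀ := by
  have hinner {G : ℝ → ℝ → ℝ → ℝ} (hG : ContinuousOn (fun z : ℝ × ℝ × ℝ => G z.1 z.2.1 z.2.2)
      (Icc p q ×ˢ uIcc a b ×ˢ univ)) :
      ContinuousOn (fun z : ℝ × ℝ => ∫ x in c..d, G z.1 z.2 x) (Icc p q ×ˢ uIcc a b) :=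
    continuousOn_integral (f := fun (z : ℝ × ℝ) x => G z.1 z.2 x)
      (hG.comp (f := fun z : (ℝ × ℝ) × ℝ => (z.1.1, z.1.2, z.2)) (by fun_prop)
        fun z hz => ⟨hz.1.1, hz.1.2, hz.2⟩) c d
  have hslice {G : ℝ → ℝ → ℝ → ℝ} (hG : ContinuousOn (fun z : ℝ × ℝ × ℝ => G z.1 z.2.1 z.2.2)
      (Icc p q ×ˢ uIcc a b ×ˢ univ)) {t : ℝ} (ht : t ∈ uIcc a b) :
      ContinuousOn (fun z : ℝ × ℝ => G z.1 t z.2) (Icc p q ×ˢ uIcc c d) :=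
    hG.comp (f := fun z : ℝ × ℝ => (z.1, t, z.2)) (by fun_prop) fun z hz => ⟨hz.1, ht, mem_univ _⟩
  exact hasDerivAt_integral_of_continuousOn (F := fun e t => ∫ x in c..d, F e t x)
    (F' := fun e t => ∫ x in c..d, F' e t x) he₀ (hinner hF) (hinner hF') fun e he t ht =>
    hasDerivAt_integral_of_continuousOn (F := fun e x => F e t x) (F' := fun e x => F' e t x)
      he (hslice hF ht) (hslice hF' ht) fun e he x _ => hd e he t ht x

theorem eq_zero_of_integral_mul_eq_zero {I : Set ℝ} (hI : IsOpen I) {G : ℝ → ℝ}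
    (hG : ContinuousOn G I)
    (h : ∀ χ : ℝ → ℝ, ContDiff ℝ (⊤ : ℕ∞) χ → HasCompactSupport χ → tsupport χ ⊆ I →
      ∫ t in I, χ t * G t = 0) {t : ℝ} (ht : t ∈ I) : G t = 0 := by
  have hae : ∀ᵐ t, t ∈ I → G t = 0 := by
    refine hI.ae_eq_zero_of_integral_contDiff_smul_eq_zero
      (hG.locallyIntegrableOn hI.measurableSet) fun χ hχ hcpt hsupp => ?_
    rw [← h χ hχ hcpt hsupp, setIntegral_eq_integral_of_forall_compl_eq_zero fun x hx => by
      rw [image_eq_zero_of_notMem_tsupport fun hx' => hx (hsupp hx'), zero_mul]]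
    rfl
  exact Measure.eqOn_open_of_ae_eq ((ae_restrict_iff' hI.measurableSet).mpr hae) hI hG
    continuousOn_const ht

theorem exists_Icc_subset {I K : Set ℝ} (hI : IsOpen I) (hI' : I.OrdConnected) (hne : I.Nonempty)
    (hK : IsCompact K) (hKI : K ⊆ I) : ∃ a b, a < b ∧ K ⊆ Ioo a b ∧ Icc a b ⊆ I := by
  obtain ⟨t₀, ht₀⟩ := hne
  have hsub : insert t₀ K ⊆ I := insert_subset ht₀ hKI
  obtain ⟨c, hc, hcle⟩ := (hK.insert t₀).exists_isLeast ⟨t₀, mem_insert _ _⟩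
  obtain ⟨d, hd, hdle⟩ := (hK.insert t₀).exists_isGreatest ⟨t₀, mem_insert _ _⟩
  obtain ⟨a, hac, haI⟩ := exists_Ioc_subset_of_mem_nhds (hI.mem_nhds (hsub hc)) (exists_lt c)
  obtain ⟨b, hdb, hbI⟩ := exists_Ico_subset_of_mem_nhds (hI.mem_nhds (hsub hd)) (exists_gt d)
  obtain ⟨a', haa', ha'c⟩ := exists_between hac
  obtain ⟨b', hdb', hb'b⟩ := exists_between hdb
  refine ⟨a', b', ha'c.trans_le ((hcle hd).trans hdb'.le), fun t ht => ?_,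
    hI'.out (haI ⟨haa', ha'c.le⟩) (hbI ⟨hdb'.le, hb'b⟩)⟩
  exact ⟨ha'c.trans_le (hcle (mem_insert_of_mem _ ht)),
    (hdle (mem_insert_of_mem _ ht)).trans_lt hdb'⟩

theorem setIntegral_eq_intervalIntegral {I K : Set ℝ} {a b : ℝ} (hab : a ≤ b)
    (hK : K ⊆ Ioo a b) (hIcc : Icc a b ⊆ I) {F : ℝ → ℝ} (hF : ∀ t, t ∉ K → F t = 0) :
    ∫ t in I, F t = ∫ t in a..b, F t := by
  rw [setIntegral_eq_integral_of_forall_compl_eq_zero, intervalIntegral.integral_of_le hab,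
    setIntegral_eq_integral_of_forall_compl_eq_zero]
  · exact fun t ht => hF t fun h => ht (Ioo_subset_Ioc_self (hK h))
  · exact fun t ht => hF t fun h => ht (hIcc (Ioo_subset_Icc_self (hK h)))

theorem integral_comp_mul_deriv_circle {φ φ' F : ℝ → ℝ} (hφ : ∀ x, HasDerivAt φ (φ' x) x)
    (hφ' : Continuous φ') (hp : φ 1 = φ 0 + 1) (hF : Continuous F) (hFp : Function.Periodic F 1) :
    ∫ x in (0 : ℝ)..1, F x = ∫ y in (0 : ℝ)..1, F (φ y) * φ' y := by
  calc ∫ x in (0 : ℝ)..1, F x = ∫ x in φ 0..φ 1, F x := by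
        rw [hp, hFp.intervalIntegral_add_eq (φ 0) 0, zero_add]
    _ = ∫ y in (0 : ℝ)..1, F (φ y) * φ' y :=
        (intervalIntegral.integral_comp_mul_deriv (fun x _ => hφ x) hφ'.continuousOn hF).symm

/-! ### The first variation of the energy -/

/-- Up to the factor `1 / 4`, the first variation of the energy at `(ρ, [θ])` in the direction of
`ρ`, when `θ` is normalized by `∫ (dt θ) ρ = 0`. -/
def elDensity (ρ θ : ℝ → ℝ → ℝ) (t x : ℝ) : ℝ :=
  dt θ t x ^ 2 + (dt ρ t x / ρ t x) ^ 2 - 2 * dt (dt ρ) t x / ρ t x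

/-- The time derivative of the momentum `(dt θ) ρ`, which is up to the factor `-1 / 2` the first
variation of the energy in the direction of `θ`. -/
def elFibre (ρ θ : ℝ → ℝ → ℝ) (t x : ℝ) : ℝ :=
  dt (dt θ) t x * ρ t x + dt θ t x * dt ρ t x

/-- The Euler–Lagrange equations of the energy.  As variations of `ρ` have mean zero, the first
equation holds up to a constant. -/
def EulerLagrange (I : Set ℝ) (ρ θ : ℝ → ℝ → ℝ) : Prop :=
  ∀ t ∈ I, (∃ c, ∀ x, elDensity ρ θ t x = c) ∧ ∀ x, elFibre ρ θ t x = 0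

/-- A `C²` curve of positive functions together with a `C²` curve of functions, in `H^s(S¹)`. -/
structure IsPair (s : WithTop ℝ) (I : Set ℝ) (ρ θ : ℝ → ℝ → ℝ) : Prop where
  isOpen : IsOpen I
  lt : ((1 / 2 : ℝ) : WithTop ℝ) < s
  density : IsCurve 2 s I ρ
  fibre : IsCurve 2 s I θ
  pos : ∀ t ∈ I, ∀ x, 0 < ρ t x

namespace IsPair

variable {s : WithTop ℝ} {I : Set ℝ} {ρ θ : ℝ → ℝ → ℝ}

theorem jointCont_density (h : IsPair s I ρ θ) : JointCont I ρ := h.density.continuousOn h.lt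

theorem jointCont_dt_density (h : IsPair s I ρ θ) : JointCont I (dt ρ) :=
  (h.density.dt h.isOpen).continuousOn h.lt

theorem jointCont_dt_dt_density (h : IsPair s I ρ θ) : JointCont I (dt (dt ρ)) :=
  ((h.density.dt h.isOpen).dt h.isOpen).continuousOn h.lt

theorem jointCont_dt_fibre (h : IsPair s I ρ θ) : JointCont I (dt θ) :=
  (h.fibre.dt h.isOpen).continuousOn h.lt

theorem jointCont_dt_dt_fibre (h : IsPair s I ρ θ) : JointCont I (dt (dt θ)) :=
  ((h.fibre.dt h.isOpen).dt h.isOpen).continuousOn h.lt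

theorem jointCont_quotient (h : IsPair s I ρ θ) : JointCont I (fun t x => dt ρ t x / ρ t x) :=
  h.jointCont_dt_density.div h.jointCont_density fun p hp => (h.pos p.1 hp.1 p.2).ne'

theorem jointCont_elDensity (h : IsPair s I ρ θ) : JointCont I (elDensity ρ θ) := by
  refine ((h.jointCont_dt_fibre.pow 2).add (h.jointCont_quotient.pow 2)).sub ?_
  exact (continuousOn_const.mul h.jointCont_dt_dt_density).div h.jointCont_density
    fun p hp => (h.pos p.1 hp.1 p.2).ne'

theorem jointCont_elFibre (h : IsPair s I ρ θ) : JointCont I (elFibre ρ θ) :=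
  (h.jointCont_dt_dt_fibre.mul h.jointCont_density).add
    (h.jointCont_dt_fibre.mul h.jointCont_dt_density)

theorem hasDerivAt_density (h : IsPair s I ρ θ) {t : ℝ} (ht : t ∈ I) (x : ℝ) :
    HasDerivAt (fun τ => ρ τ x) (dt ρ t x) t := h.density.hasDerivAt h.lt h.isOpen ht x

theorem hasDerivAt_dt_density (h : IsPair s I ρ θ) {t : ℝ} (ht : t ∈ I) (x : ℝ) :
    HasDerivAt (fun τ => dt ρ τ x) (dt (dt ρ) t x) t :=
  (h.density.dt h.isOpen).hasDerivAt h.lt h.isOpen ht x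

theorem hasDerivAt_dt_fibre (h : IsPair s I ρ θ) {t : ℝ} (ht : t ∈ I) (x : ℝ) :
    HasDerivAt (fun τ => dt θ τ x) (dt (dt θ) t x) t :=
  (h.fibre.dt h.isOpen).hasDerivAt h.lt h.isOpen ht x

theorem periodic_density (h : IsPair s I ρ θ) {t : ℝ} (ht : t ∈ I) : Function.Periodic (ρ t) 1 :=
  h.density.periodic h.lt ht

theorem periodic_dt_density (h : IsPair s I ρ θ) {t : ℝ} (ht : t ∈ I) :
    Function.Periodic (dt ρ t) 1 :=
  (h.density.dt h.isOpen).periodic h.lt ht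

theorem periodic_dt_fibre (h : IsPair s I ρ θ) {t : ℝ} (ht : t ∈ I) :
    Function.Periodic (dt θ t) 1 :=
  (h.fibre.dt h.isOpen).periodic h.lt ht

theorem periodic_elDensity (h : IsPair s I ρ θ) {t : ℝ} (ht : t ∈ I) :
    Function.Periodic (elDensity ρ θ t) 1 := fun x => by
  simp only [elDensity, h.periodic_density ht x, h.periodic_dt_density ht x,
    h.periodic_dt_fibre ht x, ((h.density.dt h.isOpen).dt h.isOpen).periodic h.lt ht x]

theorem periodic_elFibre (h : IsPair s I ρ θ) {t : ℝ} (ht : t ∈ I) :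
    Function.Periodic (elFibre ρ θ t) 1 := fun x => by
  simp only [elFibre, h.periodic_density ht x, h.periodic_dt_density ht x,
    h.periodic_dt_fibre ht x, ((h.fibre.dt h.isOpen).dt h.isOpen).periodic h.lt ht x]

theorem hasDerivAt_momentum (h : IsPair s I ρ θ) {t : ℝ} (ht : t ∈ I) (x : ℝ) :
    HasDerivAt (fun τ => dt θ τ x * ρ τ x) (elFibre ρ θ t x) t :=
  (h.hasDerivAt_dt_fibre ht x).mul (h.hasDerivAt_density ht x)

end IsPair

theorem IsPair.eventually_pos {s : WithTop ℝ} {I : Set ℝ} {ρ θ r : ℝ → ℝ → ℝ}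
    (hp : IsPair s I ρ θ) (hr : IsCurve 2 s I r) {K : Set ℝ} (hK : IsCompact K) (hKI : K ⊆ I) :
    ∀ᶠ e in 𝓝 (0 : ℝ), ∀ t ∈ K, ∀ x, 0 < ρ t x + e * r t x := by
  have hcompact : ∀ᶠ e in 𝓝 (0 : ℝ), ∀ p ∈ K ×ˢ Icc (0 : ℝ) 1,
      0 < ρ p.1 p.2 + e * r p.1 p.2 := by
    refine (hK.prod isCompact_Icc).eventually_forall_of_forall_eventually fun p hpK => ?_
    have hnhds : I ×ˢ univ ∈ 𝓝 p := (hp.isOpen.prod isOpen_univ).mem_nhds ⟨hKI hpK.1, mem_univ _⟩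
    have hρ := hp.jointCont_density.continuousAt hnhds
    have hr' := (hr.continuousOn hp.lt).continuousAt hnhds
    have hcont : ContinuousAt
        (fun z : ℝ × ℝ × ℝ => ρ z.2.1 z.2.2 + z.1 * r z.2.1 z.2.2) (0, p) :=
      (hρ.comp' (x := ((0 : ℝ), p)) continuousAt_snd).fun_add
        (continuousAt_fst.fun_mul (hr'.comp' (x := ((0 : ℝ), p)) continuousAt_snd))
    exact hcont.eventually_const_lt (by simpa using hp.pos _ (hKI hpK.1) _)
  filter_upwards [hcompact] with e he t ht x
  have hper : Function.Periodic (fun y => ρ t y + e * r t y) 1 := fun y => by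
    simp only [hp.density.periodic hp.lt (hKI ht) y, hr.periodic hp.lt (hKI ht) y]
  obtain ⟨y, hy, hxy⟩ := hper.exists_mem_Ico₀ one_pos x
  exact (he (t, y) ⟨ht, Ico_subset_Icc_self hy⟩).trans_eq hxy.symm

theorem normalize_add_mul {P T r H : ℝ → ℝ} (hP : Continuous P) (hT : Continuous T)
    (hr : Continuous r) (hH : Continuous H) (hTP : ∫ x in (0 : ℝ)..1, T x * P x = 0) (e : ℝ) :
    normalize (fun x => P x + e * r x) (fun x => T x + e * H x) = fun x =>
      T x + e * H x - (e * (∫ y in (0 : ℝ)..1, (H y * P y + T y * r y)) +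
        e ^ 2 * ∫ y in (0 : ℝ)..1, H y * r y) := by
  have hmean : ∫ y in (0 : ℝ)..1, (T y + e * H y) * (P y + e * r y) =
      e * (∫ y in (0 : ℝ)..1, (H y * P y + T y * r y)) + e ^ 2 * ∫ y in (0 : ℝ)..1, H y * r y :=
    calc ∫ y in (0 : ℝ)..1, (T y + e * H y) * (P y + e * r y)
        = ∫ y in (0 : ℝ)..1, (T y * P y + (e * (H y * P y + T y * r y) + e ^ 2 * (H y * r y))) := by
          congr 1
          ext y
          ring
      _ = _ := by
          rw [intervalIntegral.integral_add, intervalIntegral.integral_add,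
            intervalIntegral.integral_const_mul, intervalIntegral.integral_const_mul, hTP, zero_add]
          all_goals exact Continuous.intervalIntegrable (by fun_prop) _ _
  ext x
  rw [normalize, hmean]

theorem hasDerivAt_energyDensity {A B P r T H m n e : ℝ} (hpos : P + e * r ≠ 0) :
    HasDerivAt (fun e => (A + e * B) ^ 2 / (P + e * r) +
        (T + e * H - (e * m + e ^ 2 * n)) ^ 2 * (P + e * r))
      ((2 * (A + e * B) * B * (P + e * r) - (A + e * B) ^ 2 * r) / (P + e * r) ^ 2 +
        (2 * (T + e * H - (e * m + e ^ 2 * n)) * (H - (m + 2 * e * n)) * (P + e * r) +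
          (T + e * H - (e * m + e ^ 2 * n)) ^ 2 * r)) e := by
  have hline (p q : ℝ) : HasDerivAt (fun e => p + e * q) q e :=
    (((hasDerivAt_id e).mul_const q).const_add p).congr_deriv (one_mul q)
  have hmean : HasDerivAt (fun e => e * m + e ^ 2 * n) (m + 2 * e * n) e :=
    (((hasDerivAt_id e).mul_const m).fun_add ((hasDerivAt_pow 2 e).mul_const n)).congr_deriv
      (by simp)
  refine ((((hline A B).fun_pow 2).fun_div (hline P r) hpos).fun_add
    ((((hline T H).fun_sub hmean).fun_pow 2).fun_mul (hline P r))).congr_deriv ?_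
  simp

theorem hasDerivAt_integral_energyDensity {a b c d : ℝ} {P A T r B H : ℝ → ℝ → ℝ}
    {m n : ℝ → ℝ} (hP : JointCont (uIcc a b) P) (hA : JointCont (uIcc a b) A)
    (hT : JointCont (uIcc a b) T) (hr : JointCont (uIcc a b) r) (hB : JointCont (uIcc a b) B)
    (hH : JointCont (uIcc a b) H) (hm : ContinuousOn m (uIcc a b))
    (hn : ContinuousOn n (uIcc a b))
    (hpos : ∀ᶠ e in 𝓝 (0 : ℝ), ∀ t ∈ uIcc a b, ∀ x, 0 < P t x + e * r t x) :
    HasDerivAt (fun e => ∫ t in a..b, ∫ x in c..d, ((A t x + e * B t x) ^ 2 / (P t x + e * r t x) +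
        (T t x + e * H t x - (e * m t + e ^ 2 * n t)) ^ 2 * (P t x + e * r t x)))
      (∫ t in a..b, ∫ x in c..d, (2 * (A t x / P t x) * B t x - (A t x / P t x) ^ 2 * r t x +
        2 * T t x * (H t x - m t) * P t x + T t x ^ 2 * r t x)) 0 := by
  obtain ⟨δ, hδ, hpos⟩ := (nhds_basis_Icc_pos (0 : ℝ)).eventually_iff.mp hpos
  have hlift {f : ℝ → ℝ → ℝ} (hf : JointCont (uIcc a b) f) :
      ContinuousOn (fun z : ℝ × ℝ × ℝ => f z.2.1 z.2.2) (Icc (0 - δ) (0 + δ) ×ˢ uIcc a b ×ˢ univ) :=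
    ContinuousOn.comp (f := Prod.snd) hf continuousOn_snd fun z hz => hz.2
  have hlift' {f : ℝ → ℝ} (hf : ContinuousOn f (uIcc a b)) :
      ContinuousOn (fun z : ℝ × ℝ × ℝ => f z.2.1) (Icc (0 - δ) (0 + δ) ×ˢ uIcc a b ×ˢ univ) :=
    hf.comp (f := fun z : ℝ × ℝ × ℝ => z.2.1) (by fun_prop) fun z hz => hz.2.1
  have he : ContinuousOn (fun z : ℝ × ℝ × ℝ => z.1) (Icc (0 - δ) (0 + δ) ×ˢ uIcc a b ×ˢ univ) :=
    continuousOn_fst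
  have hPr := (hlift hP).fun_add (he.fun_mul (hlift hr))
  have hAB := (hlift hA).fun_add (he.fun_mul (hlift hB))
  have hX := ((hlift hT).fun_add (he.fun_mul (hlift hH))).fun_sub
    ((he.fun_mul (hlift' hm)).fun_add ((he.fun_pow 2).fun_mul (hlift' hn)))
  have hX' := (hlift hH).fun_sub ((hlift' hm).fun_add ((he.const_mul 2).fun_mul (hlift' hn)))
  have hpos' : ∀ z ∈ Icc (0 - δ) (0 + δ) ×ˢ uIcc a b ×ˢ univ,
      P z.2.1 z.2.2 + z.1 * r z.2.1 z.2.2 ≠ 0 :=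
    fun z hz => (hpos hz.1 z.2.1 hz.2.1 z.2.2).ne'
  refine (hasDerivAt_integral_integral (by simpa using hδ) ?_ ?_ fun e he t ht x =>
    hasDerivAt_energyDensity (hpos (Ioo_subset_Icc_self he) t ht x).ne').congr_deriv ?_
  · exact ((hAB.fun_pow 2).div hPr hpos').fun_add ((hX.fun_pow 2).fun_mul hPr)
  · exact (((((hAB.const_mul 2).fun_mul (hlift hB)).fun_mul hPr).fun_sub
      ((hAB.fun_pow 2).fun_mul (hlift hr))).div (hPr.fun_pow 2) fun z hz =>
        pow_ne_zero 2 (hpos' z hz)).fun_add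
      ((((hX.const_mul 2).fun_mul hX').fun_mul hPr).fun_add ((hX.fun_pow 2).fun_mul (hlift hr)))
  · refine intervalIntegral.integral_congr fun t ht => intervalIntegral.integral_congr fun x _ => ?_
    have hne : P t x ≠ 0 := by simpa using (hpos (x := 0) (by simp [hδ.le]) t ht x).ne'
    simp only [zero_mul, add_zero]
    field_simp
    ring

theorem integral_energyDensity_sub_const {q P T r B H : ℝ → ℝ} (hq : Continuous q)
    (hP : Continuous P) (hT : Continuous T) (hr : Continuous r) (hB : Continuous B)
    (hH : Continuous H) (m : ℝ) (hnorm : ∫ x in (0 : ℝ)..1, T x * P x = 0) :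
    ∫ x in (0 : ℝ)..1,
        (2 * q x * B x - q x ^ 2 * r x + 2 * T x * (H x - m) * P x + T x ^ 2 * r x) =
      ∫ x in (0 : ℝ)..1,
        (2 * q x * B x - q x ^ 2 * r x + 2 * (T x * P x) * H x + T x ^ 2 * r x) := by
  calc _ = ∫ x in (0 : ℝ)..1, ((2 * q x * B x - q x ^ 2 * r x + 2 * (T x * P x) * H x +
          T x ^ 2 * r x) - 2 * m * (T x * P x)) := by
        congr 1
        ext x
        ring
    _ = _ := by
        rw [intervalIntegral.integral_sub, intervalIntegral.integral_const_mul, hnorm, mul_zero,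
          sub_zero]
        all_goals exact Continuous.intervalIntegrable (by fun_prop) _ _

theorem dt_add_mul {s : WithTop ℝ} {I : Set ℝ} {u w : ℝ → ℝ → ℝ}
    (hs : ((1 / 2 : ℝ) : WithTop ℝ) < s) (hI : IsOpen I) (hu : IsCurve 2 s I u)
    (hw : IsCurve 2 s I w) (e : ℝ) {t : ℝ} (ht : t ∈ I) :
    dt (fun t x => u t x + e * w t x) t = fun x => dt u t x + e * dt w t x :=
  funext fun x => ((hu.hasDerivAt hs hI ht x).fun_add
    ((hw.hasDerivAt hs hI ht x).const_mul e)).deriv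

theorem IsPair.hasDerivAt_energy {s : WithTop ℝ} {I : Set ℝ} {ρ θ : ℝ → ℝ → ℝ}
    (hp : IsPair s I ρ θ) (hnorm : ∀ t ∈ I, ∫ x in (0 : ℝ)..1, dt θ t x * ρ t x = 0) {a b : ℝ}
    (hab : uIcc a b ⊆ I) {r η : ℝ → ℝ → ℝ} (hr : IsCurve 2 s I r) (hη : IsCurve 2 s I η) :
    HasDerivAt (fun e : ℝ => energy a b (fun t x => ρ t x + e * r t x)
        (fun t x => θ t x + e * η t x))
      (1 / 4 * ∫ t in a..b, ∫ x in (0 : ℝ)..1, (2 * (dt ρ t x / ρ t x) * dt r t x -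
        (dt ρ t x / ρ t x) ^ 2 * r t x + 2 * (dt θ t x * ρ t x) * dt η t x +
        dt θ t x ^ 2 * r t x)) 0 := by
  have cr : JointCont I r := hr.continuousOn hp.lt
  have crt : JointCont I (dt r) := (hr.dt hp.isOpen).continuousOn hp.lt
  have cηt : JointCont I (dt η) := (hη.dt hp.isOpen).continuousOn hp.lt
  set m : ℝ → ℝ := fun t => ∫ y in (0 : ℝ)..1, (dt η t y * ρ t y + dt θ t y * r t y)
  set n : ℝ → ℝ := fun t => ∫ y in (0 : ℝ)..1, dt η t y * r t y
  have cm : ContinuousOn m I := JointCont.integral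
    (f := fun t y => dt η t y * ρ t y + dt θ t y * r t y)
    ((cηt.mul hp.jointCont_density).add (hp.jointCont_dt_fibre.mul cr)) 0 1
  have cn : ContinuousOn n I :=
    JointCont.integral (f := fun t y => dt η t y * r t y) (cηt.mul cr) 0 1
  refine ((hasDerivAt_integral_energyDensity (c := 0) (d := 1) (hp.jointCont_density.mono hab)
    (hp.jointCont_dt_density.mono hab) (hp.jointCont_dt_fibre.mono hab) (cr.mono hab)
    (crt.mono hab) (cηt.mono hab) (cm.mono hab) (cn.mono hab)
    (hp.eventually_pos hr isCompact_uIcc hab)).const_mul (1 / 4)).congr_deriv ?_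
    |>.congr_of_eventuallyEq (Eventually.of_forall fun e => ?_)
  · congr 1
    refine intervalIntegral.integral_congr fun t ht => ?_
    exact integral_energyDensity_sub_const (hp.jointCont_quotient.space (hab ht))
      (hp.jointCont_density.space (hab ht)) (hp.jointCont_dt_fibre.space (hab ht))
      (cr.space (hab ht)) (crt.space (hab ht)) (cηt.space (hab ht)) (m t) (hnorm t (hab ht))
  · simp only [energy, sasaki, intervalIntegral.integral_const_mul]
    congr 1
    refine intervalIntegral.integral_congr fun t ht => ?_
    simp only [dt_add_mul hp.lt hp.isOpen hp.density hr e (hab ht),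
      dt_add_mul hp.lt hp.isOpen hp.fibre hη e (hab ht)]
    rw [normalize_add_mul (hp.jointCont_density.space (hab ht))
      (hp.jointCont_dt_fibre.space (hab ht)) (cr.space (hab ht)) (cηt.space (hab ht))
      (hnorm t (hab ht))]

theorem IsPair.hasDerivAt_energy_eulerLagrange {s : WithTop ℝ} {I : Set ℝ} {ρ θ : ℝ → ℝ → ℝ}
    (hp : IsPair s I ρ θ) (hnorm : ∀ t ∈ I, ∫ x in (0 : ℝ)..1, dt θ t x * ρ t x = 0) {a b : ℝ}
    (hab : uIcc a b ⊆ I) {r η : ℝ → ℝ → ℝ} (hr : IsCurve 2 s I r) (hη : IsCurve 2 s I η)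
    (hra : r a = 0) (hrb : r b = 0) (hηa : η a = 0) (hηb : η b = 0) :
    HasDerivAt (fun e : ℝ => energy a b (fun t x => ρ t x + e * r t x)
        (fun t x => θ t x + e * η t x))
      (1 / 4 * ∫ t in a..b, ∫ x in (0 : ℝ)..1,
        (elDensity ρ θ t x * r t x - 2 * (elFibre ρ θ t x * η t x))) 0 := by
  refine (hp.hasDerivAt_energy hnorm hab hr hη).congr_deriv (congrArg _ ?_)
  have hρ0 (t : ℝ) (ht : t ∈ uIcc a b) (x : ℝ) : ρ t x ≠ 0 := (hp.pos t (hab ht) x).ne'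
  have cr : JointCont I r := hr.continuousOn hp.lt
  have crt : JointCont I (dt r) := (hr.dt hp.isOpen).continuousOn hp.lt
  have cη : JointCont I η := hη.continuousOn hp.lt
  have cηt : JointCont I (dt η) := (hη.dt hp.isOpen).continuousOn hp.lt
  have cEL : JointCont I fun t x => elDensity ρ θ t x * r t x - 2 * (elFibre ρ θ t x * η t x) :=
    (hp.jointCont_elDensity.mul cr).sub
      (continuousOn_const.mul (hp.jointCont_elFibre.mul cη))
  -- The boundary term of the integration by parts is the pairing of `(r, η)` with the momenta.
  set w : ℝ → ℝ → ℝ := fun t x => 2 * (dt ρ t x / ρ t x * r t x + dt θ t x * ρ t x * η t x)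
  set w' : ℝ → ℝ → ℝ := fun t x =>
    2 * ((dt (dt ρ) t x * ρ t x - dt ρ t x * dt ρ t x) / ρ t x ^ 2 * r t x +
      dt ρ t x / ρ t x * dt r t x + (elFibre ρ θ t x * η t x + dt θ t x * ρ t x * dt η t x))
  have cw' : JointCont (uIcc a b) w' := by
    have cq' : JointCont (uIcc a b) fun t x =>
        (dt (dt ρ) t x * ρ t x - dt ρ t x * dt ρ t x) / ρ t x ^ 2 :=
      ((hp.jointCont_dt_dt_density.mul hp.jointCont_density).sub
        (hp.jointCont_dt_density.mul hp.jointCont_dt_density)).mono (prod_mono hab subset_rfl)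
        |>.div ((hp.jointCont_density.mono hab).pow 2) fun p h => pow_ne_zero 2 (hρ0 p.1 h.1 p.2)
    exact continuousOn_const.mul (((cq'.mul (cr.mono hab)).add
      ((hp.jointCont_quotient.mono hab).mul (crt.mono hab))).add
      (((hp.jointCont_elFibre.mul cη).add
        ((hp.jointCont_dt_fibre.mul hp.jointCont_density).mul cηt)).mono
        (prod_mono hab subset_rfl)))
  have hdw (t : ℝ) (ht : t ∈ uIcc a b) (x : ℝ) : HasDerivAt (fun τ => w τ x) (w' t x) t :=
    ((((hp.hasDerivAt_dt_density (hab ht) x).div (hp.hasDerivAt_density (hab ht) x)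
      (hρ0 t ht x)).mul (hr.hasDerivAt hp.lt hp.isOpen (hab ht) x)).add
      ((hp.hasDerivAt_momentum (hab ht) x).mul
        (hη.hasDerivAt hp.lt hp.isOpen (hab ht) x))).const_mul 2
  rw [← integral_integral_add_deriv (cEL.mono hab) cw' hdw (fun x => by simp [w, hra, hηa])
    fun x => by simp [w, hrb, hηb]]
  refine intervalIntegral.integral_congr fun t ht => intervalIntegral.integral_congr fun x _ => ?_
  have hρ := hρ0 t ht x
  simp only [elDensity, w']
  field_simp
  ring

theorem integral_eq_zero_of_hasDerivAt_periodic {f f' : ℝ → ℝ} (hf : ∀ x, HasDerivAt f (f' x) x)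
    (hf' : Continuous f') (hp : Function.Periodic f 1) : ∫ x in (0 : ℝ)..1, f' x = 0 := by
  rw [intervalIntegral.integral_eq_sub_of_hasDerivAt (fun x _ => hf x)
    (hf'.intervalIntegrable _ _), ← hp 0, zero_add, sub_self]

theorem integral_cosFun {n : ℤ} (hn : n ≠ 0) : ∫ x in (0 : ℝ)..1, cosFun n x = 0 := by
  have h := integral_eq_zero_of_hasDerivAt_periodic (hasDerivAt_sinFun n)
    ((contDiff_cosFun n (n := 0)).continuous.const_mul _) (periodic_sinFun n)
  simpa [hn, Real.pi_ne_zero] using h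

theorem integral_sinFun {n : ℤ} (hn : n ≠ 0) : ∫ x in (0 : ℝ)..1, sinFun n x = 0 := by
  have h := integral_eq_zero_of_hasDerivAt_periodic (hasDerivAt_cosFun n)
    ((contDiff_sinFun n (n := 0)).continuous.const_mul _) (periodic_cosFun n)
  simpa [hn, Real.pi_ne_zero] using h

theorem integral_mul_eq_zero_of_localized {I : Set ℝ} (hI : IsOpen I) (hI' : I.OrdConnected)
    {G : ℝ → ℝ → ℝ} (hG : JointCont I G) {f : ℝ → ℝ} (hf : Continuous f)
    (h : ∀ a b, a < b → Icc a b ⊆ I → ∀ χ : ℝ → ℝ, ContDiff ℝ (⊤ : ℕ∞) χ → χ a = 0 → χ b = 0 →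
      ∫ t in a..b, ∫ x in (0 : ℝ)..1, G t x * (χ t * f x) = 0) {t : ℝ} (ht : t ∈ I) :
    ∫ x in (0 : ℝ)..1, G t x * f x = 0 := by
  have hGf : JointCont I fun t x => G t x * f x :=
    hG.mul (hf.comp continuous_snd).continuousOn
  refine eq_zero_of_integral_mul_eq_zero hI (hGf.integral 0 1) (fun χ hχ hcpt hsupp => ?_) ht
  obtain ⟨a, b, hab, hK, hIcc⟩ := exists_Icc_subset hI hI' ⟨t, ht⟩ hcpt hsupp
  have hχ0 (τ : ℝ) (hτ : τ ∉ tsupport χ) : χ τ = 0 := image_eq_zero_of_notMem_tsupport hτ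
  calc ∫ t in I, χ t * ∫ x in (0 : ℝ)..1, G t x * f x
      = ∫ t in a..b, χ t * ∫ x in (0 : ℝ)..1, G t x * f x :=
        setIntegral_eq_intervalIntegral hab.le hK hIcc fun τ hτ => by rw [hχ0 τ hτ, zero_mul]
    _ = ∫ t in a..b, ∫ x in (0 : ℝ)..1, G t x * (χ t * f x) := by
        simp only [← intervalIntegral.integral_const_mul, mul_left_comm (χ _)]
    _ = 0 := h a b hab hIcc χ hχ (hχ0 a fun h => (hK h).1.false) (hχ0 b fun h => (hK h).2.false)

section

variable {s : WithTop ℝ} {I : Set ℝ} {ρ θ : ℝ → ℝ → ℝ}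

/-- Vanishing of the first variation of the energy, with fixed end points, on every compact
subinterval of `I`. -/
def IsStationary (s : WithTop ℝ) (I : Set ℝ) (ρ θ : ℝ → ℝ → ℝ) : Prop :=
  ∀ a b, a < b → Icc a b ⊆ I → ∀ r η : ℝ → ℝ → ℝ, IsCurve 2 s I r → IsCurve 2 s I η →
    (∀ t ∈ I, ∫ x in (0 : ℝ)..1, r t x = 0) → r a = 0 → r b = 0 → η a = 0 → η b = 0 →
    ∫ t in a..b, ∫ x in (0 : ℝ)..1,
      (elDensity ρ θ t x * r t x - 2 * (elFibre ρ θ t x * η t x)) = 0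

theorem EulerLagrange.isStationary (h : EulerLagrange I ρ θ) : IsStationary s I ρ θ := by
  intro a b hab hIcc r η _ _ hr0 _ _ _ _
  have hzero (t : ℝ) (ht : t ∈ uIcc a b) : ∫ x in (0 : ℝ)..1,
      (elDensity ρ θ t x * r t x - 2 * (elFibre ρ θ t x * η t x)) = 0 := by
    have htI : t ∈ I := hIcc (uIcc_of_le hab.le ▸ ht)
    obtain ⟨⟨c, hc⟩, hfibre⟩ := h t htI
    simp only [hc, hfibre, zero_mul, mul_zero, sub_zero]
    rw [intervalIntegral.integral_const_mul, hr0 t htI, mul_zero]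
  rw [intervalIntegral.integral_congr (g := fun _ => 0) hzero, intervalIntegral.integral_zero]

theorem isCurve_cutoff {χ : ℝ → ℝ} (hχ : ContDiff ℝ (⊤ : ℕ∞) χ) {f : ℝ → ℝ}
    (hf : ∀ r, f ∈ HsReal r) : IsCurve 2 s I (fun t x => χ t * f x) :=
  isCurve_smul (hχ.of_le (WithTop.coe_le_coe.mpr le_top)).contDiffOn fun r _ _ => hf r

theorem isCurve_zero {k : ℕ} : IsCurve k s I (fun _ _ => 0) :=
  isCurve_scalar (c := fun _ => 0) contDiffOn_const

theorem IsStationary.integral_elDensity_mul (hp : IsPair s I ρ θ) (hI' : I.OrdConnected)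
    (h : IsStationary s I ρ θ) {f : ℝ → ℝ} (hf : ∀ r, f ∈ HsReal r)
    (hf0 : ∫ x in (0 : ℝ)..1, f x = 0) {t : ℝ} (ht : t ∈ I) :
    ∫ x in (0 : ℝ)..1, elDensity ρ θ t x * f x = 0 := by
  refine integral_mul_eq_zero_of_localized hp.isOpen hI' hp.jointCont_elDensity (hf 1).1
    (fun a b hab hIcc χ hχ ha hb => ?_) ht
  have hχf := h a b hab hIcc _ _ (isCurve_cutoff hχ hf) isCurve_zero
    (fun t _ => by rw [intervalIntegral.integral_const_mul, hf0, mul_zero])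
    (funext fun x => by simp [ha]) (funext fun x => by simp [hb]) rfl rfl
  simpa only [mul_zero, sub_zero] using hχf

theorem IsStationary.integral_elFibre_mul (hp : IsPair s I ρ θ) (hI' : I.OrdConnected)
    (h : IsStationary s I ρ θ) {f : ℝ → ℝ} (hf : ∀ r, f ∈ HsReal r) {t : ℝ} (ht : t ∈ I) :
    ∫ x in (0 : ℝ)..1, elFibre ρ θ t x * f x = 0 := by
  refine integral_mul_eq_zero_of_localized hp.isOpen hI' hp.jointCont_elFibre (hf 1).1
    (fun a b hab hIcc χ hχ ha hb => ?_) ht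
  have hχf := h a b hab hIcc _ _ isCurve_zero (isCurve_cutoff hχ hf)
    (fun _ _ => intervalIntegral.integral_zero) rfl rfl
    (funext fun x => by simp [ha]) (funext fun x => by simp [hb])
  simpa [intervalIntegral.integral_const_mul] using hχf

theorem IsPair.isStationary_iff (hp : IsPair s I ρ θ) (hI' : I.OrdConnected) :
    IsStationary s I ρ θ ↔ EulerLagrange I ρ θ := by
  refine ⟨fun h t ht => ⟨⟨∫ x in (0 : ℝ)..1, elDensity ρ θ t x, fun x => ?_⟩, fun x => ?_⟩,
    EulerLagrange.isStationary⟩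
  · exact eq_mean_of_orthogonal (hp.jointCont_elDensity.space ht) (hp.periodic_elDensity ht)
      (fun n hn => h.integral_elDensity_mul hp hI' (cosFun_mem n) (integral_cosFun hn) ht)
      (fun n hn => h.integral_elDensity_mul hp hI' (sinFun_mem n) (integral_sinFun hn) ht) x
  · rw [eq_mean_of_orthogonal (hp.jointCont_elFibre.space ht) (hp.periodic_elFibre ht)
      (fun n _ => h.integral_elFibre_mul hp hI' (cosFun_mem n) ht)
      (fun n _ => h.integral_elFibre_mul hp hI' (sinFun_mem n) ht) x]
    simpa [cosFun] using h.integral_elFibre_mul hp hI' (cosFun_mem 0) ht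

end

theorem mem_constants_iff {s : WithTop ℝ} {f : Hs s} :
    f ∈ constants s ↔ ∃ c : ℝ, ∀ x, (f : ℝ → ℝ) x = c := by
  simp [constants, Submodule.mem_span_singleton, funext_iff, eq_comm]

theorem mkQ_eq_iff {s : WithTop ℝ} {f g : Hs s} :
    (constants s).mkQ f = (constants s).mkQ g ↔
      ∃ c : ℝ, ∀ x, (f : ℝ → ℝ) x = (g : ℝ → ℝ) x + c := by
  simp only [Submodule.mkQ_apply, Submodule.Quotient.eq, mem_constants_iff, Submodule.coe_sub,
    Pi.sub_apply, sub_eq_iff_eq_add']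

theorem normalize_add_const {ρ f : ℝ → ℝ} (hρ : Continuous ρ) (hf : Continuous f)
    (h1 : ∫ x in (0 : ℝ)..1, ρ x = 1) (c : ℝ) :
    normalize ρ (fun x => f x + c) = normalize ρ f := by
  ext x
  simp only [normalize, add_mul]
  rw [intervalIntegral.integral_add (Continuous.intervalIntegrable (by fun_prop) _ _)
    (Continuous.intervalIntegrable (by fun_prop) _ _), intervalIntegral.integral_const_mul, h1]
  ring

section

variable {s : WithTop ℝ} {I : Set ℝ} {γ : ℝ → CotDens s} {Θ Θ' : ℝ → Hs s}

theorem IsLift.isPair (hs : ((1 / 2 : ℝ) : WithTop ℝ) < s) (hI : IsOpen I)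
    (h : IsLift 2 I γ Θ) : IsPair s I (fun t => (γ t).density) (fun t => (Θ t : ℝ → ℝ)) where
  isOpen := hI
  lt := hs
  density := h.1
  fibre := h.2.1
  pos := fun t _ => (γ t).1.2.1

theorem IsLift.exists_dt_eq {k : ℕ} (hs : ((1 / 2 : ℝ) : WithTop ℝ) < s) (hI : IsOpen I)
    (h : IsLift (k + 1) I γ Θ) (h' : IsLift (k + 1) I γ Θ') {t : ℝ} (ht : t ∈ I) :
    ∃ c, ∀ x, dt (fun τ => (Θ' τ : ℝ → ℝ)) t x = dt (fun τ => (Θ τ : ℝ → ℝ)) t x + c := by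
  refine ⟨dt (fun τ => (Θ' τ : ℝ → ℝ)) t 0 - dt (fun τ => (Θ τ : ℝ → ℝ)) t 0, fun x => ?_⟩
  have hΘ (x : ℝ) := h.2.1.hasDerivAt hs hI ht x
  have hΘ' (x : ℝ) := h'.2.1.hasDerivAt hs hI ht x
  refine (hΘ' x).unique (((hΘ x).add ((hΘ' 0).sub (hΘ 0))).congr_of_eventuallyEq ?_)
  filter_upwards [hI.mem_nhds ht] with τ hτ
  obtain ⟨c, hc⟩ := mkQ_eq_iff.mp ((h'.2.2 τ hτ).trans (h.2.2 τ hτ).symm)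
  simp only [Pi.add_apply, Pi.sub_apply, hc]
  ring

theorem energy_congr_lift (hs : ((1 / 2 : ℝ) : WithTop ℝ) < s) (hI : IsOpen I)
    (h : IsLift 2 I γ Θ) (h' : IsLift 2 I γ Θ') {a b : ℝ} (hab : uIcc a b ⊆ I)
    {r η : ℝ → ℝ → ℝ} (hr : IsCurve 2 s I r) (hη : IsCurve 2 s I η)
    (hr0 : ∀ t ∈ I, ∫ x in (0 : ℝ)..1, r t x = 0) (e : ℝ) :
    energy a b (fun t x => (γ t).density x + e * r t x)
      (fun t x => (Θ' t : ℝ → ℝ) x + e * η t x) =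
    energy a b (fun t x => (γ t).density x + e * r t x)
      (fun t x => (Θ t : ℝ → ℝ) x + e * η t x) := by
  refine intervalIntegral.integral_congr fun t ht => congrArg _ ?_
  have htI : t ∈ I := hab ht
  obtain ⟨c, hc⟩ := h.exists_dt_eq hs hI h' htI
  have cρ : Continuous (γ t).density := h.1.continuous hs htI
  have cr : Continuous (r t) := hr.continuous hs htI
  have cθ : Continuous (dt (fun τ => (Θ τ : ℝ → ℝ)) t) := (h.2.1.dt hI).continuous hs htI
  have cη : Continuous (dt η t) := (hη.dt hI).continuous hs htI
  have hmass : ∫ x in (0 : ℝ)..1, ((γ t).density x + e * r t x) = 1 := by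
    rw [intervalIntegral.integral_add (cρ.intervalIntegrable _ _)
      ((cr.const_mul e).intervalIntegrable _ _), intervalIntegral.integral_const_mul, hr0 t htI,
      mul_zero, add_zero]
    exact (γ t).1.2.2
  rw [dt_add_mul hs hI (u := fun t => (Θ' t : ℝ → ℝ)) h'.2.1 hη e htI,
    dt_add_mul hs hI (u := fun t => (Θ t : ℝ → ℝ)) h.2.1 hη e htI]
  simp only [hc, add_right_comm _ c]
  exact normalize_add_const (by fun_prop) (by fun_prop) hmass c

theorem isGeodesic_iff_isStationary (hs : ((1 / 2 : ℝ) : WithTop ℝ) < s) (hI : IsOpen I)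
    (h : IsLift 2 I γ Θ)
    (hnorm : ∀ t ∈ I, ∫ x in (0 : ℝ)..1, dt (fun τ => (Θ τ : ℝ → ℝ)) t x * (γ t).density x = 0) :
    IsGeodesic I γ ↔ IsStationary s I (fun t => (γ t).density) (fun t => (Θ t : ℝ → ℝ)) := by
  constructor
  · rintro ⟨Θ', h', hcrit⟩ a b hab hIcc r η hr hη hr0 hra hrb hηa hηb
    have hab' : uIcc a b ⊆ I := uIcc_of_le hab.le ▸ hIcc
    have hder := (h.isPair hs hI).hasDerivAt_energy_eulerLagrange hnorm hab' hr hη hra hrb hηa hηb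
    have hzero := hcrit a b hab hIcc r η hr hη hr0 hra hrb hηa hηb
    simp only [energy_congr_lift hs hI h h' hab' hr hη hr0] at hzero
    linarith [hder.unique hzero]
  · refine fun hst => ⟨Θ, h, fun a b hab hIcc r η hr hη hr0 hra hrb hηa hηb => ?_⟩
    refine ((h.isPair hs hI).hasDerivAt_energy_eulerLagrange hnorm (uIcc_of_le hab.le ▸ hIcc) hr hη
      hra hrb hηa hηb).congr_deriv ?_
    rw [hst a b hab hIcc r η hr hη hr0 hra hrb hηa hηb, mul_zero]

theorem isGeodesic_iff_eulerLagrange (hs : ((1 / 2 : ℝ) : WithTop ℝ) < s) (hI : IsOpen I)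
    (hI' : I.OrdConnected) (h : IsLift 2 I γ Θ)
    (hnorm : ∀ t ∈ I, ∫ x in (0 : ℝ)..1, dt (fun τ => (Θ τ : ℝ → ℝ)) t x * (γ t).density x = 0) :
    IsGeodesic I γ ↔ EulerLagrange I (fun t => (γ t).density) (fun t => (Θ t : ℝ → ℝ)) :=
  (isGeodesic_iff_isStationary hs hI h hnorm).trans ((h.isPair hs hI).isStationary_iff hI')

end

/-! ### Diffeomorphisms of the circle and flows -/

/-- A lift to the line of an orientation preserving `C¹` diffeomorphism of the circle, with
derivative `φ'`. -/
structure IsCircleDiffeo (φ φ' : ℝ → ℝ) : Prop where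
  hasDerivAt : ∀ x, HasDerivAt φ (φ' x) x
  continuous_deriv : Continuous φ'
  pos : ∀ x, 0 < φ' x
  periodic : Function.Periodic (fun x => φ x - x) 1

namespace IsCircleDiffeo

variable {φ φ' : ℝ → ℝ}

theorem continuous (h : IsCircleDiffeo φ φ') : Continuous φ :=
  continuous_iff_continuousAt.mpr fun x => (h.hasDerivAt x).continuousAt

theorem strictMono (h : IsCircleDiffeo φ φ') : StrictMono φ :=
  strictMono_of_deriv_pos fun x => (h.hasDerivAt x).deriv ▸ h.pos x

theorem add_one (h : IsCircleDiffeo φ φ') (x : ℝ) : φ (x + 1) = φ x + 1 := by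
  linarith [h.periodic x]

theorem surjective (h : IsCircleDiffeo φ φ') : Function.Surjective φ :=
  let lift : CircleDeg1Lift := ⟨⟨φ, h.strictMono.monotone⟩, h.add_one⟩
  h.continuous.surjective lift.tendsto_atTop lift.tendsto_atBot

theorem invFun_apply (h : IsCircleDiffeo φ φ') (x : ℝ) : Function.invFun φ (φ x) = x :=
  Function.leftInverse_invFun h.strictMono.injective x

theorem apply_invFun (h : IsCircleDiffeo φ φ') (x : ℝ) : φ (Function.invFun φ x) = x :=
  Function.rightInverse_invFun h.surjective x

theorem continuous_invFun (h : IsCircleDiffeo φ φ') : Continuous (Function.invFun φ) := by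
  refine Monotone.continuous_of_surjective (fun x y hxy => ?_) fun x => ⟨φ x, h.invFun_apply x⟩
  rwa [← h.strictMono.le_iff_le, h.apply_invFun, h.apply_invFun]

theorem invFun_add_one (h : IsCircleDiffeo φ φ') (x : ℝ) :
    Function.invFun φ (x + 1) = Function.invFun φ x + 1 := by
  apply h.strictMono.injective
  rw [h.add_one, h.apply_invFun, h.apply_invFun]

theorem hasDerivAt_invFun (h : IsCircleDiffeo φ φ') (x : ℝ) :
    HasDerivAt (Function.invFun φ) (φ' (Function.invFun φ x))⁻¹ x :=
  HasDerivAt.of_local_left_inverse h.continuous_invFun.continuousAt (h.hasDerivAt _)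
    (h.pos _).ne' (Eventually.of_forall h.apply_invFun)

theorem integral_comp (h : IsCircleDiffeo φ φ') {F : ℝ → ℝ} (hF : Continuous F)
    (hp : Function.Periodic F 1) :
    ∫ x in (0 : ℝ)..1, F x = ∫ y in (0 : ℝ)..1, F (φ y) * φ' y :=
  integral_comp_mul_deriv_circle h.hasDerivAt h.continuous_deriv
    (by simpa using h.add_one 0) hF hp

theorem periodic_comp_invFun (h : IsCircleDiffeo φ φ') {G : ℝ → ℝ} (hp : Function.Periodic G 1) :
    Function.Periodic (fun x => G (Function.invFun φ x)) 1 := fun x => by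
  simp only [h.invFun_add_one, hp _]

theorem integral_comp_invFun_mul (h : IsCircleDiffeo φ φ') {G f : ℝ → ℝ} (hG : Continuous G)
    (hp : Function.Periodic G 1) (hf : Continuous f) (hfp : Function.Periodic f 1) :
    ∫ x in (0 : ℝ)..1, G (Function.invFun φ x) * f x =
      ∫ y in (0 : ℝ)..1, G y * φ' y * f (φ y) := by
  rw [h.integral_comp (F := fun x => G (Function.invFun φ x) * f x)
    ((hG.comp h.continuous_invFun).mul hf) ((h.periodic_comp_invFun hp).mul hfp)]
  simp only [h.invFun_apply, mul_right_comm]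

theorem integral_comp_invFun (h : IsCircleDiffeo φ φ') {G : ℝ → ℝ} (hG : Continuous G)
    (hp : Function.Periodic G 1) :
    ∫ x in (0 : ℝ)..1, G (Function.invFun φ x) = ∫ y in (0 : ℝ)..1, G y * φ' y := by
  simpa only [mul_one] using
    h.integral_comp_invFun_mul hG hp (f := fun _ => 1) continuous_const fun _ => rfl

theorem eq_mean_of_orthogonal (h : IsCircleDiffeo φ φ') {G : ℝ → ℝ} (hG : Continuous G)
    (hp : Function.Periodic G 1)
    (hcos : ∀ n : ℤ, n ≠ 0 → ∫ y in (0 : ℝ)..1, G y * φ' y * cosFun n (φ y) = 0)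
    (hsin : ∀ n : ℤ, n ≠ 0 → ∫ y in (0 : ℝ)..1, G y * φ' y * sinFun n (φ y) = 0) (y : ℝ) :
    G y = ∫ y in (0 : ℝ)..1, G y * φ' y := by
  have hmean := HunterSaxton.eq_mean_of_orthogonal (hG.comp h.continuous_invFun)
    (h.periodic_comp_invFun hp)
    (fun n hn => (h.integral_comp_invFun_mul hG hp (contDiff_cosFun n (n := 0)).continuous
      (periodic_cosFun n)).trans (hcos n hn))
    (fun n hn => (h.integral_comp_invFun_mul hG hp (contDiff_sinFun n (n := 0)).continuous
      (periodic_sinFun n)).trans (hsin n hn)) (φ y)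
  simpa only [Function.comp_apply, h.invFun_apply, h.integral_comp_invFun hG hp] using hmean

theorem eq_zero_of_orthogonal (h : IsCircleDiffeo φ φ') {G : ℝ → ℝ} (hG : Continuous G)
    (hp : Function.Periodic G 1) (hφ' : Function.Periodic φ' 1)
    (hcos : ∀ n : ℤ, ∫ y in (0 : ℝ)..1, G y * cosFun n (φ y) = 0)
    (hsin : ∀ n : ℤ, ∫ y in (0 : ℝ)..1, G y * sinFun n (φ y) = 0) (y : ℝ) : G y = 0 := by
  have hne (x : ℝ) : φ' x ≠ 0 := (h.pos x).ne'
  have hmean := h.eq_mean_of_orthogonal (G := fun y => G y / φ' y)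
    (hG.div h.continuous_deriv hne) (fun x => by simp only [hp x, hφ' x])
    (fun n _ => by simpa only [div_mul_cancel₀ _ (hne _)] using hcos n)
    (fun n _ => by simpa only [div_mul_cancel₀ _ (hne _)] using hsin n) y
  have hG0 : ∫ y in (0 : ℝ)..1, G y = 0 := by simpa [cosFun] using hcos 0
  simpa [div_mul_cancel₀ _ (hne _), hG0, hne y] using hmean

end IsCircleDiffeo

section

variable {k : ℕ} {s : WithTop ℝ} {I : Set ℝ} {φ : ℝ → ℝ → ℝ}

theorem dt_sub_id (φ : ℝ → ℝ → ℝ) : dt (fun t x => φ t x - x) = dt φ := by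
  ext t x
  simp [dt]

theorem hasDerivAt_of_sub_id (hs : ((1 / 2 : ℝ) : WithTop ℝ) < s)
    (h : IsCurve k (s + 1) I (fun t x => φ t x - x)) {t : ℝ} (ht : t ∈ I) (x : ℝ) :
    HasDerivAt (φ t) (dx (fun t x => φ t x - x) t x + 1) x := by
  simpa using (h.hasDerivAt_space hs ht x).fun_add (hasDerivAt_id' x)

theorem dx_eq_dx_sub_id_add_one (hs : ((1 / 2 : ℝ) : WithTop ℝ) < s)
    (h : IsCurve k (s + 1) I (fun t x => φ t x - x)) {t : ℝ} (ht : t ∈ I) :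
    dx φ t = fun x => dx (fun t x => φ t x - x) t x + 1 :=
  funext fun x => (hasDerivAt_of_sub_id hs h ht x).deriv

theorem isCurve_dx_of_sub_id (hs : ((1 / 2 : ℝ) : WithTop ℝ) < s)
    (h : IsCurve k (s + 1) I (fun t x => φ t x - x)) : IsCurve k s I (dx φ) :=
  (h.dx.add (isCurve_scalar (c := fun _ => 1) contDiffOn_const)).congr fun _ ht =>
    dx_eq_dx_sub_id_add_one hs h ht

theorem dt_dx_of_sub_id (hs : ((1 / 2 : ℝ) : WithTop ℝ) < s) (hI : IsOpen I)
    (h : IsCurve (k + 1) (s + 1) I (fun t x => φ t x - x)) {t : ℝ} (ht : t ∈ I) :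
    dt (dx φ) t = dx (dt φ) t := by
  rw [← dt_sub_id φ, ← h.dt_dx hs hI ht]
  ext x
  refine (((h.dx.hasDerivAt hs hI ht x).add_const 1).congr_of_eventuallyEq ?_).deriv
  filter_upwards [hI.mem_nhds ht] with τ hτ
  rw [dx_eq_dx_sub_id_add_one hs h hτ]

theorem isCircleDiffeo_of_sub_id (hs : ((1 / 2 : ℝ) : WithTop ℝ) < s)
    (h : IsCurve k (s + 1) I (fun t x => φ t x - x)) {t : ℝ} (ht : t ∈ I)
    (hpos : ∀ x, 0 < dx φ t x) : IsCircleDiffeo (φ t) (dx φ t) where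
  hasDerivAt x := (hasDerivAt_of_sub_id hs h ht x).differentiableAt.hasDerivAt
  continuous_deriv := (isCurve_dx_of_sub_id hs h).continuous hs ht
  pos := hpos
  periodic := h.periodic (half_lt_add_one hs) ht

end

/-- A `C²` curve of circle diffeomorphisms `φ` and functions `a`, with its Eulerian velocity
`(v, σ)`. -/
structure IsFlow (s : WithTop ℝ) (I : Set ℝ) (φ a v σ : ℝ → ℝ → ℝ) : Prop where
  isOpen : IsOpen I
  lt : ((1 / 2 : ℝ) : WithTop ℝ) < s
  curve : IsCurve 2 (s + 1) I (fun t x => φ t x - x)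
  curve_fibre : IsCurve 2 s I a
  pos : ∀ t ∈ I, ∀ x, 0 < dx φ t x
  velocity : ∀ t ∈ I, ∀ x, dt φ t x = v t (φ t x)
  velocity_fibre : ∀ t ∈ I, ∀ x, dt a t x = σ t (φ t x)

namespace IsFlow

variable {s : WithTop ℝ} {I : Set ℝ} {φ a v σ : ℝ → ℝ → ℝ}

theorem isCircleDiffeo (h : IsFlow s I φ a v σ) {t : ℝ} (ht : t ∈ I) :
    IsCircleDiffeo (φ t) (dx φ t) := isCircleDiffeo_of_sub_id h.lt h.curve ht (h.pos t ht)

theorem isPair (h : IsFlow s I φ a v σ) : IsPair s I (dx φ) a where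
  isOpen := h.isOpen
  lt := h.lt
  density := isCurve_dx_of_sub_id h.lt h.curve
  fibre := h.curve_fibre
  pos := h.pos

theorem curve_dt (h : IsFlow s I φ a v σ) : IsCurve 1 (s + 1) I (dt φ) :=
  dt_sub_id φ ▸ h.curve.dt h.isOpen

theorem hasDerivAt_time (h : IsFlow s I φ a v σ) {t : ℝ} (ht : t ∈ I) (x : ℝ) :
    HasDerivAt (fun τ => φ τ x) (v t (φ t x)) t := by
  have hdisp := h.curve.hasDerivAt (half_lt_add_one h.lt) h.isOpen ht x
  rw [dt_sub_id, h.velocity t ht] at hdisp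
  simpa using hdisp.add_const x

theorem velocity_eq (h : IsFlow s I φ a v σ) {t : ℝ} (ht : t ∈ I) :
    v t = fun x => dt φ t (Function.invFun (φ t) x) := by
  ext x
  rw [h.velocity t ht, (h.isCircleDiffeo ht).apply_invFun]

theorem velocity_fibre_eq (h : IsFlow s I φ a v σ) {t : ℝ} (ht : t ∈ I) :
    σ t = fun x => dt a t (Function.invFun (φ t) x) := by
  ext x
  rw [h.velocity_fibre t ht, (h.isCircleDiffeo ht).apply_invFun]

theorem hasDerivAt_velocity (h : IsFlow s I φ a v σ) {t : ℝ} (ht : t ∈ I) (x : ℝ) :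
    HasDerivAt (v t) (dt (dx φ) t (Function.invFun (φ t) x) / dx φ t (Function.invFun (φ t) x))
      x := by
  rw [h.velocity_eq ht, div_eq_mul_inv, dt_dx_of_sub_id h.lt h.isOpen h.curve ht]
  exact (h.curve_dt.hasDerivAt_space h.lt ht _).comp x ((h.isCircleDiffeo ht).hasDerivAt_invFun x)

theorem dx_velocity (h : IsFlow s I φ a v σ) {t : ℝ} (ht : t ∈ I) :
    dx v t = fun x =>
      dt (dx φ) t (Function.invFun (φ t) x) / dx φ t (Function.invFun (φ t) x) :=
  funext fun x => (h.hasDerivAt_velocity ht x).deriv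

theorem dx_velocity_apply (h : IsFlow s I φ a v σ) {t : ℝ} (ht : t ∈ I) (y : ℝ) :
    dx v t (φ t y) = dt (dx φ) t y / dx φ t y := by
  simp only [h.dx_velocity ht, (h.isCircleDiffeo ht).invFun_apply]

theorem continuous_velocity (h : IsFlow s I φ a v σ) {t : ℝ} (ht : t ∈ I) : Continuous (v t) :=
  continuous_iff_continuousAt.mpr fun x => (h.hasDerivAt_velocity ht x).continuousAt

theorem continuous_dx_velocity (h : IsFlow s I φ a v σ) {t : ℝ} (ht : t ∈ I) :
    Continuous (dx v t) := by
  rw [h.dx_velocity ht]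
  exact (h.isPair.jointCont_quotient.space ht).comp (h.isCircleDiffeo ht).continuous_invFun

theorem continuous_velocity_fibre (h : IsFlow s I φ a v σ) {t : ℝ} (ht : t ∈ I) :
    Continuous (σ t) := by
  rw [h.velocity_fibre_eq ht]
  exact (h.isPair.jointCont_dt_fibre.space ht).comp (h.isCircleDiffeo ht).continuous_invFun

theorem periodic_velocity (h : IsFlow s I φ a v σ) {t : ℝ} (ht : t ∈ I) :
    Function.Periodic (v t) 1 := by
  rw [h.velocity_eq ht]
  exact (h.isCircleDiffeo ht).periodic_comp_invFun (h.curve_dt.periodic (half_lt_add_one h.lt) ht)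

theorem periodic_velocity_fibre (h : IsFlow s I φ a v σ) {t : ℝ} (ht : t ∈ I) :
    Function.Periodic (σ t) 1 := by
  rw [h.velocity_fibre_eq ht]
  exact (h.isCircleDiffeo ht).periodic_comp_invFun (h.isPair.periodic_dt_fibre ht)

theorem integral_velocity_fibre (h : IsFlow s I φ a v σ) {t : ℝ} (ht : t ∈ I) :
    ∫ x in (0 : ℝ)..1, σ t x = ∫ y in (0 : ℝ)..1, dt a t y * dx φ t y := by
  rw [h.velocity_fibre_eq ht]
  exact (h.isCircleDiffeo ht).integral_comp_invFun (h.isPair.jointCont_dt_fibre.space ht)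
    (h.isPair.periodic_dt_fibre ht)

theorem jointCont (h : IsFlow s I φ a v σ) : JointCont I φ := by
  simpa using (h.curve.continuousOn (half_lt_add_one h.lt)).fun_add continuousOn_snd

theorem jointCont_dt (h : IsFlow s I φ a v σ) : JointCont I (dt φ) :=
  h.curve_dt.continuousOn (half_lt_add_one h.lt)

theorem jointCont_comp (h : IsFlow s I φ a v σ) {ζ : ℝ → ℝ → ℝ}
    (hζ : Continuous fun p : ℝ × ℝ => ζ p.1 p.2) : JointCont I (fun t y => ζ t (φ t y)) :=
  hζ.comp_continuousOn (continuousOn_fst.prodMk h.jointCont)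

end IsFlow

/-! ### Weak solutions and the Euler–Lagrange equations -/

section

variable {I : Set ℝ} {η : ℝ → ℝ → ℝ}

theorem hasDerivAt_dt {t x : ℝ} (h : DifferentiableAt ℝ (fun p : ℝ × ℝ => η p.1 p.2) (t, x)) :
    HasDerivAt (fun τ => η τ x) (fderiv ℝ (fun p : ℝ × ℝ => η p.1 p.2) (t, x) (1, 0)) t :=
  h.hasFDerivAt.comp_hasDerivAt (f := fun τ => (τ, x)) t
    ((hasDerivAt_id t).prodMk (hasDerivAt_const t x))

theorem hasDerivAt_dx {t x : ℝ} (h : DifferentiableAt ℝ (fun p : ℝ × ℝ => η p.1 p.2) (t, x)) :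
    HasDerivAt (η t) (fderiv ℝ (fun p : ℝ × ℝ => η p.1 p.2) (t, x) (0, 1)) x :=
  h.hasFDerivAt.comp_hasDerivAt (f := fun y => (t, y)) x
    ((hasDerivAt_const x t).prodMk (hasDerivAt_id x))

theorem contDiff_dt (h : ContDiff ℝ (⊤ : ℕ∞) fun p : ℝ × ℝ => η p.1 p.2) :
    ContDiff ℝ (⊤ : ℕ∞) fun p : ℝ × ℝ => dt η p.1 p.2 := by
  simp only [dt, (hasDerivAt_dt (h.differentiable (by simp) _)).deriv]
  exact (h.fderiv_right (m := (⊤ : ℕ∞)) (by simp)).clm_apply contDiff_const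

theorem contDiff_dx (h : ContDiff ℝ (⊤ : ℕ∞) fun p : ℝ × ℝ => η p.1 p.2) :
    ContDiff ℝ (⊤ : ℕ∞) fun p : ℝ × ℝ => dx η p.1 p.2 := by
  simp only [dx, (hasDerivAt_dx (h.differentiable (by simp) _)).deriv]
  exact (h.fderiv_right (m := (⊤ : ℕ∞)) (by simp)).clm_apply contDiff_const

theorem hasDerivAt_along {c : ℝ → ℝ} {c' t : ℝ}
    (h : DifferentiableAt ℝ (fun p : ℝ × ℝ => η p.1 p.2) (t, c t)) (hc : HasDerivAt c c' t) :
    HasDerivAt (fun τ => η τ (c τ)) (dt η t (c t) + dx η t (c t) * c') t := by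
  refine (h.hasFDerivAt.comp_hasDerivAt (f := fun τ => (τ, c τ)) t
    ((hasDerivAt_id t).prodMk hc)).congr_deriv ?_
  have hsplit : ((1 : ℝ), c') = (1, 0) + c' • (0, 1) := by simp
  rw [hsplit, map_add, map_smul, smul_eq_mul, dt, dx, (hasDerivAt_dt h).deriv,
    (hasDerivAt_dx h).deriv, mul_comm c']

theorem dt_eq_zero_of_notMem {K : Set ℝ} (hK : IsClosed K)
    (h : ∀ t, t ∉ K → ∀ x, η t x = 0) {t : ℝ} (ht : t ∉ K) (x : ℝ) : dt η t x = 0 := by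
  have hev : (fun τ => η τ x) =ᶠ[𝓝 t] fun _ => 0 := by
    filter_upwards [hK.isOpen_compl.mem_nhds ht] with τ hτ
    exact h τ hτ x
  rw [dt, hev.deriv_eq, deriv_const]

theorem dx_eq_zero_of_eq_zero {t : ℝ} (h : ∀ x, η t x = 0) (x : ℝ) : dx η t x = 0 := by
  rw [dx, funext h, deriv_const]

theorem periodic_deriv {u : ℝ → ℝ} {c : ℝ} (h : Function.Periodic u c) :
    Function.Periodic (deriv u) c := fun x => by
  rw [← deriv_comp_add_const, h.funext]

namespace IsTest

theorem continuous (h : IsTest I η) (t : ℝ) : Continuous (η t) :=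
  h.1.continuous.comp (Continuous.prodMk_right t)

theorem hasDerivAt_space (h : IsTest I η) (t x : ℝ) : HasDerivAt (η t) (dx η t x) x :=
  (hasDerivAt_dx (h.1.differentiable (by simp) _)).differentiableAt.hasDerivAt

theorem exists_Icc (h : IsTest I η) (hI : IsOpen I) (hI' : I.OrdConnected) (hne : I.Nonempty) :
    ∃ b c, b < c ∧ Icc b c ⊆ I ∧
      ∀ t, t ∉ Ioo b c → ∀ x, η t x = 0 ∧ dt η t x = 0 ∧ dx η t x = 0 := by
  obtain ⟨-, -, K, hK, hKI, h0⟩ := h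
  obtain ⟨b, c, hbc, hKbc, hIcc⟩ := exists_Icc_subset hI hI' hne hK hKI
  refine ⟨b, c, hbc, hIcc, fun t ht x => ?_⟩
  have htK : t ∉ K := fun htK => ht (hKbc htK)
  exact ⟨h0 t htK x, dt_eq_zero_of_notMem hK.isClosed h0 htK x,
    dx_eq_zero_of_eq_zero (h0 t htK) x⟩

end IsTest

theorem isTest_dt (h : IsTest I η) : IsTest I (dt η) := by
  obtain ⟨hη, hper, K, hK, hKI, h0⟩ := h
  exact ⟨contDiff_dt hη, fun t x => by simp only [dt, hper _ x], K, hK, hKI,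
    fun t => dt_eq_zero_of_notMem hK.isClosed h0⟩

theorem isTest_dx (h : IsTest I η) : IsTest I (dx η) := by
  obtain ⟨hη, hper, K, hK, hKI, h0⟩ := h
  exact ⟨contDiff_dx hη, fun t => periodic_deriv (hper t), K, hK, hKI,
    fun t ht => dx_eq_zero_of_eq_zero (h0 t ht)⟩

theorem isTest_mul {χ f : ℝ → ℝ} (hχ : ContDiff ℝ (⊤ : ℕ∞) χ) (hcpt : HasCompactSupport χ)
    (hsupp : tsupport χ ⊆ I) (hf : ContDiff ℝ (⊤ : ℕ∞) f) (hp : Function.Periodic f 1) :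
    IsTest I (fun t x => χ t * f x) :=
  ⟨(hχ.comp contDiff_fst).mul (hf.comp contDiff_snd), fun t x => by simp only [hp x], tsupport χ,
    hcpt, hsupp, fun t ht x => by
      simp only [image_eq_zero_of_notMem_tsupport ht, zero_mul]⟩

theorem integral_mul_comp_eq_zero (hI : IsOpen I) {G φ : ℝ → ℝ → ℝ} (hG : JointCont I G)
    (hφ : JointCont I φ) {f : ℝ → ℝ} (hf : Continuous f)
    (h : ∀ χ : ℝ → ℝ, ContDiff ℝ (⊤ : ℕ∞) χ → HasCompactSupport χ → tsupport χ ⊆ I →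
      ∫ t in I, ∫ y in (0 : ℝ)..1, G t y * (χ t * f (φ t y)) = 0) {t : ℝ} (ht : t ∈ I) :
    ∫ y in (0 : ℝ)..1, G t y * f (φ t y) = 0 := by
  have hGf : JointCont I fun t y => G t y * f (φ t y) := hG.mul (hf.comp_continuousOn hφ)
  refine eq_zero_of_integral_mul_eq_zero hI (hGf.integral 0 1) (fun χ hχ hcpt hsupp => ?_) ht
  simpa only [← intervalIntegral.integral_const_mul, mul_left_comm (χ _)] using h χ hχ hcpt hsupp

end

namespace IsFlow

variable {s : WithTop ℝ} {I : Set ℝ} {φ a v σ ζ : ℝ → ℝ → ℝ}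

theorem jointCont_dt_along (h : IsFlow s I φ a v σ) (hζ : IsTest I ζ) :
    JointCont I (fun t y => dt ζ t (φ t y) + dx ζ t (φ t y) * v t (φ t y)) := by
  refine ((h.jointCont_comp (contDiff_dt hζ.1).continuous).add
    ((h.jointCont_comp (contDiff_dx hζ.1).continuous).mul h.jointCont_dt)).congr fun p hp => ?_
  simp only [Pi.add_apply, Pi.mul_apply, h.velocity p.1 hp.1]

theorem integral_mul_along (h : IsFlow s I φ a v σ) (hI' : I.OrdConnected) (hne : I.Nonempty)
    {P Q R : ℝ → ℝ → ℝ} (hP : JointCont I P) (hQ : JointCont I Q) (hR : JointCont I R)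
    (hPQ : ∀ t ∈ I, ∀ x, HasDerivAt (fun τ => P τ x) (Q t x) t) (hζ : IsTest I ζ) :
    ∫ t in I, ∫ y in (0 : ℝ)..1, (P t y * (dt ζ t (φ t y) + dx ζ t (φ t y) * v t (φ t y)) +
      R t y * ζ t (φ t y)) = ∫ t in I, ∫ y in (0 : ℝ)..1, (R t y - Q t y) * ζ t (φ t y) := by
  obtain ⟨b, c, hbc, hIcc, h0⟩ := hζ.exists_Icc h.isOpen hI' hne
  have hbcI : uIcc b c ⊆ I := uIcc_of_le hbc.le ▸ hIcc
  have cζ : JointCont I (fun t y => ζ t (φ t y)) := h.jointCont_comp hζ.1.continuous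
  have cF : JointCont I fun t y => (R t y - Q t y) * ζ t (φ t y) := (hR.sub hQ).mul cζ
  have cw' : JointCont I fun t y => Q t y * ζ t (φ t y) +
      P t y * (dt ζ t (φ t y) + dx ζ t (φ t y) * v t (φ t y)) :=
    (hQ.mul cζ).add (hP.mul (h.jointCont_dt_along hζ))
  rw [setIntegral_eq_intervalIntegral hbc.le subset_rfl hIcc fun t ht => by simp [h0 t ht],
    setIntegral_eq_intervalIntegral hbc.le subset_rfl hIcc fun t ht => by simp [h0 t ht],
    ← integral_integral_add_deriv (cF.mono hbcI) (cw'.mono hbcI)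
      (w := fun t y => P t y * ζ t (φ t y))
      (fun t ht y => (hPQ t (hbcI ht) y).mul
        (hasDerivAt_along (hζ.1.differentiable (by simp) _) (h.hasDerivAt_time (hbcI ht) y)))
      (fun y => by simp [h0 b]) fun y => by simp [h0 c]]
  refine intervalIntegral.integral_congr fun t _ => intervalIntegral.integral_congr fun y _ => ?_
  ring

theorem integral_velocity_dt (h : IsFlow s I φ a v σ) (hζ : IsTest I ζ) {t : ℝ} (ht : t ∈ I) :
    ∫ x in (0 : ℝ)..1, (dx v t x * dt ζ t x + v t x * dx v t x * dx ζ t x +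
      (dx v t x ^ 2 / 2 + σ t x ^ 2 / 2) * ζ t x) =
    ∫ y in (0 : ℝ)..1, (dt (dx φ) t y * (dt ζ t (φ t y) + dx ζ t (φ t y) * v t (φ t y)) +
      ((dt (dx φ) t y / dx φ t y) ^ 2 / 2 + dt a t y ^ 2 / 2) * dx φ t y * ζ t (φ t y)) := by
  have cv := h.continuous_velocity ht
  have cv' := h.continuous_dx_velocity ht
  have cσ := h.continuous_velocity_fibre ht
  have cζ := hζ.continuous t
  have cζt := (isTest_dt hζ).continuous t
  have cζx := (isTest_dx hζ).continuous t
  have pv' : Function.Periodic (dx v t) 1 := periodic_deriv (h.periodic_velocity ht)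
  rw [(h.isCircleDiffeo ht).integral_comp (by fun_prop) fun x => by
    simp only [h.periodic_velocity ht x, pv' x, h.periodic_velocity_fibre ht x, hζ.2.1 t x,
      (isTest_dt hζ).2.1 t x, (isTest_dx hζ).2.1 t x]]
  refine intervalIntegral.integral_congr fun y _ => ?_
  have hne : dx φ t y ≠ 0 := (h.pos t ht y).ne'
  simp only [h.dx_velocity_apply ht, ← h.velocity_fibre t ht]
  field_simp

theorem integral_velocity_fibre_dt (h : IsFlow s I φ a v σ) (hζ : IsTest I ζ) {t : ℝ}
    (ht : t ∈ I) :
    ∫ x in (0 : ℝ)..1, (σ t x * dt ζ t x + σ t x * v t x * dx ζ t x) =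
    ∫ y in (0 : ℝ)..1,
      dt a t y * dx φ t y * (dt ζ t (φ t y) + dx ζ t (φ t y) * v t (φ t y)) := by
  have cv := h.continuous_velocity ht
  have cσ := h.continuous_velocity_fibre ht
  have cζt := (isTest_dt hζ).continuous t
  have cζx := (isTest_dx hζ).continuous t
  rw [(h.isCircleDiffeo ht).integral_comp (by fun_prop) fun x => by
    simp only [h.periodic_velocity ht x, h.periodic_velocity_fibre ht x,
      (isTest_dt hζ).2.1 t x, (isTest_dx hζ).2.1 t x]]
  refine intervalIntegral.integral_congr fun y _ => ?_
  simp only [h.velocity_fibre t ht]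
  ring

theorem integral_weak_velocity (h : IsFlow s I φ a v σ) (hI' : I.OrdConnected)
    (hne : I.Nonempty) (hζ : IsTest I ζ) :
    ∫ t in I, ∫ x in (0 : ℝ)..1, (dx v t x * dt ζ t x + v t x * dx v t x * dx ζ t x +
      (dx v t x ^ 2 / 2 + σ t x ^ 2 / 2) * ζ t x) =
    ∫ t in I, ∫ y in (0 : ℝ)..1, 1 / 2 * elDensity (dx φ) a t y * dx φ t y * ζ t (φ t y) := by
  have hp := h.isPair
  have cR : JointCont I fun t y =>
      ((dt (dx φ) t y / dx φ t y) ^ 2 / 2 + dt a t y ^ 2 / 2) * dx φ t y :=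
    (((hp.jointCont_quotient.pow 2).div_const 2).add
      ((hp.jointCont_dt_fibre.pow 2).div_const 2)).mul hp.jointCont_density
  rw [setIntegral_congr_fun h.isOpen.measurableSet fun t ht => h.integral_velocity_dt hζ ht,
    h.integral_mul_along hI' hne hp.jointCont_dt_density hp.jointCont_dt_dt_density cR
      (fun t ht => hp.hasDerivAt_dt_density ht) hζ]
  refine setIntegral_congr_fun h.isOpen.measurableSet fun t ht =>
    intervalIntegral.integral_congr fun y _ => ?_
  have hne : dx φ t y ≠ 0 := (h.pos t ht y).ne'
  simp only [elDensity]
  field_simp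
  ring

theorem integral_weak_fibre (h : IsFlow s I φ a v σ) (hI' : I.OrdConnected)
    (hne : I.Nonempty) (hζ : IsTest I ζ) :
    ∫ t in I, ∫ x in (0 : ℝ)..1, (σ t x * dt ζ t x + σ t x * v t x * dx ζ t x) =
    ∫ t in I, ∫ y in (0 : ℝ)..1, -elFibre (dx φ) a t y * ζ t (φ t y) := by
  have hp := h.isPair
  have htransport := h.integral_mul_along hI' hne (P := fun t y => dt a t y * dx φ t y)
    (R := fun _ _ => 0) (hp.jointCont_dt_fibre.mul hp.jointCont_density) hp.jointCont_elFibre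
    continuousOn_const (fun t ht => hp.hasDerivAt_momentum ht) hζ
  simp only [zero_mul, add_zero, zero_sub] at htransport
  rw [← htransport]
  exact setIntegral_congr_fun h.isOpen.measurableSet fun t ht => h.integral_velocity_fibre_dt hζ ht

theorem integral_elDensity_mul_comp (h : IsFlow s I φ a v σ) (hI' : I.OrdConnected)
    (hw : IsWeakSolution I v σ) {f F : ℝ → ℝ} (hf : Continuous f)
    (hF : ContDiff ℝ (⊤ : ℕ∞) F) (hp : Function.Periodic F 1) (hd : ∀ x, HasDerivAt F (f x) x)
    {t : ℝ} (ht : t ∈ I) :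
    ∫ y in (0 : ℝ)..1, elDensity (dx φ) a t y * dx φ t y * f (φ t y) = 0 := by
  have cG : JointCont I fun t y => 1 / 2 * elDensity (dx φ) a t y * dx φ t y :=
    (continuousOn_const.mul h.isPair.jointCont_elDensity).mul h.isPair.jointCont_density
  have hzero := integral_mul_comp_eq_zero h.isOpen cG h.jointCont hf
    (fun χ hχ hcpt hsupp => ?_) ht
  · simpa [mul_assoc, intervalIntegral.integral_const_mul] using hzero
  · have htest := isTest_mul hχ hcpt hsupp hF hp
    have hdx : dx (fun t x => χ t * F x) = fun t x => χ t * f x :=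
      funext fun t => funext fun x => ((hd x).const_mul (χ t)).deriv
    have hweak := (hw _ htest).1
    rwa [h.integral_weak_velocity hI' ⟨t, ht⟩ (isTest_dx htest), hdx] at hweak

theorem integral_elFibre_mul_comp (h : IsFlow s I φ a v σ) (hI' : I.OrdConnected)
    (hw : IsWeakSolution I v σ) {f : ℝ → ℝ} (hf : ContDiff ℝ (⊤ : ℕ∞) f)
    (hp : Function.Periodic f 1) {t : ℝ} (ht : t ∈ I) :
    ∫ y in (0 : ℝ)..1, elFibre (dx φ) a t y * f (φ t y) = 0 := by
  have cG : JointCont I fun t y => -elFibre (dx φ) a t y := h.isPair.jointCont_elFibre.neg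
  have hzero := integral_mul_comp_eq_zero h.isOpen cG h.jointCont hf.continuous
    (fun χ hχ hcpt hsupp => ?_) ht
  · simpa using hzero
  · have htest := isTest_mul hχ hcpt hsupp hf hp
    rw [← h.integral_weak_fibre hI' ⟨t, ht⟩ htest]
    exact (hw _ htest).2

theorem eulerLagrange_of_isWeakSolution (h : IsFlow s I φ a v σ) (hI' : I.OrdConnected)
    (hw : IsWeakSolution I v σ) : EulerLagrange I (dx φ) a := by
  have hp := h.isPair
  refine fun t ht => ⟨⟨∫ y in (0 : ℝ)..1, elDensity (dx φ) a t y * dx φ t y, ?_⟩, ?_⟩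
  · refine (h.isCircleDiffeo ht).eq_mean_of_orthogonal (hp.jointCont_elDensity.space ht)
      (hp.periodic_elDensity ht) (fun n hn => ?_) fun n hn => ?_
    · have horth := h.integral_elDensity_mul_comp hI' hw
        ((contDiff_cosFun n (n := 0)).continuous.const_mul _) (contDiff_sinFun n)
        (periodic_sinFun n) (hasDerivAt_sinFun n) ht
      simp only [mul_left_comm _ (2 * Real.pi * n), intervalIntegral.integral_const_mul] at horth
      simpa [hn, Real.pi_ne_zero] using horth
    · have horth := h.integral_elDensity_mul_comp hI' hw
        ((contDiff_sinFun n (n := 0)).continuous.const_mul _) (contDiff_cosFun n)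
        (periodic_cosFun n) (hasDerivAt_cosFun n) ht
      simp only [mul_left_comm _ (-(2 * Real.pi * n)), intervalIntegral.integral_const_mul]
        at horth
      simpa [hn, Real.pi_ne_zero] using horth
  · exact (h.isCircleDiffeo ht).eq_zero_of_orthogonal (hp.jointCont_elFibre.space ht)
      (hp.periodic_elFibre ht) (hp.periodic_density ht)
      (fun n => h.integral_elFibre_mul_comp hI' hw (contDiff_cosFun n) (periodic_cosFun n) ht)
      (fun n => h.integral_elFibre_mul_comp hI' hw (contDiff_sinFun n) (periodic_sinFun n) ht)

theorem isWeakSolution_of_eulerLagrange (h : IsFlow s I φ a v σ) (hI' : I.OrdConnected)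
    (hne : I.Nonempty) (hEL : EulerLagrange I (dx φ) a) : IsWeakSolution I v σ := by
  intro η hη
  rw [h.integral_weak_velocity hI' hne (isTest_dx hη), h.integral_weak_fibre hI' hne hη]
  refine ⟨setIntegral_eq_zero_of_forall_eq_zero fun t ht => ?_,
    setIntegral_eq_zero_of_forall_eq_zero fun t ht => by simp [(hEL t ht).2]⟩
  obtain ⟨⟨c, hc⟩, -⟩ := hEL t ht
  have cη := (isTest_dx hη).continuous t
  have hmean : ∫ y in (0 : ℝ)..1, dx η t (φ t y) * dx φ t y = 0 := by
    rw [← (h.isCircleDiffeo ht).integral_comp cη ((isTest_dx hη).2.1 t)]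
    exact integral_eq_zero_of_hasDerivAt_periodic (hη.hasDerivAt_space t) cη (hη.2.1 t)
  simp only [hc, mul_assoc, intervalIntegral.integral_const_mul, mul_comm (dx φ t _), hmean,
    mul_zero]

theorem isWeakSolution_iff_eulerLagrange (h : IsFlow s I φ a v σ) (hI' : I.OrdConnected)
    (hne : I.Nonempty) : IsWeakSolution I v σ ↔ EulerLagrange I (dx φ) a :=
  ⟨h.eulerLagrange_of_isWeakSolution hI', h.isWeakSolution_of_eulerLagrange hI' hne⟩

end IsFlow

/-! ### Classical solutions -/

/-- The second space derivative, in Lagrangian coordinates, of the velocity of a flow whose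
Jacobian is `ρ`. -/
def lagrangianSecondDeriv (ρ : ℝ → ℝ → ℝ) (t y : ℝ) : ℝ :=
  (dx (dt ρ) t y * ρ t y - dt ρ t y * dx ρ t y) / ρ t y ^ 3

theorem IsCurve.differentiableAt_uncurry {k : ℕ} {s : WithTop ℝ} {I : Set ℝ} {u : ℝ → ℝ → ℝ}
    (hs : ((1 / 2 : ℝ) : WithTop ℝ) < s) (hI : IsOpen I) (h : IsCurve (k + 1) (s + 1) I u) {t : ℝ}
    (ht : t ∈ I) (x : ℝ) : DifferentiableAt ℝ (fun p : ℝ × ℝ => u p.1 p.2) (t, x) :=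
  (h.hasStrictFDerivAt hs hI ht x).hasFDerivAt.differentiableAt

namespace IsPair

variable {S : WithTop ℝ} {I : Set ℝ} {ρ θ : ℝ → ℝ → ℝ} {t : ℝ}

theorem hasDerivAt_quotient_space (h : IsPair (S + 1) I ρ θ)
    (hS : ((1 / 2 : ℝ) : WithTop ℝ) < S) (ht : t ∈ I) (y : ℝ) :
    HasDerivAt (fun y => dt ρ t y / ρ t y) (lagrangianSecondDeriv ρ t y * ρ t y) y := by
  have hne : ρ t y ≠ 0 := (h.pos t ht y).ne'
  refine (((h.density.dt h.isOpen).hasDerivAt_space hS ht y).fun_div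
    (h.density.hasDerivAt_space hS ht y) hne).congr_deriv ?_
  rw [lagrangianSecondDeriv]
  field_simp

theorem hasDerivAt_elDensity_space (h : IsPair (S + 1) I ρ θ)
    (hS : ((1 / 2 : ℝ) : WithTop ℝ) < S) (ht : t ∈ I) (y : ℝ) :
    HasDerivAt (elDensity ρ θ t)
      (2 * dt θ t y * dx (dt θ) t y +
        2 * (dt ρ t y / ρ t y) * (lagrangianSecondDeriv ρ t y * ρ t y) -
        (2 * dx (dt (dt ρ)) t y * ρ t y - 2 * dt (dt ρ) t y * dx ρ t y) / ρ t y ^ 2) y := by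
  have d1 := (h.fibre.dt h.isOpen).hasDerivAt_space hS ht y
  have d3 := h.density.hasDerivAt_space hS ht y
  have d4 := ((h.density.dt h.isOpen).dt h.isOpen).hasDerivAt_space hS ht y
  refine (((d1.fun_pow 2).fun_add ((h.hasDerivAt_quotient_space hS ht y).fun_pow 2)).fun_sub
    ((d4.const_mul 2).fun_div d3 (h.pos t ht y).ne')).congr_deriv ?_
  simp

theorem contDiff_lagrangianSecondDeriv (h : IsPair (S + 1 + 1) I ρ θ)
    (hS : ((1 / 2 : ℝ) : WithTop ℝ) < S) (ht : t ∈ I) :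
    ContDiff ℝ 1 (lagrangianSecondDeriv ρ t) := by
  have hS1 := half_lt_add_one hS
  have hρ := h.density.contDiff hS1 ht
  have hρt := (h.density.dt h.isOpen).contDiff hS1 ht
  have hρx := h.density.dx.contDiff hS ht
  have hρtx := (h.density.dt h.isOpen).dx.contDiff hS ht
  exact ((hρtx.mul hρ).sub (hρt.mul hρx)).div (hρ.pow 3) fun y =>
    pow_ne_zero 3 (h.pos t ht y).ne'

theorem differentiableAt_lagrangianSecondDeriv (h : IsPair (S + 1 + 1) I ρ θ)
    (hS : ((1 / 2 : ℝ) : WithTop ℝ) < S) (ht : t ∈ I) (y : ℝ) :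
    DifferentiableAt ℝ (fun p : ℝ × ℝ => lagrangianSecondDeriv ρ p.1 p.2) (t, y) := by
  have hI := h.isOpen
  have hS1 := half_lt_add_one hS
  have hρ := h.density.differentiableAt_uncurry hS1 hI ht y
  have hρt := (h.density.dt hI).differentiableAt_uncurry hS1 hI ht y
  have hρx := h.density.dx.differentiableAt_uncurry hS hI ht y
  have hρtx := (h.density.dt hI).dx.differentiableAt_uncurry hS hI ht y
  simp only [lagrangianSecondDeriv, div_eq_mul_inv]
  exact ((hρtx.fun_mul hρ).fun_sub (hρt.fun_mul hρx)).fun_mul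
    ((hρ.fun_pow 3).fun_inv (pow_ne_zero 3 (h.pos t ht y).ne'))

theorem hasDerivAt_lagrangianSecondDeriv_time (h : IsPair (S + 1 + 1) I ρ θ)
    (hS : ((1 / 2 : ℝ) : WithTop ℝ) < S) (ht : t ∈ I) (y : ℝ) :
    HasDerivAt (fun τ => lagrangianSecondDeriv ρ τ y)
      (-2 * (dt ρ t y / ρ t y) * lagrangianSecondDeriv ρ t y +
        dt θ t y * (dx (dt θ) t y / ρ t y) - deriv (elDensity ρ θ t) y / (2 * ρ t y)) t := by
  have hI := h.isOpen
  have hS1 := half_lt_add_one hS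
  have hne : ρ t y ≠ 0 := (h.pos t ht y).ne'
  have hρ := h.hasDerivAt_density ht y
  have hρt := h.hasDerivAt_dt_density ht y
  have hρx := h.density.dx.hasDerivAt hS1 hI ht y
  have hρtx := (h.density.dt hI).dx.hasDerivAt hS1 hI ht y
  rw [h.density.dt_dx hS1 hI ht] at hρx
  rw [(h.density.dt hI).dt_dx hS1 hI ht] at hρtx
  refine (((hρtx.fun_mul hρ).fun_sub (hρt.fun_mul hρx)).fun_div (hρ.fun_pow 3)
    (pow_ne_zero 3 hne)).congr_deriv ?_
  rw [(h.hasDerivAt_elDensity_space hS1 ht y).deriv]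
  simp only [lagrangianSecondDeriv]
  field_simp
  ring

end IsPair

namespace IsFlow

variable {s : WithTop ℝ} {I : Set ℝ} {φ a v σ : ℝ → ℝ → ℝ}

theorem antitone {s' : WithTop ℝ} (h : IsFlow s I φ a v σ)
    (hs : ((1 / 2 : ℝ) : WithTop ℝ) < s') (hss : s' ≤ s) : IsFlow s' I φ a v σ where
  isOpen := h.isOpen
  lt := hs
  curve := h.curve.anti (by gcongr)
  curve_fibre := h.curve_fibre.anti hss
  pos := h.pos
  velocity := h.velocity
  velocity_fibre := h.velocity_fibre

theorem hasStrictFDerivAt (h : IsFlow s I φ a v σ) {t : ℝ} (ht : t ∈ I) (y : ℝ) :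
    HasStrictFDerivAt (fun p : ℝ × ℝ => φ p.1 p.2)
      ((ContinuousLinearMap.toSpanSingleton ℝ (dt φ t y)).coprod
        (ContinuousLinearMap.toSpanSingleton ℝ (dx φ t y))) (t, y) := by
  have hdisp := (h.curve.hasStrictFDerivAt h.lt h.isOpen ht y).fun_add
    (hasStrictFDerivAt_snd (𝕜 := ℝ) (E := ℝ) (F := ℝ) (p := (t, y)))
  simp only [sub_add_cancel, dt_sub_id] at hdisp
  refine hdisp.congr_fderiv ?_
  ext <;> simp [dx_eq_dx_sub_id_add_one h.lt h.curve ht]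

theorem isInvertible_dx (h : IsFlow s I φ a v σ) {t : ℝ} (ht : t ∈ I) (y : ℝ) :
    ((ContinuousLinearMap.toSpanSingleton ℝ (dt φ t y)).coprod
      (ContinuousLinearMap.toSpanSingleton ℝ (dx φ t y)) ∘L
        ContinuousLinearMap.inr ℝ ℝ ℝ).IsInvertible :=
  ⟨ContinuousLinearEquiv.unitsEquivAut ℝ (Units.mk0 _ (h.pos t ht y).ne'), by ext; simp⟩

theorem hasDerivAt_invFun_time (h : IsFlow s I φ a v σ) {t : ℝ} (ht : t ∈ I) (y : ℝ) :
    HasDerivAt (fun τ => Function.invFun (φ τ) (φ t y)) (-v t (φ t y) / dx φ t y) t := by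
  have hφ := h.hasStrictFDerivAt ht y
  have hinv := h.isInvertible_dx ht y
  set ψ := hφ.implicitFunctionOfProdDomain hinv
  have hψ : ∀ᶠ τ in 𝓝 t, φ τ (ψ τ) = φ t y :=
    hφ.eventually_apply_implicitFunctionOfProdDomain hinv
  have hψt : ψ t = y :=
    (hφ.eventually_apply_eq_iff_implicitFunctionOfProdDomain hinv).self_of_nhds.mp rfl
  have hψ' : HasDerivAt ψ (deriv ψ t) t :=
    (hφ.hasStrictFDerivAt_implicitFunctionOfProdDomain hinv).differentiableAt.hasDerivAt
  have hderiv : dt φ t y + dx φ t y * deriv ψ t = 0 := by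
    have halong := hasDerivAt_along (η := φ) (hψt.symm ▸ hφ.differentiableAt) hψ'
    rw [hψt] at halong
    exact halong.unique ((hasDerivAt_const t (φ t y)).congr_of_eventuallyEq hψ)
  refine (hψ'.congr_of_eventuallyEq ?_).congr_deriv ?_
  · filter_upwards [hψ, h.isOpen.mem_nhds ht] with τ hτ hτI
    rw [← hτ, (h.isCircleDiffeo hτI).invFun_apply]
  · rw [eq_div_iff (h.pos t ht y).ne', ← h.velocity t ht]
    linear_combination hderiv

theorem hasDerivAt_comp_invFun_time (h : IsFlow s I φ a v σ) {F : ℝ → ℝ → ℝ} {t : ℝ} (ht : t ∈ I)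
    {y : ℝ} (hF : DifferentiableAt ℝ (fun p : ℝ × ℝ => F p.1 p.2) (t, y)) :
    HasDerivAt (fun τ => F τ (Function.invFun (φ τ) (φ t y)))
      (dt F t y - v t (φ t y) * (dx F t y / dx φ t y)) t := by
  have hinv : Function.invFun (φ t) (φ t y) = y := (h.isCircleDiffeo ht).invFun_apply y
  have halong := hasDerivAt_along (η := F) (hinv.symm ▸ hF) (h.hasDerivAt_invFun_time ht y)
  rw [hinv] at halong
  exact halong.congr_deriv (by ring)

theorem hasDerivAt_comp_invFun (h : IsFlow s I φ a v σ) {t : ℝ} (ht : t ∈ I) {f : ℝ → ℝ}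
    {f' x : ℝ} (hf : HasDerivAt f f' (Function.invFun (φ t) x)) :
    HasDerivAt (fun x => f (Function.invFun (φ t) x))
      (f' / dx φ t (Function.invFun (φ t) x)) x :=
  hf.comp x ((h.isCircleDiffeo ht).hasDerivAt_invFun x)

theorem contDiff_invFun (h : IsFlow s I φ a v σ) {t : ℝ} (ht : t ∈ I) :
    ContDiff ℝ 1 (Function.invFun (φ t)) := by
  have hφ := h.isCircleDiffeo ht
  refine contDiff_one_iff_deriv.mpr
    ⟨fun x => (hφ.hasDerivAt_invFun x).differentiableAt, ?_⟩
  simp only [funext fun x => (hφ.hasDerivAt_invFun x).deriv]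
  exact (hφ.continuous_deriv.comp hφ.continuous_invFun).inv₀ fun x => (hφ.pos _).ne'

section

variable {S : WithTop ℝ} {t : ℝ}

theorem hasDerivAt_velocity_fibre (h : IsFlow (S + 1) I φ a v σ)
    (hS : ((1 / 2 : ℝ) : WithTop ℝ) < S) (ht : t ∈ I) (x : ℝ) :
    HasDerivAt (σ t) (dx (dt a) t (Function.invFun (φ t) x) / dx φ t (Function.invFun (φ t) x))
      x := by
  rw [h.velocity_fibre_eq ht]
  exact h.hasDerivAt_comp_invFun ht ((h.curve_fibre.dt h.isOpen).hasDerivAt_space hS ht _)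

theorem contDiff_velocity_fibre (h : IsFlow (S + 1) I φ a v σ)
    (hS : ((1 / 2 : ℝ) : WithTop ℝ) < S) (ht : t ∈ I) : ContDiff ℝ 1 (σ t) := by
  rw [h.velocity_fibre_eq ht]
  exact ((h.curve_fibre.dt h.isOpen).contDiff hS ht).comp (h.contDiff_invFun ht)

theorem hasDerivAt_dx_velocity (h : IsFlow (S + 1) I φ a v σ)
    (hS : ((1 / 2 : ℝ) : WithTop ℝ) < S) (ht : t ∈ I) (x : ℝ) :
    HasDerivAt (dx v t) (lagrangianSecondDeriv (dx φ) t (Function.invFun (φ t) x)) x := by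
  rw [h.dx_velocity ht]
  refine (h.hasDerivAt_comp_invFun ht (f := fun y => dt (dx φ) t y / dx φ t y)
    (h.isPair.hasDerivAt_quotient_space hS ht _)).congr_deriv ?_
  exact mul_div_cancel_right₀ _ (h.pos t ht _).ne'

theorem dx_dx_velocity (h : IsFlow (S + 1) I φ a v σ)
    (hS : ((1 / 2 : ℝ) : WithTop ℝ) < S) (ht : t ∈ I) :
    dx (dx v) t = fun x => lagrangianSecondDeriv (dx φ) t (Function.invFun (φ t) x) :=
  funext fun x => (h.hasDerivAt_dx_velocity hS ht x).deriv

theorem dx_dx_dx_velocity (h : IsFlow (S + 1 + 1) I φ a v σ)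
    (hS : ((1 / 2 : ℝ) : WithTop ℝ) < S) (ht : t ∈ I) (y : ℝ) :
    dx (dx (dx v)) t (φ t y) = dx (lagrangianSecondDeriv (dx φ)) t y / dx φ t y := by
  have hL : Differentiable ℝ (lagrangianSecondDeriv (dx φ) t) :=
    (h.isPair.contDiff_lagrangianSecondDeriv hS ht).differentiable one_ne_zero
  have hcomp := (h.hasDerivAt_comp_invFun ht (x := φ t y) (hL _).hasDerivAt).deriv
  rwa [← h.dx_dx_velocity (half_lt_add_one hS) ht, (h.isCircleDiffeo ht).invFun_apply] at hcomp

theorem contDiff_velocity (h : IsFlow (S + 1 + 1) I φ a v σ)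
    (hS : ((1 / 2 : ℝ) : WithTop ℝ) < S) (ht : t ∈ I) : ContDiff ℝ 3 (v t) := by
  have hS1 := half_lt_add_one hS
  have hdd : ContDiff ℝ 1 (dx (dx v) t) := by
    rw [h.dx_dx_velocity hS1 ht]
    exact (h.isPair.contDiff_lagrangianSecondDeriv hS ht).comp (h.contDiff_invFun ht)
  have hd : ContDiff ℝ (1 + 1) (dx v t) := contDiff_succ_iff_deriv.mpr
    ⟨fun x => (h.hasDerivAt_dx_velocity hS1 ht x).differentiableAt, by simp, hdd⟩
  rw [show (3 : WithTop ℕ∞) = 1 + 1 + 1 by norm_num]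
  exact contDiff_succ_iff_deriv.mpr
    ⟨fun x => (h.hasDerivAt_velocity ht x).differentiableAt, by simp, hd⟩

theorem hasDerivAt_dx_dx_velocity_time (h : IsFlow (S + 1 + 1) I φ a v σ)
    (hS : ((1 / 2 : ℝ) : WithTop ℝ) < S) (ht : t ∈ I) (y : ℝ) :
    HasDerivAt (fun τ => dx (dx v) τ (φ t y))
      (-2 * dx v t (φ t y) * dx (dx v) t (φ t y) - v t (φ t y) * dx (dx (dx v)) t (φ t y) +
        σ t (φ t y) * dx σ t (φ t y) - deriv (elDensity (dx φ) a t) y / (2 * dx φ t y)) t := by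
  have hS1 := half_lt_add_one hS
  have hinv : Function.invFun (φ t) (φ t y) = y := (h.isCircleDiffeo ht).invFun_apply y
  have hσ : dx σ t (φ t y) = dx (dt a) t y / dx φ t y := by
    rw [dx, (h.hasDerivAt_velocity_fibre hS1 ht _).deriv, hinv]
  have hv : dx (dx v) t (φ t y) = lagrangianSecondDeriv (dx φ) t y := by
    simp only [h.dx_dx_velocity hS1 ht, hinv]
  have hL := h.hasDerivAt_comp_invFun_time ht
    (h.isPair.differentiableAt_lagrangianSecondDeriv hS ht y)
  refine (hL.congr_of_eventuallyEq ?_).congr_deriv ?_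
  · filter_upwards [h.isOpen.mem_nhds ht] with τ hτ
    rw [h.dx_dx_velocity hS1 hτ]
  · rw [dt, (h.isPair.hasDerivAt_lagrangianSecondDeriv_time hS ht y).deriv,
      h.dx_velocity_apply ht, hv, h.dx_dx_dx_velocity hS ht,
      ← h.velocity_fibre t ht, hσ]
    ring

theorem hasDerivAt_velocity_fibre_time (h : IsFlow (S + 1) I φ a v σ)
    (hS : ((1 / 2 : ℝ) : WithTop ℝ) < S) (ht : t ∈ I) (y : ℝ) :
    HasDerivAt (fun τ => σ τ (φ t y))
      (-deriv (fun x => σ t x * v t x) (φ t y) + elFibre (dx φ) a t y / dx φ t y) t := by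
  have hinv : Function.invFun (φ t) (φ t y) = y := (h.isCircleDiffeo ht).invFun_apply y
  have hσ := h.hasDerivAt_comp_invFun_time ht
    ((h.curve_fibre.dt h.isOpen).differentiableAt_uncurry hS h.isOpen ht y)
  refine (hσ.congr_of_eventuallyEq ?_).congr_deriv ?_
  · filter_upwards [h.isOpen.mem_nhds ht] with τ hτ
    rw [h.velocity_fibre_eq hτ]
  · have hne : dx φ t y ≠ 0 := (h.pos t ht y).ne'
    rw [((h.hasDerivAt_velocity_fibre hS ht _).fun_mul (h.hasDerivAt_velocity ht _)).deriv, hinv,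
      ← h.velocity_fibre t ht, elFibre]
    field_simp
    ring

theorem eulerLagrange_of_isClassicalSolution (h : IsFlow (S + 1 + 1) I φ a v σ)
    (hS : ((1 / 2 : ℝ) : WithTop ℝ) < S) (hcl : IsClassicalSolution I v σ) :
    EulerLagrange I (dx φ) a := by
  intro t ht
  have hS1 := half_lt_add_one hS
  obtain ⟨-, -, heq⟩ := hcl t ht
  constructor
  · have hconst (y : ℝ) : deriv (elDensity (dx φ) a t) y = 0 := by
      have hpos := h.pos t ht y
      have huniq := (heq (φ t y)).1.unique (h.hasDerivAt_dx_dx_velocity_time hS ht y)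
      have hquot : deriv (elDensity (dx φ) a t) y / (2 * dx φ t y) = 0 := by
        linear_combination huniq
      exact (div_eq_zero_iff.mp hquot).resolve_right (by positivity)
    exact ⟨_, fun y => is_const_of_deriv_eq_zero
      (fun y => (h.isPair.hasDerivAt_elDensity_space hS1 ht y).differentiableAt) hconst y 0⟩
  · intro y
    have huniq := (heq (φ t y)).2.unique (h.hasDerivAt_velocity_fibre_time hS1 ht y)
    have hquot : elFibre (dx φ) a t y / dx φ t y = 0 := by linear_combination -huniq
    exact (div_eq_zero_iff.mp hquot).resolve_right (h.pos t ht y).ne'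

theorem isClassicalSolution_of_eulerLagrange (h : IsFlow (S + 1 + 1) I φ a v σ)
    (hS : ((1 / 2 : ℝ) : WithTop ℝ) < S) (hEL : EulerLagrange I (dx φ) a) :
    IsClassicalSolution I v σ := by
  intro t ht
  have hS1 := half_lt_add_one hS
  obtain ⟨⟨c, hc⟩, hfibre⟩ := hEL t ht
  refine ⟨h.contDiff_velocity hS ht, h.contDiff_velocity_fibre hS1 ht, fun x => ?_⟩
  obtain ⟨y, rfl⟩ := (h.isCircleDiffeo ht).surjective x
  have hvel := h.hasDerivAt_dx_dx_velocity_time hS ht y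
  have hfib := h.hasDerivAt_velocity_fibre_time hS1 ht y
  rw [funext hc, deriv_const, zero_div, sub_zero] at hvel
  rw [hfibre, zero_div, add_zero] at hfib
  exact ⟨hvel, hfib⟩

theorem isClassicalSolution_iff_eulerLagrange (h : IsFlow (S + 1 + 1) I φ a v σ)
    (hS : ((1 / 2 : ℝ) : WithTop ℝ) < S) :
    IsClassicalSolution I v σ ↔ EulerLagrange I (dx φ) a :=
  ⟨h.eulerLagrange_of_isClassicalSolution hS, h.isClassicalSolution_of_eulerLagrange hS⟩

end

end IsFlow

/-! ### Lifts of curves in the semidirect product -/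

theorem exists_eq_add_const_of_coe_eq {p : ℝ} {f g : ℝ → ℝ} (hf : Continuous f)
    (hg : Continuous g) (h : ∀ x, (f x : AddCircle p) = (g x : AddCircle p)) :
    ∃ c, ∀ x, f x = g x + c := by
  refine ⟨f 0 - g 0, congrFun <| (AddCircle.isCoveringMap_coe p).eq_of_comp_eq hf
    (by fun_prop) (funext fun x => ?_) 0 (by ring)⟩
  simp only [Function.comp_apply, AddCircle.coe_add, AddCircle.coe_sub, h, sub_self, add_zero]

section

variable {s : WithTop ℝ} {I : Set ℝ}

theorem toCotDens_snd (hs : ((1 / 2 : ℝ) : WithTop ℝ) < s) {g : SemiDirect s} {b : Hs s}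
    (hb : ∀ x, g.α x = (((b : ℝ → ℝ) x : ℝ) : AddCircle (2 * Real.pi))) :
    g.toCotDens.2 = (constants s).mkQ b := by
  refine mkQ_eq_iff.mpr (exists_eq_add_const_of_coe_eq (p := 2 * Real.pi)
    (continuous_of_mem_Hs hs (Subtype.mem _)) (continuous_of_mem_Hs hs b.2) fun x => ?_)
  rw [← hb, g.exists_lift.choose_spec]

theorem dt_congr (hI : IsOpen I) {u w : ℝ → ℝ → ℝ} (h : ∀ t ∈ I, u t = w t) {t : ℝ}
    (ht : t ∈ I) : dt u t = dt w t := by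
  ext x
  refine EventuallyEq.deriv_eq ?_
  filter_upwards [hI.mem_nhds ht] with τ hτ
  rw [h τ hτ]

theorem IsLift.congr {k : ℕ} {γ γ' : ℝ → CotDens s} {Θ : ℝ → Hs s} (h : IsLift k I γ Θ)
    (hγ : ∀ t ∈ I, γ' t = γ t) : IsLift k I γ' Θ :=
  ⟨h.1.congr fun t ht => by rw [hγ t ht], h.2.1, fun t ht => by rw [hγ t ht, h.2.2 t ht]⟩

theorem IsGeodesic.congr {γ γ' : ℝ → CotDens s} (hI : IsOpen I) (h : IsGeodesic I γ)
    (hγ : ∀ t ∈ I, γ' t = γ t) : IsGeodesic I γ' := by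
  obtain ⟨Θ, hΘ, hcrit⟩ := h
  refine ⟨Θ, hΘ.congr hγ, fun a b hab hIcc r η hr hη hr0 hra hrb hηa hηb => ?_⟩
  have henergy : ∀ ε, energy a b (fun t x => (γ' t).density x + ε * r t x)
      (fun t x => (Θ t : ℝ → ℝ) x + ε * η t x) =
        energy a b (fun t x => (γ t).density x + ε * r t x)
          (fun t x => (Θ t : ℝ → ℝ) x + ε * η t x) := fun ε =>
    intervalIntegral.integral_congr fun t ht => by
      have htI : t ∈ I := hIcc (uIcc_of_le hab.le ▸ ht)
      have hdt := dt_congr hI (u := fun t x => (γ' t).density x + ε * r t x)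
        (w := fun t x => (γ t).density x + ε * r t x) (fun τ hτ => by rw [hγ τ hτ]) htI
      simp only [hdt, hγ t htI]
  simpa only [henergy] using hcrit a b hab hIcc r η hr hη hr0 hra hrb hηa hηb

theorem IsLift.normalize_dt_eq {γ : ℝ → CotDens s} {k : ℕ} {Θ Θ' : ℝ → Hs s}
    (hs : ((1 / 2 : ℝ) : WithTop ℝ) < s) (hI : IsOpen I) (h : IsLift (k + 1) I γ Θ)
    (h' : IsLift (k + 1) I γ Θ') {t : ℝ} (ht : t ∈ I)
    (hnorm : ∫ x in (0 : ℝ)..1, dt (fun τ => (Θ τ : ℝ → ℝ)) t x * (γ t).density x = 0) :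
    normalize (γ t).density (dt (fun τ => (Θ' τ : ℝ → ℝ)) t) =
      dt (fun τ => (Θ τ : ℝ → ℝ)) t := by
  obtain ⟨c, hc⟩ := h.exists_dt_eq hs hI h' ht
  rw [funext hc, normalize_add_const (h.1.continuous hs ht) ((h.2.1.dt hI).continuous hs ht)
    (γ t).1.2.2]
  ext x
  rw [normalize, hnorm, sub_zero]

namespace IsGroupCurve

variable {g : ℝ → SemiDirect s} {a : ℝ → ℝ → ℝ} {k : ℕ}

theorem exists_isLift (hs : ((1 / 2 : ℝ) : WithTop ℝ) < s) (h : IsGroupCurve k I g a) :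
    ∃ Θ : ℝ → Hs s, IsLift k I (fun t => (g t).toCotDens) Θ ∧ ∀ t ∈ I, (Θ t : ℝ → ℝ) = a t := by
  obtain ⟨hφ, ha, hα⟩ := h
  choose! Θ hΘ using fun t (ht : t ∈ I) =>
    (⟨⟨a t, ha.mem_Hs hs ht⟩, rfl⟩ : ∃ θ : Hs s, (θ : ℝ → ℝ) = a t)
  refine ⟨Θ, ⟨isCurve_dx_of_sub_id (φ := fun t => (g t).φ) hs hφ, ha.congr hΘ, fun t ht => ?_⟩, hΘ⟩
  exact (toCotDens_snd hs fun x => by rw [hα t ht, hΘ t ht]).symm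

theorem isCotCurve (hs : ((1 / 2 : ℝ) : WithTop ℝ) < s) (h : IsGroupCurve k I g a) :
    IsCotCurve k I fun t => (g t).toCotDens :=
  let ⟨Θ, hΘ, _⟩ := h.exists_isLift hs
  ⟨Θ, hΘ⟩

theorem isCircleDiffeo (hs : ((1 / 2 : ℝ) : WithTop ℝ) < s) (h : IsGroupCurve k I g a) {t : ℝ}
    (ht : t ∈ I) : IsCircleDiffeo (g t).φ (dx (fun τ => (g τ).φ) t) :=
  isCircleDiffeo_of_sub_id (φ := fun t => (g t).φ) hs h.1 ht (g t).deriv_pos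

theorem isEulerianVelocity (hs : ((1 / 2 : ℝ) : WithTop ℝ) < s) (h : IsGroupCurve 2 I g a) :
    IsEulerianVelocity I (fun t x => dt (fun τ => (g τ).φ) t (Function.invFun (g t).φ x))
      (fun t x => dt a t (Function.invFun (g t).φ x)) g a :=
  ⟨h, fun t ht x => by simp only [(h.isCircleDiffeo hs ht).invFun_apply x, and_self]⟩

end IsGroupCurve

/-! ### The pullback metric -/

theorem IsCircleDiffeo.lenells_eq_sasaki {φ φ' u u' α : ℝ → ℝ} (h : IsCircleDiffeo φ φ')
    (hu : ∀ x, HasDerivAt u (u' x) x) (hcont : Continuous u') (hper : Function.Periodic u' 1)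
    (hα : Continuous α) (hαper : Function.Periodic α 1) :
    lenells φ u α = sasaki φ' u' α := by
  have hφ' : Function.Periodic φ' 1 := fun x =>
    ((h.hasDerivAt (x + 1)).comp_add_const x 1).unique
      (((h.hasDerivAt x).add_const 1).congr_of_eventuallyEq (Eventually.of_forall h.add_one))
  have hne : ∀ y, φ' y ≠ 0 := fun y => (h.pos y).ne'
  have hderiv : ∀ x, deriv (u ∘ Function.invFun φ) x =
      u' (Function.invFun φ x) / φ' (Function.invFun φ x) := fun x =>
    ((hu _).comp x (h.hasDerivAt_invFun x)).deriv
  have hG : Continuous fun y => (u' y / φ' y) ^ 2 + α y ^ 2 :=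
    ((hcont.div h.continuous_deriv hne).pow 2).add (hα.pow 2)
  have hGper : Function.Periodic (fun y => (u' y / φ' y) ^ 2 + α y ^ 2) 1 := fun y => by
    simp only [hper y, hφ' y, hαper y]
  unfold lenells lenellsOne sasaki
  simp only [hderiv, Function.comp_apply, h.integral_comp_invFun hG hGper]
  congr 1
  refine intervalIntegral.integral_congr fun y _ => ?_
  have := hne y
  field_simp

theorem IsGroupCurve.sasaki_eq_lenells {g : ℝ → SemiDirect s} {a : ℝ → ℝ → ℝ}
    (hs : ((1 / 2 : ℝ) : WithTop ℝ) < s) (hI : IsOpen I) (h : IsGroupCurve 1 I g a) {t : ℝ}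
    (ht : t ∈ I) {ρd θd : ℝ → ℝ} (hv : IsVelocity I (fun τ => (g τ).toCotDens) t ρd θd)
    (h0 : ∫ x in (0 : ℝ)..1, dt a t (Function.invFun (g t).φ x) = 0) :
    sasaki (g t).toCotDens.density ρd θd =
      lenells (g t).φ (dt (fun τ => (g τ).φ) t) (dt a t) := by
  obtain ⟨Θ, hΘ, hΘa⟩ := h.exists_isLift hs
  obtain ⟨Θ', hΘ', rfl, rfl⟩ := hv
  have hφ := h.isCircleDiffeo hs ht
  have hda : dt (fun τ => (Θ τ : ℝ → ℝ)) t = dt a t := dt_congr hI hΘa ht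
  have cdφ : IsCurve 0 (s + 1) I (dt fun τ => (g τ).φ) := by
    simpa only [dt_sub_id (fun τ => (g τ).φ)] using h.1.dt hI
  have cda : IsCurve 0 s I (dt a) := h.2.1.dt hI
  have hnorm :
      ∫ x in (0 : ℝ)..1, dt (fun τ => (Θ τ : ℝ → ℝ)) t x * (g t).toCotDens.density x = 0 := by
    rw [hda]
    exact (hφ.integral_comp_invFun (cda.continuous hs ht) (cda.periodic hs ht)).symm.trans h0
  have hdρ : dt (fun τ => (g τ).toCotDens.density) t = dx (dt fun τ => (g τ).φ) t :=
    dt_dx_of_sub_id (φ := fun τ => (g τ).φ) hs hI h.1 ht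
  rw [hΘ.normalize_dt_eq (k := 0) hs hI hΘ' ht hnorm, hda, hdρ]
  exact (hφ.lenells_eq_sasaki (cdφ.hasDerivAt_space hs ht) (cdφ.dx.continuous hs ht)
    (cdφ.dx.periodic hs ht) (cda.continuous hs ht) (cda.periodic hs ht)).symm

end

/-! ### Solutions and geodesics -/

theorem IsFlow.integral_velocity_fibre_eq {s : WithTop ℝ} {I : Set ℝ} {φ a v σ : ℝ → ℝ → ℝ}
    (h : IsFlow s I φ a v σ) (hI' : I.OrdConnected) (hEL : EulerLagrange I (dx φ) a) {t t' : ℝ}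
    (ht : t ∈ I) (ht' : t' ∈ I) :
    ∫ x in (0 : ℝ)..1, σ t x = ∫ x in (0 : ℝ)..1, σ t' x := by
  have hmomentum : ∀ x, dt a t x * dx φ t x = dt a t' x * dx φ t' x := fun x =>
    h.isOpen.is_const_of_deriv_eq_zero hI'.isPreconnected
      (fun τ hτ => (h.isPair.hasDerivAt_momentum hτ x).differentiableAt.differentiableWithinAt)
      (fun τ hτ => (h.isPair.hasDerivAt_momentum hτ x).deriv.trans ((hEL τ hτ).2 x)) ht ht'
  simp only [h.integral_velocity_fibre ht, h.integral_velocity_fibre ht', hmomentum]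

namespace IsEulerianVelocity

variable {s : WithTop ℝ} {I : Set ℝ} {g g' : ℝ → SemiDirect s} {a a' v v' σ σ' : ℝ → ℝ → ℝ}

theorem exists_isFlow (hs : ((1 / 2 : ℝ) : WithTop ℝ) < s) (hI : IsOpen I)
    (h : IsEulerianVelocity I v σ g a) :
    ∃ Θ : ℝ → Hs s, IsLift 2 I (fun t => (g t).toCotDens) Θ ∧
      IsFlow s I (fun t => (g t).φ) (fun t => (Θ t : ℝ → ℝ)) v σ := by
  obtain ⟨Θ, hΘ, hΘa⟩ := h.1.exists_isLift hs
  exact ⟨Θ, hΘ, hI, hs, h.1.1, hΘ.2.1, fun t _ => (g t).deriv_pos, fun t ht x => (h.2 t ht x).1,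
    fun t ht x => by rw [dt_congr hI hΘa ht, (h.2 t ht x).2]⟩

theorem isWeakSolution_iff_isGeodesic (hs : ((1 / 2 : ℝ) : WithTop ℝ) < s) (hI : IsOpen I)
    (hI' : I.OrdConnected) (h : IsEulerianVelocity I v σ g a) {t₀ : ℝ} (ht₀ : t₀ ∈ I) :
    (IsWeakSolution I v σ ∧ ∫ x in (0 : ℝ)..1, σ t₀ x = 0) ↔
      (IsGeodesic I (fun t => (g t).toCotDens) ∧ ∀ t ∈ I, ∫ x in (0 : ℝ)..1, σ t x = 0) := by
  obtain ⟨Θ, hΘ, hflow⟩ := h.exists_isFlow hs hI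
  rw [hflow.isWeakSolution_iff_eulerLagrange hI' ⟨t₀, ht₀⟩]
  have hgeod (h0 : ∀ t ∈ I, ∫ x in (0 : ℝ)..1, σ t x = 0) :
      IsGeodesic I (fun t => (g t).toCotDens) ↔
        EulerLagrange I (dx fun t => (g t).φ) fun t => (Θ t : ℝ → ℝ) :=
    isGeodesic_iff_eulerLagrange hs hI hI' hΘ fun t ht =>
      (hflow.integral_velocity_fibre ht).symm.trans (h0 t ht)
  constructor
  · rintro ⟨hEL, h0⟩
    have hmean : ∀ t ∈ I, ∫ x in (0 : ℝ)..1, σ t x = 0 := fun t ht =>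
      (hflow.integral_velocity_fibre_eq hI' hEL ht ht₀).trans h0
    exact ⟨(hgeod hmean).mpr hEL, hmean⟩
  · rintro ⟨hγ, hmean⟩
    exact ⟨(hgeod hmean).mp hγ, hmean t₀ ht₀⟩

theorem isWeakSolution_iff_isClassicalSolution (hs : ((5 / 2 : ℝ) : WithTop ℝ) < s)
    (hI : IsOpen I) (hI' : I.OrdConnected) (hne : I.Nonempty)
    (h : IsEulerianVelocity I v σ g a) : IsWeakSolution I v σ ↔ IsClassicalSolution I v σ := by
  obtain ⟨r, hr, hrs⟩ := exists_exponent hs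
  have hS : ((1 / 2 : ℝ) : WithTop ℝ) < ((r - 2 : ℝ) : WithTop ℝ) :=
    WithTop.coe_lt_coe.mpr (by linarith)
  have hle : ((r - 2 : ℝ) : WithTop ℝ) + 1 + 1 ≤ s := by
    refine le_trans (le_of_eq ?_) hrs
    exact_mod_cast (by ring : r - 2 + 1 + 1 = r)
  have hS2 := half_lt_add_one (half_lt_add_one hS)
  obtain ⟨Θ, -, hflow⟩ := h.exists_isFlow (hS2.trans_le hle) hI
  exact (hflow.isWeakSolution_iff_eulerLagrange hI' hne).trans
    ((hflow.antitone hS2 hle).isClassicalSolution_iff_eulerLagrange hS).symm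

/-- The fixed point determines the integration constant of `φ`, and the mean of `σ` that of
`dt a`. -/
theorem eq_of_toCotDens_eq (hs : ((1 / 2 : ℝ) : WithTop ℝ) < s) (hI : IsOpen I)
    (h : IsEulerianVelocity I v σ g a) (h' : IsEulerianVelocity I v' σ' g' a') {x₀ : ℝ}
    (hx₀ : ∀ t ∈ I, (g' t).φ x₀ = (g t).φ x₀)
    (hg : ∀ t ∈ I, (g' t).toCotDens = (g t).toCotDens)
    (hmean : ∀ t ∈ I, ∫ x in (0 : ℝ)..1, σ t x = 0)
    (hmean' : ∀ t ∈ I, ∫ x in (0 : ℝ)..1, σ' t x = 0) {t : ℝ} (ht : t ∈ I) :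
    v' t = v t ∧ σ' t = σ t := by
  obtain ⟨Θ, hΘ, hflow⟩ := h.exists_isFlow hs hI
  obtain ⟨Θ', hΘ', hflow'⟩ := h'.exists_isFlow hs hI
  have hφ : ∀ t ∈ I, (g' t).φ = (g t).φ := fun t ht =>
    eq_of_fderiv_eq ((g' t).contDiff_φ.differentiable one_ne_zero)
      ((g t).contDiff_φ.differentiable one_ne_zero)
      (fun x => by
        have hderiv : deriv (g' t).φ = deriv (g t).φ := congrArg CotDens.density (hg t ht)
        rw [← toSpanSingleton_deriv, ← toSpanSingleton_deriv, hderiv]) x₀ (hx₀ t ht)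
  have hdΘ : dt (fun τ => (Θ' τ : ℝ → ℝ)) t = dt (fun τ => (Θ τ : ℝ → ℝ)) t := by
    have hnorm := (hflow.integral_velocity_fibre ht).symm.trans (hmean t ht)
    have hnorm' := (hflow'.integral_velocity_fibre ht).symm.trans (hmean' t ht)
    have hΘ'g : IsLift 2 I (fun t => (g t).toCotDens) Θ' := hΘ'.congr fun t ht => (hg t ht).symm
    rw [← hΘ.normalize_dt_eq hs hI hΘ'g ht hnorm, ← hg t ht,
      hΘ'.normalize_dt_eq hs hI hΘ' ht hnorm']
  constructor
  · rw [hflow'.velocity_eq ht, hflow.velocity_eq ht, dt_congr hI hφ ht, hφ t ht]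
  · rw [hflow'.velocity_fibre_eq ht, hflow.velocity_fibre_eq ht, hdΘ, hφ t ht]

end IsEulerianVelocity

/-! ### Reconstruction of a curve in the semidirect product from its image -/

section

variable {s : WithTop ℝ}

/-- The function with value `x₀` at `x₀` and derivative `ρ`, when `ρ` has integral one over a
period. -/
def reconstructMap (x₀ : ℝ) (ρ : ℝ → ℝ) (x : ℝ) : ℝ := x + (primitive ρ x - primitive ρ x₀)

theorem hasDerivAt_reconstructMap (x₀ : ℝ) {ρ : ℝ → ℝ} (hρ : Continuous ρ)
    (h1 : ∫ x in (0 : ℝ)..1, ρ x = 1) (x : ℝ) : HasDerivAt (reconstructMap x₀ ρ) (ρ x) x := by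
  refine ((hasDerivAt_id x).add
    ((hasDerivAt_primitive hρ x).sub_const (primitive ρ x₀))).congr_deriv ?_
  rw [h1, add_sub_cancel]

theorem reconstructMap_sub_id_mem_Hs (x₀ : ℝ) {ρ : ℝ → ℝ} (hρ : ρ ∈ Hs s) :
    (fun x => reconstructMap x₀ ρ x - x) ∈ Hs (s + 1) := by
  simp only [reconstructMap, add_sub_cancel_left]
  exact (Hs (s + 1)).sub_mem (primitive_mem_Hs hρ) (const_mem_Hs _ _)

theorem reconstructMap_self (x₀ : ℝ) (ρ : ℝ → ℝ) : reconstructMap x₀ ρ x₀ = x₀ := by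
  simp only [reconstructMap, sub_self, add_zero]

theorem deriv_reconstructMap (hs : ((1 / 2 : ℝ) : WithTop ℝ) < s) (x₀ : ℝ) (ρ : Dens s) :
    deriv (reconstructMap x₀ ((ρ : Hs s) : ℝ → ℝ)) = ((ρ : Hs s) : ℝ → ℝ) :=
  funext fun x =>
    (hasDerivAt_reconstructMap x₀ (continuous_of_mem_Hs hs ρ.1.2) ρ.2.2 x).deriv

/-- The element of the semidirect product, with diffeomorphism fixing `x₀`, over the density `ρ`
and the function `θ`. -/
def reconstruct (hs : ((1 / 2 : ℝ) : WithTop ℝ) < s) (x₀ : ℝ) (ρ : Dens s) (θ : Hs s) :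
    SemiDirect s where
  φ := reconstructMap x₀ ((ρ : Hs s) : ℝ → ℝ)
  contDiff_φ := by
    have hρ := continuous_of_mem_Hs hs ρ.1.2
    rw [contDiff_one_iff_deriv, deriv_reconstructMap hs]
    exact ⟨fun x => (hasDerivAt_reconstructMap x₀ hρ ρ.2.2 x).differentiableAt, hρ⟩
  periodic_φ := periodic_of_mem_Hs (half_lt_add_one hs) (reconstructMap_sub_id_mem_Hs x₀ ρ.1.2)
  mem_φ := reconstructMap_sub_id_mem_Hs x₀ ρ.1.2
  deriv_pos x := by
    rw [deriv_reconstructMap hs]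
    exact ρ.2.1 x
  α x := (((θ : ℝ → ℝ) x : ℝ) : AddCircle (2 * Real.pi))
  exists_lift := ⟨θ, fun _ => rfl⟩

theorem toCotDens_reconstruct (hs : ((1 / 2 : ℝ) : WithTop ℝ) < s) (x₀ : ℝ) (ρ : Dens s)
    (θ : Hs s) : (reconstruct hs x₀ ρ θ).toCotDens = (ρ, (constants s).mkQ θ) :=
  Prod.ext (Subtype.ext (Subtype.ext (deriv_reconstructMap hs x₀ ρ)))
    (toCotDens_snd hs fun _ => rfl)

variable {I : Set ℝ} {γ : ℝ → CotDens s}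

theorem isGroupCurve_reconstruct {k : ℕ} (hs : ((1 / 2 : ℝ) : WithTop ℝ) < s) (x₀ : ℝ)
    {Θ : ℝ → Hs s} (h : IsLift k I γ Θ) :
    IsGroupCurve k I (fun t => reconstruct hs x₀ (γ t).1 (Θ t)) (fun t => (Θ t : ℝ → ℝ)) := by
  refine ⟨?_, h.2.1, fun t _ x => rfl⟩
  have hprim := h.1.primitive hs
  have hx₀ : ContDiffOn ℝ k (fun t => -primitive (γ t).density x₀) I :=
    (hprim.eval (half_lt_add_one hs) x₀).neg
  refine (hprim.add (isCurve_scalar hx₀)).congr fun t _ => funext fun x => ?_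
  change reconstructMap x₀ (γ t).density x - x = _
  rw [reconstructMap, add_sub_cancel_left, sub_eq_add_neg]

theorem exists_contDiffOn_primitive {n : ℕ} (hI : IsOpen I) (hI' : I.OrdConnected) {m : ℝ → ℝ}
    (hm : ContDiffOn ℝ n m I) :
    ∃ M : ℝ → ℝ, ContDiffOn ℝ (n + 1 : ℕ) M I ∧ ∀ t ∈ I, HasDerivAt M (m t) t := by
  rcases I.eq_empty_or_nonempty with rfl | ⟨t₀, ht₀⟩
  · exact ⟨0, contDiffOn_empty, fun t ht => ht.elim⟩
  have hM : ∀ t ∈ I, HasDerivAt (fun t => ∫ τ in t₀..t, m τ) (m t) t := fun t ht =>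
    intervalIntegral.integral_hasDerivAt_right
      (hm.continuousOn.mono (hI'.uIcc_subset ht₀ ht)).intervalIntegrable
      (hm.continuousOn.stronglyMeasurableAtFilter hI t ht)
      (hm.continuousOn.continuousAt (hI.mem_nhds ht))
  refine ⟨_, ?_, hM⟩
  rw [Nat.cast_add, Nat.cast_one, contDiffOn_succ_iff_deriv_of_isOpen hI]
  exact ⟨fun t ht => (hM t ht).differentiableAt.differentiableWithinAt, by simp,
    hm.congr fun t ht => (hM t ht).deriv⟩

theorem integral_normalize_mul {ρ f : ℝ → ℝ} (hρ : Continuous ρ) (hf : Continuous f)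
    (h1 : ∫ x in (0 : ℝ)..1, ρ x = 1) : ∫ x in (0 : ℝ)..1, normalize ρ f x * ρ x = 0 := by
  have hfρ : Continuous fun x => f x * ρ x := hf.mul hρ
  simp only [normalize, sub_mul]
  rw [intervalIntegral.integral_sub (hfρ.intervalIntegrable 0 1)
    ((hρ.const_mul _).intervalIntegrable 0 1), intervalIntegral.integral_const_mul, h1, mul_one,
    sub_self]

theorem IsLift.exists_normalized {k : ℕ} (hs : ((1 / 2 : ℝ) : WithTop ℝ) < s) (hI : IsOpen I)
    (hI' : I.OrdConnected) {Θ₀ : ℝ → Hs s} (h : IsLift (k + 1) I γ Θ₀) :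
    ∃ Θ : ℝ → Hs s, IsLift (k + 1) I γ Θ ∧
      ∀ t ∈ I, ∫ x in (0 : ℝ)..1, dt (fun τ => (Θ τ : ℝ → ℝ)) t x * (γ t).density x = 0 := by
  obtain ⟨hρ, hΘ₀, hγ⟩ := h
  have hdt : IsCurve k s I (dt fun t => (Θ₀ t : ℝ → ℝ)) := hΘ₀.dt hI
  obtain ⟨M, hM, hM'⟩ := exists_contDiffOn_primitive hI hI'
    (hdt.integral_mul hs (hρ.of_le k.le_succ))
  let Θ : ℝ → Hs s := fun t => Θ₀ t + ⟨fun _ => -M t, const_mem_Hs s _⟩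
  have hΘ : ∀ t x, (Θ t : ℝ → ℝ) x = (Θ₀ t : ℝ → ℝ) x + -M t := fun t x => rfl
  refine ⟨Θ, ⟨hρ, (hΘ₀.add (isCurve_scalar (c := fun t => -M t) hM.neg)).congr
    fun t _ => funext (hΘ t), fun t ht => ?_⟩, fun t ht => ?_⟩
  · rw [← hγ t ht]
    exact mkQ_eq_iff.mpr ⟨-M t, hΘ t⟩
  · have hdtΘ : ∀ x, dt (fun τ => (Θ τ : ℝ → ℝ)) t x =
        normalize (γ t).density (dt (fun τ => (Θ₀ τ : ℝ → ℝ)) t) x := fun x =>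
      ((hΘ₀.hasDerivAt hs hI ht x).add (hM' t ht).neg).deriv
    simp only [hdtΘ]
    exact integral_normalize_mul (hρ.continuous hs ht) (hdt.continuous hs ht) (γ t).1.2.2

theorem IsCotCurve.exists_isEulerianVelocity (hs : ((1 / 2 : ℝ) : WithTop ℝ) < s) (hI : IsOpen I)
    (hI' : I.OrdConnected) (h : IsCotCurve 2 I γ) (x₀ : ℝ) :
    ∃ (v σ : ℝ → ℝ → ℝ) (g : ℝ → SemiDirect s) (a : ℝ → ℝ → ℝ),
      IsEulerianVelocity I v σ g a ∧ (∀ t ∈ I, (g t).φ x₀ = x₀) ∧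
        (∀ t ∈ I, (g t).toCotDens = γ t) ∧ ∀ t ∈ I, ∫ x in (0 : ℝ)..1, σ t x = 0 := by
  obtain ⟨Θ₀, hΘ₀⟩ := h
  obtain ⟨Θ, hΘ, hnorm⟩ := hΘ₀.exists_normalized hs hI hI'
  have hg := isGroupCurve_reconstruct hs x₀ hΘ
  refine ⟨_, _, _, _, hg.isEulerianVelocity hs, fun t _ => reconstructMap_self _ _,
    fun t ht => ?_, fun t ht => ?_⟩
  · rw [toCotDens_reconstruct, hΘ.2.2 t ht]
  · have hdt := hΘ.2.1.dt hI
    have hjac : dx (fun t => (reconstruct hs x₀ (γ t).1 (Θ t)).φ) t = (γ t).density :=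
      deriv_reconstructMap hs x₀ (γ t).1
    rw [(hg.isCircleDiffeo hs ht).integral_comp_invFun (hdt.continuous hs ht)
      (hdt.periodic hs ht), hjac]
    exact hnorm t ht

end

end HunterSaxton

end

open HunterSaxton in
theorem proposition3p5 (s : WithTop ℝ) (hs : ((1 / 2 : ℝ) : WithTop ℝ) < s) (x₀ : ℝ)
    (I : Set ℝ) (hI : IsOpen I) (hI' : I.OrdConnected) (t₀ : ℝ) (ht₀ : t₀ ∈ I) :
    -- on vectors of mean zero, the metric of the semidirect product is the pullback
    (∀ (g : ℝ → SemiDirect s) (a : ℝ → ℝ → ℝ), IsGroupCurve 1 I g a →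
      IsCotCurve 1 I (fun t => (g t).toCotDens) ∧
      ∀ t ∈ I, ∀ ρd θd : ℝ → ℝ, IsVelocity I (fun τ => (g τ).toCotDens) t ρd θd →
        ∫ x in (0 : ℝ)..1, dt a t (Function.invFun (g t).φ x) = 0 →
        sasaki (g t).toCotDens.density ρd θd =
          lenells (g t).φ (dt (fun τ => (g τ).φ) t) (dt a t)) ∧
    -- mean-zero solutions correspond to geodesics
    (∀ (v σ : ℝ → ℝ → ℝ) (g : ℝ → SemiDirect s) (a : ℝ → ℝ → ℝ), IsEulerianVelocity I v σ g a →
      ((IsWeakSolution I v σ ∧ ∫ x in (0 : ℝ)..1, σ t₀ x = 0) ↔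
        (IsGeodesic I (fun t => (g t).toCotDens) ∧ ∀ t ∈ I, ∫ x in (0 : ℝ)..1, σ t x = 0)) ∧
      (((5 / 2 : ℝ) : WithTop ℝ) < s → (IsWeakSolution I v σ ↔ IsClassicalSolution I v σ))) ∧
    -- every geodesic comes from exactly one such solution
    (∀ γ : ℝ → CotDens s, IsGeodesic I γ →
      ∃ (v σ : ℝ → ℝ → ℝ) (g : ℝ → SemiDirect s) (a : ℝ → ℝ → ℝ),
        (IsEulerianVelocity I v σ g a ∧ (∀ t ∈ I, (g t).φ x₀ = x₀) ∧
          ∀ t ∈ I, (g t).toCotDens = γ t) ∧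
        IsWeakSolution I v σ ∧ (∀ t ∈ I, ∫ x in (0 : ℝ)..1, σ t x = 0) ∧
        ∀ (v' σ' : ℝ → ℝ → ℝ) (g' : ℝ → SemiDirect s) (a' : ℝ → ℝ → ℝ),
          IsEulerianVelocity I v' σ' g' a' → (∀ t ∈ I, (g' t).φ x₀ = x₀) →
          (∀ t ∈ I, (g' t).toCotDens = γ t) → (∀ t ∈ I, ∫ x in (0 : ℝ)..1, σ' t x = 0) →
          ∀ t ∈ I, v' t = v t ∧ σ' t = σ t) := by
  refine ⟨fun g a h => ⟨h.isCotCurve hs, fun t ht ρd θd hv h0 =>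
      h.sasaki_eq_lenells hs hI ht hv h0⟩,
    fun v σ g a h => ⟨h.isWeakSolution_iff_isGeodesic hs hI hI' ht₀, fun hs' =>
      h.isWeakSolution_iff_isClassicalSolution hs' hI hI' ⟨t₀, ht₀⟩⟩, fun γ hγ => ?_⟩
  have hcurve : IsCotCurve 2 I γ := hγ.imp fun _ hΘ => hΘ.1
  obtain ⟨v, σ, g, a, h, hx₀, hg, hmean⟩ := hcurve.exists_isEulerianVelocity hs hI hI' x₀
  have hweak : IsWeakSolution I v σ :=
    ((h.isWeakSolution_iff_isGeodesic hs hI hI' ht₀).mpr ⟨hγ.congr hI hg, hmean⟩).1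
  exact ⟨v, σ, g, a, ⟨h, hx₀, hg⟩, hweak, hmean, fun v' σ' g' a' h' hx₀' hg' hmean' t ht =>
    h.eq_of_toCotDens_eq hs hI h' (fun t ht => (hx₀' t ht).trans (hx₀ t ht).symm)
      (fun t ht => (hg' t ht).trans (hg t ht).symm) hmean hmean' ht⟩
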